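/- Fix $a>0$. Let $\sigma(t)=\frac2\pi\sqrt{1-t^2}$ for $|t|\le 1$, let $\rho(u)=\frac{2}{\pi(1+4a^2)}\sqrt{(1+4a^2-u^2)_+}$, and for $R,\eta>0$ let $\Omega_{R,\eta}=\{z\in\mathbb C:\ |\mathrm{Re}\,z|\le R,\ \eta\le|\mathrm{Im}\,z|\le R\}$. For $N\ge1$, $y\in\mathbb R^N$, $S>0$ and $x,v\in\mathbb R$ put $$K_N^{S}(x,v;y)=\frac{e^{(v^2-x^2)/2S}}{(v-x)S(2\pi i)^2}\int_\gamma dz\int_\Gamma dw\,(1-e^{(v-x)z/S})\frac1z\Big(w+z-v-S\sum_{j=1}^N\frac{y_j}{(w-y_j)(z-y_j)}\Big)\prod_{j=1}^N\frac{w-y_j}{z-y_j}\;e^{(w^2-2vw-z^2+2xz)/2S},$$ where $\gamma$ is the union of the lines $t\mapsto -t+i\kappa$ and $t\mapsto t-i\kappa$ ($t\in\mathbb R$) for a fixed $\kappa>0$, and $\Gamma$ is the line $t\mapsto it$ ($t\in\mathbb R$); for $v=x$ the quotient $(1-e^{(v-x)z/S})/(v-x)$ is replaced by its limit $-z/S$.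 For $\omega\in\mathbb R$ put $$\mathcal K_N^{\omega}(x,v;y)=e^{\frac{N(x^2-v^2)}{2a^2}+\omega(v-x)}\,K_N^{a^2/N}(x,v;y).$$ For $|u|\le\sqrt{1/2+2a^2}$ let $\theta_c\in[0,\pi]$ be given by $u=\sqrt{1+4a^2}\cos\theta_c$ and put $\omega_0(u)=\pi\frac{1+2a^2}{2a^2}\cot\theta_c$. Let $\xi\in(0,1/2]$ and let $K\subset\mathbb R$ be compact. Then there are $R_0>0$ and $\eta_0>0$ such that for every constant $C_0$ and every real sequence $\varepsilon_N\to0$ there is a constant $C$ with the following property. Let $N\ge1$, and let $y\in\mathbb R^N$ satisfy $$\sup_{z\in\Omega_{R_0,\eta_0}}\Big|\frac1N\sum_{j=1}^N\log(z-y_j)-\int_{-1}^1\log(z-t)\sigma(t)\,dt\Big|\le C_0N^{-\xi}$$ (principal branch of the logarithm). Then for all $\tau\in K$, all $u$ with $|u|\le\sqrt{1/2+2a^2}$, and all real $u_N$ with $|u_N-u|\le\varepsilon_N$, $$\left|\frac1{N\rho(u)}\mathcal K_N^{\omega}\Big(u_N,u_N+\frac{\tau}{N\rho(u)};y\Big)-\frac{\sin\pi\tau}{\pi\tau}\right|\le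 C\big(|u-u_N|+N^{-\xi}\big),\qquad \omega=\omega_0(u)\,N\rho(u),$$ where $\frac{\sin\pi\tau}{\pi\tau}=1$ at $\tau=0$. -/

import Mathlib

open Filter Topology

noncomputable section

namespace WignerKernel

/-- The domain `Ω_{R,η} = {z : |Re z| ≤ R, η ≤ |Im z| ≤ R}`. -/
def Omega (R η : ℝ) : Set ℂ :=
  {z : ℂ | |z.re| ≤ R ∧ η ≤ |z.im| ∧ |z.im| ≤ R}

/-- The semicircle density `σ(t) = (2/π) √(1 - t²)` on `[-1, 1]`. -/
def semicircle (t : ℝ) : ℝ := 2 / Real.pi * Real.sqrt (1 - t ^ 2)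

/-- The logarithmic potential `∫_{-1}^1 log (z - t) σ(t) dt` (principal branch). -/
def semicirclePotential (z : ℂ) : ℂ :=
  ∫ t in (-1 : ℝ)..1, Complex.log (z - (t : ℂ)) * (semicircle t : ℂ)

/-- The set `Y_{R,η} ⊆ ℝ^N`, for a given constant `C` and exponent `ξ`: the points `y` with
`sup_{z ∈ Ω_{R,η}} |(1/N) ∑_j log (z - y_j) - ∫ log (z - t) σ(t) dt| ≤ C N^{-ξ}`. -/
def goodPoints (R η ξ C : ℝ) (N : ℕ) : Set (Fin N → ℝ) :=
  {y | ∀ z ∈ Omega R η,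
    ‖(1 / (N : ℂ)) * ∑ j, Complex.log (z - (y j : ℂ)) - semicirclePotential z‖
      ≤ C * (N : ℝ) ^ (-ξ)}

/-- The limiting density `ρ(u) = 2 / (π (1 + 4a²)) √((1 + 4a² - u²)_+)`. -/
def rho (a u : ℝ) : ℝ :=
  2 / (Real.pi * (1 + 4 * a ^ 2)) * Real.sqrt (max (1 + 4 * a ^ 2 - u ^ 2) 0)

/-- `∫_γ F(z) dz`, where `γ` is the union of the two lines `t ↦ -t + iκ` and `t ↦ t - iκ`,
`t ∈ ℝ`. -/
def integralGamma (κ : ℝ) (F : ℂ → ℂ) : ℂ :=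
  (∫ t : ℝ, F (-(t : ℂ) + Complex.I * (κ : ℂ)) * (-1)) +
    ∫ t : ℝ, F ((t : ℂ) - Complex.I * (κ : ℂ))

/-- `∫_Γ F(w) dw`, where `Γ` is the line `t ↦ it`, `t ∈ ℝ`. -/
def integralVertical (F : ℂ → ℂ) : ℂ :=
  ∫ t : ℝ, F (Complex.I * (t : ℂ)) * Complex.I

/-- The factor `(1 - e^{(v-u)z/S}) / ((v-u) S z)`, extended to `u = v` by its limit `-1/S²`. -/
def kernelFactor (S u v : ℝ) (z : ℂ) : ℂ :=
  if u = v then -1 / (S : ℂ) ^ 2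
  else (1 - Complex.exp (((v : ℂ) - u) * z / S)) / (((v : ℂ) - u) * S * z)

/-- The correlation kernel `K_N^S(u, v; y)` of `N` Brownian motions started at `y_1, …, y_N` and
conditioned never to intersect, at time `S`, in its double contour integral form. -/
def kernel (κ S : ℝ) {N : ℕ} (y : Fin N → ℝ) (u v : ℝ) : ℂ :=
  Complex.exp (((v : ℂ) ^ 2 - (u : ℂ) ^ 2) / (2 * S)) / (2 * Real.pi * Complex.I) ^ 2 *
    integralGamma κ fun z => integralVertical fun w =>
      kernelFactor S u v z *
        (w + z - v - S * ∑ j, (y j : ℂ) / ((w - y j) * (z - y j))) *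
        (∏ j, (w - y j) / (z - y j)) *
        Complex.exp ((w ^ 2 - 2 * v * w - z ^ 2 + 2 * u * z) / (2 * S))

/-- The constant `ω₀ = π (1 + 2a²) / (2a²) · cot θ_c`, where `u = √(1 + 4a²) cos θ_c` with
`θ_c ∈ [0, π]`. -/
def omegaZero (a u : ℝ) : ℝ :=
  Real.pi * ((1 + 2 * a ^ 2) / (2 * a ^ 2)) *
    Real.cot (Real.arccos (u / Real.sqrt (1 + 4 * a ^ 2)))

/-- The conjugated kernel
`𝒦_N(x, x'; y) = e^{N (x² - x'²) / (2a²) + ω (x' - x)} K_N^{a²/N}(x, x'; y)`. -/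
def conjKernel (κ a ω : ℝ) {N : ℕ} (y : Fin N → ℝ) (x x' : ℝ) : ℂ :=
  Complex.exp ((N : ℂ) * ((x : ℂ) ^ 2 - (x' : ℂ) ^ 2) / (2 * (a : ℂ) ^ 2) +
      (ω : ℂ) * ((x' : ℂ) - x)) *
    kernel κ (a ^ 2 / N) y x x'

end WignerKernel

end

/-!
The proof is the method of steepest descent for the double contour integral, carried out uniformly
in the starting points `y`.

With `S = a² / N` the integrand is a finite sum of products of a function of `z` and a function of
`w`, each carrying the factor `e^{∓N f}` for the phase `f(z) = (z² - 2uz) / (2a²) + (1/N) ∑_j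
log (z - y_j)` (`integrand_eq`); the sum over `j` in the integrand is split by
`y / ((w - y)(z - y)) = (w / (w - y) - 1) / (z - y)`. Hence the kernel is a combination of products
of single integrals, whose contours can be moved through a saddle point `p` of `f` in the upper half
plane and its conjugate (`kernel_eq_separatedIntegral`).

At a saddle point the imaginary part of `f'(p) = 0` says that the average of `1 / |p - y_j|²` is
`1 / a²`. Together with the arithmetic-geometric mean inequality this gives Gaussian decay of
`e^{N f}` on the whole vertical line through `p`, whatever the points `y_j`
(`norm_weight_vertical_le`), and `Re f''(p) ≥ 2 (Im p)² / a⁴` (`le_curvature_re`). It also makes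
the pairs `(p, p̄)` of saddle points negligible: their amplitudes cancel up to `O(1/N)`
(`sum_mixed_amplitudes`), so that no singularity at coinciding saddle points is met. For the
pairs `(p, p)` the amplitudes add up to a multiple of `f''(p)`, which cancels the Gaussian
normalization, and the kernel is `Im (p (1 - e^{-αp}) / (αp))` up to explicit factors and a relative
error `O(N^{-1/2})` (`separatedIntegral_asymptotics`).

The saddle point `p` comes from the limit `N → ∞`. The hypothesis on the logarithmic potentials and
Cauchy's estimate bound the difference between the Stieltjes transform of `y` and that of the
semicircle law. The latter is explicit in the Joukowski coordinate, and so is the limiting saddle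
point: its imaginary part is `π a² ρ(u)`, and `ω₀` is `π` times the quotient of its real and
imaginary parts. On the horizontal line through it the phase grows strictly in both directions
(`limitPhaseDeriv_re_pos`). Both facts
are stable under small perturbations (`exists_saddle`), with `|p - p_lim| = O(|u - u_N| + N^{-ξ})`.
At the limiting saddle point the main term is exactly the sine kernel
(`limitSaddle_leading_term`), and it is Lipschitz in `p`. The finitely many `N` for which the
perturbation is not small are covered by a crude bound of the kernel that is uniform in `y`
(`exists_norm_kernel_le`).
-/

noncomputable section

namespace WignerKernel

open MeasureTheory Complex

/-! ### Contour shifts and Gaussian bounds -/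

theorem integrable_of_norm_le_gaussian {f : ℝ → ℂ} (hf : AEStronglyMeasurable f) {C c : ℝ}
    (hc : 0 < c) (h : ∀ t, ‖f t‖ ≤ C * Real.exp (-c * t ^ 2)) : Integrable f :=
  ((integrable_exp_neg_mul_sq hc).const_mul C).mono' hf (ae_of_all _ h)

/-- Horizontal lines bounding a strip carry the same integral of a holomorphic function with
Gaussian decay on the strip. -/
theorem integral_horizontal_line_eq {F : ℂ → ℂ} {a b : ℝ} (hab : a ≤ b)
    (hF : DifferentiableOn ℂ F {z | a ≤ z.im ∧ z.im ≤ b}) {C c : ℝ} (hc : 0 < c)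
    (hbd : ∀ t s : ℝ, a ≤ s → s ≤ b → ‖F (t + s * I)‖ ≤ C * Real.exp (-c * t ^ 2)) :
    ∫ t : ℝ, F (t + a * I) = ∫ t : ℝ, F (t + b * I) := by
  have hcont : ∀ s : ℝ, a ≤ s → s ≤ b → Continuous fun t : ℝ => F (t + s * I) := by
    intro s h1 h2
    refine hF.continuousOn.comp_continuous (by fun_prop) ?_
    intro t; simp [h1, h2]
  have hint : ∀ s : ℝ, a ≤ s → s ≤ b → Integrable fun t : ℝ => F (t + s * I) := fun s h1 h2 =>
    integrable_of_norm_le_gaussian (hcont s h1 h2).aestronglyMeasurable hc fun t => hbd t s h1 h2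
  have htend : ∀ s : ℝ, a ≤ s → s ≤ b →
      Tendsto (fun T : ℝ => ∫ t in (-T)..T, F (t + s * I)) atTop (𝓝 (∫ t : ℝ, F (t + s * I))) :=
    fun s h1 h2 => intervalIntegral_tendsto_integral (hint s h1 h2) tendsto_neg_atTop_atBot
      tendsto_id
  have hside : ∀ e : ℝ → ℝ, (∀ T, (e T) ^ 2 = T ^ 2) →
      Tendsto (fun T : ℝ => ∫ y in a..b, F ((e T : ℝ) + y * I)) atTop (𝓝 0) := by
    intro e he
    have h0 : Tendsto (fun T : ℝ => C * Real.exp (-c * T ^ 2) * |b - a|) atTop (𝓝 0) := by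
      have h1 : Tendsto (fun T : ℝ => -c * T ^ 2) atTop atBot := by
        have := (tendsto_pow_atTop (α := ℝ) (two_ne_zero)).const_mul_atTop_of_neg
          (neg_lt_zero.mpr hc)
        exact this
      have := ((Real.tendsto_exp_atBot.comp h1).const_mul C).mul_const |b - a|
      simpa using this
    refine squeeze_zero_norm (fun T => ?_) h0
    refine intervalIntegral.norm_integral_le_of_norm_le_const fun y hy => ?_
    rw [Set.uIoc_of_le hab] at hy
    have := hbd (e T) y hy.1.le hy.2
    rwa [he T] at this
  have hrect : ∀ T : ℝ, (∫ t in (-T)..T, F (t + a * I)) - (∫ t in (-T)..T, F (t + b * I)) +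
      I * (∫ y in a..b, F (((T : ℝ) : ℂ) + y * I)) -
      I * (∫ y in a..b, F (((-T : ℝ) : ℂ) + y * I)) = 0 := by
    intro T
    have := integral_boundary_rect_eq_zero_of_differentiableOn F ((-T : ℝ) + a * I)
      ((T : ℝ) + b * I) (hF.mono ?_)
    · simpa using this
    · intro z hz
      have := hz.2
      simp only [add_im, ofReal_im, mul_im, ofReal_re, I_im, I_re, mul_one, mul_zero, zero_add,
        add_zero, Set.mem_preimage, Set.uIcc_of_le hab] at this
      exact ⟨this.1, this.2⟩
  have hlim := (((htend a le_rfl hab).sub (htend b hab le_rfl)).add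
    ((hside (fun T => T) (fun _ => rfl)).const_mul I)).sub
    ((hside (fun T => -T) (fun _ => neg_sq _)).const_mul I)
  have h0 := tendsto_nhds_unique hlim (tendsto_const_nhds.congr fun T => (hrect T).symm)
  simp only [mul_zero, add_zero, sub_zero] at h0
  exact sub_eq_zero.mp h0

theorem integrable_abs_mul_exp_neg_mul_sq {b : ℝ} (hb : 0 < b) :
    Integrable fun r : ℝ => |r| * Real.exp (-b * r ^ 2) := by
  refine (integrable_mul_exp_neg_mul_sq hb).norm.congr (ae_of_all _ fun r => ?_)
  simp

theorem integral_abs_mul_exp_neg_mul_sq {b : ℝ} (hb : 0 < b) :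
    ∫ r : ℝ, |r| * Real.exp (-b * r ^ 2) = 1 / b := by
  have h1 := integral_comp_abs (f := fun r => r * Real.exp (-b * r ^ 2))
  simp only [sq_abs] at h1
  rw [h1]
  have h2 := integral_mul_cexp_neg_mul_sq (b := (b : ℂ)) (by simpa using hb)
  have h3 : ((∫ r in Set.Ioi (0 : ℝ), r * Real.exp (-b * r ^ 2) : ℝ) : ℂ) = ((2 * b)⁻¹ : ℝ) := by
    rw [← integral_complex_ofReal]
    push_cast
    exact h2
  rw [Complex.ofReal_inj.mp h3]
  field_simp

theorem exp_linear_mul_gaussian_le {A c : ℝ} (hA : 0 ≤ A) (hc : 0 < c) {n : ℝ} (hn : 1 ≤ n)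
    (r : ℝ) :
    Real.exp (A * |r|) * Real.exp (-(2 * c) * n * r ^ 2) ≤
      Real.exp (A ^ 2 / c) * Real.exp (-c * n * r ^ 2) := by
  rw [← Real.exp_add, ← Real.exp_add]
  apply Real.exp_le_exp.mpr
  have h1 : A * |r| ≤ A ^ 2 / c + c * r ^ 2 := by
    rw [← sq_abs r]
    have : A ^ 2 / c + c * |r| ^ 2 - A * |r| = ((A - c * |r|) ^ 2 + A * (c * |r|)) / c := by
      field_simp; ring
    have h2 : 0 ≤ ((A - c * |r|) ^ 2 + A * (c * |r|)) / c := by positivity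
    linarith
  have h2 : c * r ^ 2 ≤ c * r ^ 2 * n := le_mul_of_one_le_right (by positivity) hn
  nlinarith

/-- `(e^z - 1) / z`, extended by `1` at `z = 0`, written as `∫₀¹ e^{zs} ds`. -/
def expQuot (z : ℂ) : ℂ := ∫ s in (0 : ℝ)..1, exp (z * s)

theorem expQuot_zero : expQuot 0 = 1 := by simp [expQuot]

theorem expQuot_of_ne {z : ℂ} (hz : z ≠ 0) : expQuot z = (exp z - 1) / z := by
  simp [expQuot, integral_exp_mul_complex hz]

theorem mul_expQuot (z : ℂ) : z * expQuot z = exp z - 1 := by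
  by_cases hz : z = 0
  · simp [hz]
  · rw [expQuot_of_ne hz, mul_div_cancel₀ _ hz]

theorem norm_expQuot_le (z : ℂ) : ‖expQuot z‖ ≤ Real.exp ‖z‖ := by
  have := intervalIntegral.norm_integral_le_of_norm_le_const (a := (0 : ℝ)) (b := 1)
    (f := fun s : ℝ => exp (z * s)) (C := Real.exp ‖z‖) (fun s hs => ?_)
  · simpa [expQuot] using this
  · rw [Set.uIoc_of_le zero_le_one] at hs
    rw [norm_exp]
    apply Real.exp_le_exp.mpr
    refine (re_le_norm _).trans ?_
    rw [norm_mul, norm_real, Real.norm_of_nonneg hs.1.le]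
    exact mul_le_of_le_one_right (norm_nonneg _) hs.2

theorem norm_exp_sub_exp_le (z w : ℂ) :
    ‖exp z - exp w‖ ≤ ‖z - w‖ * Real.exp (‖w‖ + ‖z - w‖) := by
  have h1 : exp z - exp w = exp w * (exp (z - w) - 1) := by
    rw [mul_sub, ← exp_add]; simp
  have h2 := norm_exp_sub_sum_le_norm_mul_exp (z - w) 1
  simp only [Finset.range_one, Finset.sum_singleton, pow_zero, Nat.factorial_zero, Nat.cast_one,
    div_one, pow_one] at h2
  rw [h1, norm_mul, Real.exp_add]
  have h3 : ‖exp w‖ ≤ Real.exp ‖w‖ := norm_exp_le_exp_norm w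
  calc ‖exp w‖ * ‖exp (z - w) - 1‖ ≤ Real.exp ‖w‖ * (‖z - w‖ * Real.exp ‖z - w‖) := by gcongr
    _ = _ := by ring

theorem norm_expQuot_sub_le (z w : ℂ) :
    ‖expQuot z - expQuot w‖ ≤ ‖z - w‖ * Real.exp (‖w‖ + ‖z - w‖) := by
  have hi : ∀ z : ℂ, IntervalIntegrable (fun s : ℝ => exp (z * s)) volume 0 1 := fun z =>
    (by fun_prop : Continuous fun s : ℝ => exp (z * s)).intervalIntegrable _ _
  rw [expQuot, expQuot, ← intervalIntegral.integral_sub (hi z) (hi w)]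
  have := intervalIntegral.norm_integral_le_of_norm_le_const (a := (0 : ℝ)) (b := 1)
    (f := fun s : ℝ => exp (z * s) - exp (w * s))
    (C := ‖z - w‖ * Real.exp (‖w‖ + ‖z - w‖)) (fun s hs => ?_)
  · simpa using this
  · rw [Set.uIoc_of_le zero_le_one] at hs
    refine (norm_exp_sub_exp_le _ _).trans ?_
    rw [← sub_mul, norm_mul, norm_mul, norm_real, Real.norm_of_nonneg hs.1.le]
    have h1 : ‖z - w‖ * s ≤ ‖z - w‖ := mul_le_of_le_one_right (norm_nonneg _) hs.2
    have h2 : ‖w‖ * s ≤ ‖w‖ := mul_le_of_le_one_right (norm_nonneg _) hs.2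
    gcongr

theorem expQuot_conj (z : ℂ) : expQuot ((starRingEnd ℂ) z) = (starRingEnd ℂ) (expQuot z) := by
  by_cases hz : z = 0
  · simp [hz, expQuot_zero]
  · rw [expQuot_of_ne hz, expQuot_of_ne (by simpa using hz)]
    simp [← exp_conj]

theorem differentiableAt_expQuot_mul (α : ℝ) {z : ℂ} (hz : z ≠ 0) :
    DifferentiableAt ℂ (fun z : ℂ => expQuot (α * z)) z := by
  by_cases hα : α = 0
  · simp [hα]
  · have h1 : (fun z : ℂ => expQuot (α * z)) =ᶠ[𝓝 z] fun z => (exp (α * z) - 1) / (α * z) := by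
      filter_upwards [isOpen_ne.mem_nhds hz] with w hw
      exact expQuot_of_ne (mul_ne_zero (by exact_mod_cast hα) hw)
    refine DifferentiableAt.congr_of_eventuallyEq ?_ h1
    have : (α : ℂ) * z ≠ 0 := mul_ne_zero (by exact_mod_cast hα) hz
    fun_prop (disch := assumption)

/-- Laplace's method at one Gaussian peak, uniformly in the large parameter `n`, the complex
curvature `l` and the functions involved: `e` is the normalised peak and `g` the amplitude, which
only has to be Lipschitz where `e` is not negligible. -/
theorem norm_integral_sub_gaussian_le {c δ L T : ℝ} (hc : 0 < c) (hδ : 0 < δ) (hL : 0 ≤ L)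
    (hT : 0 ≤ T) (hTδ : T * δ ≤ c) :
    ∃ C : ℝ, 0 ≤ C ∧ ∀ (n : ℝ), 1 ≤ n → ∀ (l : ℂ), 4 * c ≤ l.re → ∀ (e g : ℝ → ℂ) (g₀ : ℂ),
      (∀ r, |r| ≤ δ → ∃ θ : ℂ, e r = exp (-(n * (l * r ^ 2 / 2)) + n * θ) ∧ ‖θ‖ ≤ T * |r| ^ 3) →
      (∀ r, ‖e r‖ ≤ Real.exp (-c * n * r ^ 2)) →
      (∀ r, ‖e r‖ * ‖g r - g₀‖ ≤ L * |r| * Real.exp (-c * n * r ^ 2)) → ‖g₀‖ ≤ L →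
      AEStronglyMeasurable (fun r => e r * g r) →
      ‖(∫ r, e r * g r) - g₀ * ((Real.pi : ℂ) / (n * l / 2)) ^ (1 / 2 : ℂ)‖ ≤ C / n := by
  refine ⟨(L + L * (T + 2 / δ ^ 3) * (2 / c)) * (2 / c), by positivity, ?_⟩
  intro n hn l hl e g g₀ h1 h2 h3 hg₀ hmeas
  have hn0 : 0 < n := by linarith
  have hint : Integrable (fun r => e r * g r) := by
    have hcn : 0 < c * n := by positivity
    have hi1 := (integrable_abs_mul_exp_neg_mul_sq hcn).const_mul L
    have hi2 := (integrable_exp_neg_mul_sq hcn).const_mul L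
    refine (hi1.add hi2).mono' hmeas (ae_of_all _ fun r => ?_)
    have e1 : e r * g r = e r * (g r - g₀) + e r * g₀ := by ring
    rw [e1, Pi.add_apply]
    refine (norm_add_le _ _).trans ?_
    rw [norm_mul, norm_mul, ← neg_mul, ← mul_assoc, mul_comm L (Real.exp _)]
    exact add_le_add (h3 r) (mul_le_mul (h2 r) hg₀ (norm_nonneg _) (Real.exp_nonneg _))
  have hb : 0 < (n * l / 2 : ℂ).re := by
    have : (n * l / 2 : ℂ).re = n * l.re / 2 := by simp
    rw [this]; have : 0 < l.re := by linarith
    positivity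
  have hgauss : ∀ r : ℝ, ‖exp (-(n * l / 2 : ℂ) * (r : ℂ) ^ 2)‖ ≤ Real.exp (-(2 * c) * n * r ^ 2) := by
    intro r
    rw [norm_exp]
    apply Real.exp_le_exp.mpr
    have : (-(n * l / 2 : ℂ) * (r : ℂ) ^ 2).re = -(n * l.re / 2) * r ^ 2 := by
      rw [← ofReal_pow, re_mul_ofReal]; simp
    rw [this]
    have : 0 ≤ n * r ^ 2 * (l.re - 4 * c) := mul_nonneg (by positivity) (by linarith)
    nlinarith
  have hpeak : ∀ r : ℝ, ‖e r - exp (-(n * l / 2 : ℂ) * (r : ℂ) ^ 2)‖ ≤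
      (T + 2 / δ ^ 3) * (n * |r| ^ 3) * Real.exp (-c * n * r ^ 2) := by
    intro r
    rcases le_or_gt |r| δ with hr | hr
    · obtain ⟨θ, he, hθ⟩ := h1 r hr
      have e1 : (-(n * (l * r ^ 2 / 2)) : ℂ) = -(n * l / 2 : ℂ) * (r : ℂ) ^ 2 := by ring
      rw [he, e1, exp_add, ← mul_sub_one, norm_mul]
      have h5 := norm_exp_sub_exp_le (n * θ) 0
      simp only [exp_zero, sub_zero, norm_zero, zero_add] at h5
      have h6 : ‖(n : ℂ) * θ‖ ≤ n * (T * |r| ^ 3) := by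
        rw [norm_mul, norm_real, Real.norm_of_nonneg hn0.le]; gcongr
      have h7 : n * (T * |r| ^ 3) ≤ c * n * r ^ 2 := by
        have : T * |r| ≤ c := (mul_le_mul_of_nonneg_left hr hT).trans hTδ
        rw [← sq_abs r]
        have h8 : 0 ≤ n * |r| ^ 2 * (c - T * |r|) := mul_nonneg (by positivity) (by linarith)
        nlinarith
      calc _ ≤ Real.exp (-(2 * c) * n * r ^ 2) * (n * (T * |r| ^ 3) * Real.exp (c * n * r ^ 2)) := by
            refine mul_le_mul (hgauss r) (h5.trans ?_) (norm_nonneg _) (Real.exp_nonneg _)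
            gcongr
            exact h6.trans h7
        _ = T * (n * |r| ^ 3) * Real.exp (-c * n * r ^ 2) := by
            have : Real.exp (-c * n * r ^ 2) =
                Real.exp (-(2 * c) * n * r ^ 2) * Real.exp (c * n * r ^ 2) := by
              rw [← Real.exp_add]; ring_nf
            rw [this]; ring
        _ ≤ _ := by
            gcongr
            have : 0 ≤ 2 / δ ^ 3 := by positivity
            linarith
    · have h4 : 1 ≤ n * |r| ^ 3 / δ ^ 3 := by
        rw [one_le_div (by positivity)]
        calc δ ^ 3 ≤ |r| ^ 3 := by gcongr
          _ ≤ n * |r| ^ 3 := le_mul_of_one_le_left (by positivity) hn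
      have h5 : Real.exp (-(2 * c) * n * r ^ 2) ≤ Real.exp (-c * n * r ^ 2) := by
        apply Real.exp_le_exp.mpr
        have : 0 ≤ c * n * r ^ 2 := by positivity
        nlinarith
      calc _ ≤ Real.exp (-c * n * r ^ 2) + Real.exp (-c * n * r ^ 2) :=
            (norm_sub_le _ _).trans (add_le_add (h2 r) ((hgauss r).trans h5))
        _ = 2 * 1 * Real.exp (-c * n * r ^ 2) := by ring
        _ ≤ 2 * (n * |r| ^ 3 / δ ^ 3) * Real.exp (-c * n * r ^ 2) := by gcongr
        _ = 2 / δ ^ 3 * (n * |r| ^ 3) * Real.exp (-c * n * r ^ 2) := by ring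
        _ ≤ _ := by
            gcongr
            linarith
  -- the cubic weight costs one factor `n r²`, absorbed by half of the Gaussian
  have habsorb : ∀ r : ℝ, n * |r| ^ 3 * Real.exp (-c * n * r ^ 2) ≤
      2 / c * (|r| * Real.exp (-(c * n / 2) * r ^ 2)) := by
    intro r
    have h4 : c * n * r ^ 2 / 2 ≤ Real.exp (c * n * r ^ 2 / 2) := by
      linarith [Real.add_one_le_exp (c * n * r ^ 2 / 2)]
    have h5 : Real.exp (-(c * n / 2) * r ^ 2) =
        Real.exp (c * n * r ^ 2 / 2) * Real.exp (-c * n * r ^ 2) := by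
      rw [← Real.exp_add]; ring_nf
    rw [h5]
    calc _ = 2 / c * (|r| * (c * n * r ^ 2 / 2 * Real.exp (-c * n * r ^ 2))) := by
          rw [← sq_abs r]; field_simp
      _ ≤ _ := by gcongr
  have hhalf : ∀ r : ℝ, Real.exp (-c * n * r ^ 2) ≤ Real.exp (-(c * n / 2) * r ^ 2) := by
    intro r
    apply Real.exp_le_exp.mpr
    have : 0 ≤ c * n * r ^ 2 := by positivity
    nlinarith
  rw [← integral_gaussian_complex hb, ← integral_const_mul,
    ← integral_sub hint ((integrable_cexp_neg_mul_sq hb).const_mul g₀)]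
  have hcn : 0 < c * n / 2 := by positivity
  have hbound : ∀ r : ℝ, ‖e r * g r - g₀ * exp (-(n * l / 2 : ℂ) * (r : ℂ) ^ 2)‖ ≤
      (L + L * (T + 2 / δ ^ 3) * (2 / c)) * (|r| * Real.exp (-(c * n / 2) * r ^ 2)) := by
    intro r
    have : e r * g r - g₀ * exp (-(n * l / 2 : ℂ) * (r : ℂ) ^ 2) =
        e r * (g r - g₀) + g₀ * (e r - exp (-(n * l / 2 : ℂ) * (r : ℂ) ^ 2)) := by ring
    rw [this]
    refine (norm_add_le _ _).trans ?_
    rw [norm_mul, norm_mul, add_mul]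
    refine add_le_add ((h3 r).trans ?_) ?_
    · rw [mul_assoc]
      exact mul_le_mul_of_nonneg_left (mul_le_mul_of_nonneg_left (hhalf r) (abs_nonneg r)) hL
    · calc _ ≤ L * ((T + 2 / δ ^ 3) * (n * |r| ^ 3) * Real.exp (-c * n * r ^ 2)) := by
            gcongr; exact hpeak r
        _ = L * (T + 2 / δ ^ 3) * (n * |r| ^ 3 * Real.exp (-c * n * r ^ 2)) := by ring
        _ ≤ L * (T + 2 / δ ^ 3) * (2 / c * (|r| * Real.exp (-(c * n / 2) * r ^ 2))) := by
            exact mul_le_mul_of_nonneg_left (habsorb r) (by positivity)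
        _ = _ := by ring
  refine (norm_integral_le_of_norm_le
    ((integrable_abs_mul_exp_neg_mul_sq hcn).const_mul _) (ae_of_all _ hbound)).trans ?_
  rw [integral_const_mul, integral_abs_mul_exp_neg_mul_sq hcn]
  apply le_of_eq
  field_simp

/-! ### The exponential weight near a saddle point -/

/-- The empirical Stieltjes transform `(1/N) ∑_j 1 / (z - y_j)`. -/
def stieltjes {N : ℕ} (y : Fin N → ℝ) (z : ℂ) : ℂ := 1 / (N : ℂ) * ∑ j, 1 / (z - y j)

/-- The derivative of the phase `(z² - 2uz) / (2a²) + (1/N) ∑_j log (z - y_j)`; its zeros are the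
saddle points. -/
def phaseDeriv (a u : ℝ) {N : ℕ} (y : Fin N → ℝ) (z : ℂ) : ℂ :=
  (z - u) / (a : ℂ) ^ 2 + stieltjes y z

/-- The second derivative of the phase. -/
def curvature (a : ℝ) {N : ℕ} (y : Fin N → ℝ) (z : ℂ) : ℂ :=
  1 / (a : ℂ) ^ 2 - 1 / (N : ℂ) * ∑ j, 1 / (z - y j) ^ 2

/-- The exponential of `N` times the phase, `∏_j (z - y_j) e^{N (z² - 2uz) / (2a²)}`. -/
def weight (a u : ℝ) {N : ℕ} (y : Fin N → ℝ) (z : ℂ) : ℂ :=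
  (∏ j, (z - y j)) * exp (N * (z ^ 2 - 2 * u * z) / (2 * (a : ℂ) ^ 2))

section

variable {a u : ℝ} {N : ℕ} {y : Fin N → ℝ} {p : ℂ}

theorem sub_ofReal_ne_zero {z : ℂ} (hz : z.im ≠ 0) (t : ℝ) : z - t ≠ 0 := by
  intro h; apply hz; simpa using congrArg im h

theorem abs_im_le_norm_sub_ofReal (z : ℂ) (t : ℝ) : |z.im| ≤ ‖z - t‖ := by
  simpa using abs_im_le_norm (z - t)

theorem norm_one_div_sub_ofReal_le {z : ℂ} {η : ℝ} (hη : 0 < η) (hz : η ≤ |z.im|) (t : ℝ) :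
    ‖1 / (z - t)‖ ≤ 1 / η := by
  rw [norm_div, norm_one]
  exact one_div_le_one_div_of_le hη (hz.trans (abs_im_le_norm_sub_ofReal z t))

theorem weight_ne_zero {z : ℂ} (hz : z.im ≠ 0) : weight a u y z ≠ 0 :=
  mul_ne_zero (Finset.prod_ne_zero_iff.mpr fun _ _ => sub_ofReal_ne_zero hz _) (exp_ne_zero _)

theorem weight_conj (z : ℂ) :
    weight a u y ((starRingEnd ℂ) z) = (starRingEnd ℂ) (weight a u y z) := by
  have : (starRingEnd ℂ) (2 : ℂ) = 2 := conj_ofNat 2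
  simp [weight, ← exp_conj, map_prod, this]

theorem norm_average_le {f : Fin N → ℂ} {C : ℝ} (hC : 0 ≤ C) (h : ∀ j, ‖f j‖ ≤ C) :
    ‖1 / (N : ℂ) * ∑ j, f j‖ ≤ C := by
  rcases Nat.eq_zero_or_pos N with h0 | h0
  · subst h0; simpa using hC
  · have hN : (0 : ℝ) < N := by exact_mod_cast h0
    rw [norm_mul, norm_div, norm_one, norm_natCast]
    have := norm_sum_le_of_le Finset.univ (fun j (_ : j ∈ Finset.univ) => h j)
    rw [Finset.sum_const, Finset.card_univ, Fintype.card_fin, nsmul_eq_mul] at this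
    rw [div_mul_eq_mul_div, one_mul, div_le_iff₀ hN]
    linarith

theorem norm_stieltjes_le {z : ℂ} {η : ℝ} (hη : 0 < η) (hz : η ≤ |z.im|) :
    ‖stieltjes y z‖ ≤ 1 / η :=
  norm_average_le (by positivity) fun j => norm_one_div_sub_ofReal_le hη hz _

theorem stieltjes_im (z : ℂ) :
    (stieltjes y z).im = -(z.im * (1 / (N : ℝ) * ∑ j, 1 / normSq (z - y j))) := by
  have h : ((1 : ℂ) / N) = ((1 / (N : ℝ) : ℝ) : ℂ) := by push_cast; rfl
  have h2 : ∀ j, (1 / (z - y j)).im = -z.im * (1 / normSq (z - y j)) := by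
    intro j
    simp [div_eq_mul_inv]
  rw [stieltjes, h, im_ofReal_mul, im_sum, Finset.sum_congr rfl fun j _ => h2 j, ← Finset.mul_sum]
  ring

/-- The real part of the curvature is a nonnegative term plus one that vanishes at saddle
points. -/
theorem curvature_re (z : ℂ) (hz : z.im ≠ 0) :
    (curvature a y z).re = (1 / a ^ 2 - 1 / (N : ℝ) * ∑ j, 1 / normSq (z - y j)) +
      2 * z.im ^ 2 * (1 / (N : ℝ) * ∑ j, (1 / normSq (z - y j)) ^ 2) := by
  have h : ((1 : ℂ) / N) = ((1 / (N : ℝ) : ℝ) : ℂ) := by push_cast; rfl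
  have h2 : ((1 : ℂ) / (a : ℂ) ^ 2) = ((1 / a ^ 2 : ℝ) : ℂ) := by push_cast; rfl
  rw [curvature, sub_re, h, h2, ofReal_re, re_ofReal_mul, re_sum]
  have : ∀ j, (1 / (z - y j) ^ 2).re =
      1 / normSq (z - y j) - 2 * z.im ^ 2 * (1 / normSq (z - y j)) ^ 2 := by
    intro j
    have hne : normSq (z - y j) ≠ 0 := by
      rw [Ne, normSq_eq_zero]; exact sub_ofReal_ne_zero hz _
    rw [one_div, inv_re, normSq_eq_norm_sq, norm_pow, ← normSq_eq_norm_sq]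
    field_simp
    simp [pow_two, normSq_apply]
    ring
  rw [Finset.sum_congr rfl fun j _ => this j, Finset.sum_sub_distrib, ← Finset.mul_sum]
  ring

theorem average_sq_le (hN : 1 ≤ N) (r : Fin N → ℝ) :
    (1 / (N : ℝ) * ∑ j, r j) ^ 2 ≤ 1 / (N : ℝ) * ∑ j, r j ^ 2 := by
  have hN0 : (0 : ℝ) < N := by exact_mod_cast hN
  have := sq_sum_le_card_mul_sum_sq (s := (Finset.univ : Finset (Fin N))) (f := r)
  rw [Finset.card_univ, Fintype.card_fin] at this
  rw [mul_pow, div_pow, one_pow, div_mul_eq_mul_div, div_mul_eq_mul_div, one_mul, one_mul,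
    div_le_div_iff₀ (by positivity) hN0]
  nlinarith

/-- The imaginary part of the saddle point equation. All bounds that are uniform in the points
`y j` come from this identity. -/
theorem average_eq_of_phaseDeriv_eq_zero (hp : 0 < p.im) (h : phaseDeriv a u y p = 0) :
    1 / (N : ℝ) * ∑ j, 1 / normSq (p - y j) = 1 / a ^ 2 := by
  have h1 := congrArg im h
  have h2 : ((p - u) / (a : ℂ) ^ 2).im = p.im / a ^ 2 := by
    rw [← ofReal_pow, div_ofReal_im]; simp
  rw [phaseDeriv, add_im, stieltjes_im, h2, zero_im] at h1
  have h3 : p.im * (1 / a ^ 2 - 1 / (N : ℝ) * ∑ j, 1 / normSq (p - y j)) = 0 := by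
    linear_combination h1
  rcases mul_eq_zero.mp h3 with h4 | h4
  · exact absurd h4 hp.ne'
  · linarith

/-- Saddle points away from the real axis are uniformly nondegenerate, by Cauchy-Schwarz. -/
theorem le_curvature_re (hN : 1 ≤ N) (hp : 0 < p.im) (h : phaseDeriv a u y p = 0) :
    2 * p.im ^ 2 / a ^ 4 ≤ (curvature a y p).re := by
  have h1 := average_eq_of_phaseDeriv_eq_zero hp h
  have h2 := average_sq_le hN fun j => 1 / normSq (p - y j)
  rw [h1] at h2
  rw [curvature_re p hp.ne', h1, sub_self, zero_add]
  calc _ = 2 * p.im ^ 2 * (1 / a ^ 2) ^ 2 := by ring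
    _ ≤ _ := by gcongr

theorem im_le_of_phaseDeriv_eq_zero (ha : 0 < a) (hp : 0 < p.im)
    (h : phaseDeriv a u y p = 0) : p.im ≤ a := by
  have h1 := average_eq_of_phaseDeriv_eq_zero hp h
  have h2 := norm_average_le (f := fun j => ((1 / normSq (p - y j) : ℝ) : ℂ)) (C := 1 / p.im ^ 2)
    (by positivity) (fun j => by
      rw [norm_real, Real.norm_of_nonneg (one_div_nonneg.mpr (normSq_nonneg _))]
      apply one_div_le_one_div_of_le (by positivity)
      rw [normSq_eq_norm_sq]
      have := abs_im_le_norm_sub_ofReal p (y j)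
      rw [abs_of_pos hp] at this
      gcongr)
  have h3 : 1 / (N : ℂ) * ∑ j, ((1 / normSq (p - y j) : ℝ) : ℂ) = ((1 / a ^ 2 : ℝ) : ℂ) := by
    rw [← h1]; push_cast; rfl
  rw [h3, norm_real, Real.norm_of_nonneg (by positivity),
    one_div_le_one_div (by positivity) (by positivity)] at h2
  exact (sq_le_sq₀ hp.le ha.le).mp h2

/-- Second-order expansion of the weight at a saddle point. -/
theorem weight_div_eq_exp (hN : 1 ≤ N) (hp : 0 < p.im) (h : phaseDeriv a u y p = 0)
    {ζ : ℂ} (hζ : ‖ζ‖ ≤ p.im / 2) :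
    ∃ θ : ℂ, weight a u y (p + ζ) / weight a u y p =
      exp (N * (curvature a y p * ζ ^ 2 / 2) + N * θ) ∧ ‖θ‖ ≤ 1 / p.im ^ 3 * ‖ζ‖ ^ 3 := by
  have hN0 : (N : ℂ) ≠ 0 := by exact_mod_cast (by omega : N ≠ 0)
  have hne : ∀ j, p - y j ≠ 0 := fun j => sub_ofReal_ne_zero hp.ne' _
  have hξ : ∀ j, ‖ζ / (p - y j)‖ ≤ ‖ζ‖ / p.im := by
    intro j
    have := norm_one_div_sub_ofReal_le hp (le_abs_self p.im) (y j)
    rw [div_eq_mul_one_div, norm_mul, div_eq_mul_one_div ‖ζ‖]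
    gcongr
  have hζ2 : ‖ζ‖ / p.im ≤ 1 / 2 := by rw [div_le_iff₀ hp]; linarith
  set R : Fin N → ℂ := fun j => log (1 + ζ / (p - y j)) -
    (ζ / (p - y j) - (ζ / (p - y j)) ^ 2 / 2) with hR
  have hRle : ∀ j, ‖R j‖ ≤ 1 / p.im ^ 3 * ‖ζ‖ ^ 3 := by
    intro j
    have h1 := norm_log_sub_logTaylor_le 2 (z := ζ / (p - y j)) (by linarith [hξ j])
    have h2 : logTaylor (2 + 1) (ζ / (p - y j)) =
        ζ / (p - y j) - (ζ / (p - y j)) ^ 2 / 2 := by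
      simp [logTaylor_succ, logTaylor_zero]; ring
    rw [h2] at h1
    refine h1.trans ?_
    have h3 : (1 - ‖ζ / (p - y j)‖)⁻¹ ≤ 2 := by
      rw [inv_le_comm₀ (by linarith [hξ j]) (by norm_num)]
      linarith [hξ j]
    calc _ ≤ (‖ζ‖ / p.im) ^ 3 * 2 / (2 + 1) := by
          push_cast
          have h4 : 0 ≤ (1 - ‖ζ / (p - y j)‖)⁻¹ := inv_nonneg.mpr (by linarith [hξ j])
          have h5 := hξ j
          gcongr
      _ ≤ (‖ζ‖ / p.im) ^ 3 := by
          have : 0 ≤ (‖ζ‖ / p.im) ^ 3 := by positivity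
          linarith
      _ = _ := by rw [div_pow]; ring
  refine ⟨1 / (N : ℂ) * ∑ j, R j, ?_, norm_average_le (by positivity) hRle⟩
  have hprod : ∏ j, (p + ζ - y j) =
      (∏ j, (p - y j)) * exp (∑ j, log (1 + ζ / (p - y j))) := by
    rw [exp_sum, ← Finset.prod_mul_distrib]
    refine Finset.prod_congr rfl fun j _ => ?_
    rw [exp_log]
    · have := hne j; field_simp; ring
    · intro h0
      have h1 : ζ / (p - y j) = -1 := by linear_combination h0
      have h2 := hξ j
      rw [h1, norm_neg, norm_one] at h2
      linarith
  have hsum : ∑ j, log (1 + ζ / (p - y j)) = ζ * (∑ j, 1 / (p - y j)) -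
      ζ ^ 2 / 2 * (∑ j, 1 / (p - y j) ^ 2) + ∑ j, R j := by
    rw [Finset.mul_sum, Finset.mul_sum, ← Finset.sum_sub_distrib, ← Finset.sum_add_distrib]
    refine Finset.sum_congr rfl fun j _ => ?_
    simp only [hR, div_pow]
    ring
  have hsad : ∑ j, 1 / (p - (y j : ℂ)) = -(N * ((p - u) / (a : ℂ) ^ 2)) := by
    rw [phaseDeriv, stieltjes] at h
    field_simp at h ⊢
    linear_combination h
  have hP : ∏ j, (p - (y j : ℂ)) ≠ 0 := Finset.prod_ne_zero_iff.mpr fun j _ => hne j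
  rw [weight, weight, hprod, hsum, hsad, mul_assoc, mul_div_mul_left _ _ hP, ← exp_add, ← exp_sub]
  congr 1
  rw [curvature]
  field_simp
  ring

/-- The arithmetic-geometric mean inequality. -/
theorem prod_le_average_pow (hN : 1 ≤ N) (z : Fin N → ℝ) (hz : ∀ j, 0 ≤ z j) :
    ∏ j, z j ≤ (1 / (N : ℝ) * ∑ j, z j) ^ N := by
  have hN0 : (0 : ℝ) < N := by exact_mod_cast hN
  have h := Real.geom_mean_le_arith_mean_weighted Finset.univ (fun _ : Fin N => 1 / (N : ℝ)) z
    (fun _ _ => by positivity) (by simp [hN0.ne']) (fun j _ => hz j)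
  have h2 : ∏ j, z j = (∏ j, z j ^ (1 / (N : ℝ))) ^ N := by
    rw [← Finset.prod_pow]
    refine Finset.prod_congr rfl fun j _ => ?_
    rw [← Real.rpow_natCast, ← Real.rpow_mul (hz j)]
    simp [hN0.ne']
  rw [h2, Finset.mul_sum]
  exact pow_le_pow_left₀ (Finset.prod_nonneg fun j _ => Real.rpow_nonneg (hz j) _) h N

theorem norm_sq_ofReal_add (x s t : ℝ) : ‖(x : ℂ) + s * I - t‖ ^ 2 = (x - t) ^ 2 + s ^ 2 := by
  rw [← normSq_eq_norm_sq, normSq_apply]; simp; ring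

theorem norm_weight (x s : ℝ) :
    ‖weight a u y (x + s * I)‖ = (∏ j, ‖(x : ℂ) + s * I - y j‖) *
      Real.exp (N * (x ^ 2 - s ^ 2 - 2 * u * x) / (2 * a ^ 2)) := by
  rw [weight, norm_mul, norm_prod, norm_exp]
  congr 2
  have : (N * (((x : ℂ) + s * I) ^ 2 - 2 * u * (x + s * I)) / (2 * (a : ℂ) ^ 2)) =
      ((N * (x ^ 2 - s ^ 2 - 2 * u * x) / (2 * a ^ 2) : ℝ) : ℂ) +
        ((N * (2 * x * s - 2 * u * s) / (2 * a ^ 2) : ℝ) : ℂ) * I := by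
    push_cast
    have : ((x : ℂ) + s * I) ^ 2 = x ^ 2 + 2 * x * s * I - s ^ 2 := by
      ring_nf; rw [I_sq]; ring
    rw [this]; ring
  rw [this, add_re, ofReal_re, re_ofReal_mul]; simp

/-- On the vertical line through a saddle point the weight is largest at the saddle point and its
conjugate. The arithmetic-geometric mean inequality reduces the bound to a one-variable one. -/
theorem norm_weight_vertical_le (ha : 0 < a) (hN : 1 ≤ N) (hp : 0 < p.im)
    (h : phaseDeriv a u y p = 0) (s : ℝ) :
    ‖weight a u y (p.re + s * I)‖ ≤
      Real.exp (-(p.im ^ 2 / (8 * a ^ 4)) * N * (|s| - p.im) ^ 2) * ‖weight a u y p‖ := by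
  have hN0 : (0 : ℝ) < N := by exact_mod_cast hN
  have hav := average_eq_of_phaseDeriv_eq_zero hp h
  have hya := im_le_of_phaseDeriv_eq_zero ha hp h
  set Y := p.im with hY
  set d := s ^ 2 - Y ^ 2 with hd
  set q := 1 + d / a ^ 2 with hq
  have hpeq : p = p.re + Y * I := (re_add_im p).symm
  have hr : ∀ j, normSq (p - y j) = (p.re - y j) ^ 2 + Y ^ 2 := by
    intro j; rw [normSq_apply]; simp [hY]; ring
  have hrpos : ∀ j, 0 < (p.re - y j) ^ 2 + Y ^ 2 := fun j => by positivity
  -- `q` is the average of the ratios of `|Re p + i s - y j|²` and `|p - y j|²`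
  have hq0 : 0 ≤ q := by
    have : q = (a ^ 2 - Y ^ 2 + s ^ 2) / a ^ 2 := by rw [hq, hd]; field_simp; ring
    rw [this]
    have : Y ^ 2 ≤ a ^ 2 := by gcongr
    apply div_nonneg _ (by positivity)
    nlinarith [sq_nonneg s]
  have hprod : ∏ j, ‖(p.re : ℂ) + s * I - y j‖ ^ 2 ≤ q ^ N * ∏ j, ‖(p.re : ℂ) + Y * I - y j‖ ^ 2 := by
    have h1 : ∀ j, ‖(p.re : ℂ) + s * I - y j‖ ^ 2 =
        (1 + d * (1 / normSq (p - y j))) * ‖(p.re : ℂ) + Y * I - y j‖ ^ 2 := by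
      intro j
      rw [norm_sq_ofReal_add, norm_sq_ofReal_add, hr]
      have := (hrpos j).ne'
      field_simp
      rw [hd]; ring
    rw [Finset.prod_congr rfl fun j _ => h1 j, Finset.prod_mul_distrib]
    gcongr
    have h2 := prod_le_average_pow hN (fun j => 1 + d * (1 / normSq (p - y j))) (fun j => by
      rw [hr]
      have : 1 + d * (1 / ((p.re - y j) ^ 2 + Y ^ 2)) =
          ((p.re - y j) ^ 2 + s ^ 2) / ((p.re - y j) ^ 2 + Y ^ 2) := by
        have := (hrpos j).ne'
        field_simp
        rw [hd]; ring
      rw [this]; positivity)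
    refine h2.trans (le_of_eq ?_)
    congr 1
    rw [Finset.sum_add_distrib, ← Finset.mul_sum, mul_add, mul_left_comm, hav, hq]
    simp
    field_simp
  have hsq : q ≤ Real.exp (2 * (Real.sqrt q - 1)) := by
    have h1 : Real.sqrt q ≤ Real.exp (Real.sqrt q - 1) := by
      linarith [Real.add_one_le_exp (Real.sqrt q - 1)]
    calc q = Real.sqrt q ^ 2 := (Real.sq_sqrt hq0).symm
      _ ≤ Real.exp (Real.sqrt q - 1) ^ 2 := by gcongr
      _ = _ := by rw [← Real.exp_nat_mul]; norm_num
  have hroot : Y ^ 2 / (4 * a ^ 4) * (|s| - Y) ^ 2 ≤ (Real.sqrt q - 1) ^ 2 := by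
    have h1 : Real.sqrt q ≤ 1 + |s| / a := by
      apply Real.sqrt_le_iff.mpr ⟨by positivity, ?_⟩
      have : q ≤ 1 + s ^ 2 / a ^ 2 := by
        rw [hq, hd]; gcongr; nlinarith [sq_nonneg Y]
      refine this.trans ?_
      rw [add_sq, div_pow, sq_abs]
      have : 0 ≤ 2 * 1 * (|s| / a) := by positivity
      linarith
    have h2 : (Real.sqrt q - 1) * (Real.sqrt q + 1) = (|s| - Y) * (|s| + Y) / a ^ 2 := by
      have := Real.sq_sqrt hq0
      have h3 : (|s| - Y) * (|s| + Y) = d := by rw [hd, ← sq_abs s]; ring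
      rw [h3]
      nlinarith
    have h3 : 0 < Real.sqrt q + 1 := by positivity
    have h4 : Real.sqrt q - 1 = (|s| - Y) * ((|s| + Y) / (a ^ 2 * (Real.sqrt q + 1))) := by
      field_simp
      field_simp at h2
      linarith
    have h5 : Y / (2 * a ^ 2) ≤ (|s| + Y) / (a ^ 2 * (Real.sqrt q + 1)) := by
      rw [div_le_div_iff₀ (by positivity) (by positivity)]
      have h6 : Y * (Real.sqrt q + 1) ≤ 2 * (|s| + Y) := by
        have : Y * (Real.sqrt q + 1) ≤ Y * (2 + |s| / a) :=
            mul_le_mul_of_nonneg_left (by linarith) hp.le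
        have h7 : Y * (|s| / a) ≤ |s| := by
          rw [mul_div_assoc', div_le_iff₀ ha, mul_comm]; gcongr
        nlinarith [abs_nonneg s]
      nlinarith [sq_nonneg a]
    rw [h4, mul_pow]
    calc _ = (|s| - Y) ^ 2 * (Y / (2 * a ^ 2)) ^ 2 := by field_simp; ring
      _ ≤ _ := by gcongr
  have hfin : ‖weight a u y (p.re + s * I)‖ ^ 2 ≤
      (Real.exp (-(Y ^ 2 / (8 * a ^ 4)) * N * (|s| - Y) ^ 2) * ‖weight a u y p‖) ^ 2 := by
    conv_rhs => rw [hpeq]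
    rw [norm_weight, norm_weight, mul_pow, mul_pow, mul_pow, ← Finset.prod_pow, ← Finset.prod_pow]
    have h1 : q ^ N * Real.exp (-(N * (d / a ^ 2))) ≤
        Real.exp (-(Y ^ 2 / (8 * a ^ 4)) * N * (|s| - Y) ^ 2) ^ 2 := by
      calc _ ≤ Real.exp (2 * (Real.sqrt q - 1)) ^ N * Real.exp (-(N * (d / a ^ 2))) := by gcongr
        _ = Real.exp (-(N * (Real.sqrt q - 1) ^ 2)) := by
            rw [← Real.exp_nat_mul, ← Real.exp_add]
            congr 1
            have := Real.sq_sqrt hq0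
            have h3 : d / a ^ 2 = q - 1 := by rw [hq]; ring
            rw [h3]
            linear_combination (N : ℝ) * this
        _ ≤ _ := by
            rw [← Real.exp_nat_mul]
            apply Real.exp_le_exp.mpr
            have := mul_le_mul_of_nonneg_left hroot hN0.le
            have h4 : ((2 : ℕ) : ℝ) * (-(Y ^ 2 / (8 * a ^ 4)) * N * (|s| - Y) ^ 2) =
              -(N * (Y ^ 2 / (4 * a ^ 4) * (|s| - Y) ^ 2)) := by push_cast; field_simp; ring
            rw [h4]
            linarith
    have h2 : Real.exp (N * (p.re ^ 2 - s ^ 2 - 2 * u * p.re) / (2 * a ^ 2)) ^ 2 =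
        Real.exp (-(N * (d / a ^ 2))) *
          Real.exp (N * (p.re ^ 2 - Y ^ 2 - 2 * u * p.re) / (2 * a ^ 2)) ^ 2 := by
      rw [← Real.exp_nat_mul, ← Real.exp_nat_mul, ← Real.exp_add]
      congr 1
      push_cast
      rw [hd]
      field_simp
      ring
    rw [h2]
    calc _ ≤ (q ^ N * ∏ j, ‖(p.re : ℂ) + Y * I - y j‖ ^ 2) * (Real.exp (-(N * (d / a ^ 2))) *
          Real.exp (N * (p.re ^ 2 - Y ^ 2 - 2 * u * p.re) / (2 * a ^ 2)) ^ 2) := by gcongr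
      _ = (q ^ N * Real.exp (-(N * (d / a ^ 2)))) * ((∏ j, ‖(p.re : ℂ) + Y * I - y j‖ ^ 2) *
          Real.exp (N * (p.re ^ 2 - Y ^ 2 - 2 * u * p.re) / (2 * a ^ 2)) ^ 2) := by ring
      _ ≤ _ := by gcongr
  exact (sq_le_sq₀ (norm_nonneg _) (by positivity)).mp hfin

end

section

variable {a u : ℝ} {N : ℕ} {y : Fin N → ℝ} {p : ℂ}

/-- The weight with one of its linear factors removed obeys the same kind of bound, including
near the real axis: there the remaining factors only grow if the point is moved up to height
`Y² / (8a)`, `Y` the height of the saddle point. -/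
theorem norm_weight_vertical_le_mul (ha : 0 < a) (hN : 1 ≤ N) (hp : 0 < p.im)
    (h : phaseDeriv a u y p = 0) (s : ℝ) (k : Fin N) :
    ‖weight a u y (p.re + s * I)‖ ≤ 8 * a / p.im ^ 2 *
      Real.exp (-(p.im ^ 2 / (16 * a ^ 4)) * N * (|s| - p.im) ^ 2) * ‖weight a u y p‖ *
        ‖(p.re : ℂ) + s * I - y k‖ := by
  have hN0 : (0 : ℝ) < N := by exact_mod_cast hN
  have hya := im_le_of_phaseDeriv_eq_zero ha hp h
  set Y := p.im with hY
  set η := Y ^ 2 / (8 * a) with hη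
  have hη0 : 0 < η := by positivity
  have hηinv : 8 * a / Y ^ 2 = 1 / η := by rw [hη]; field_simp
  have hηY : η ≤ Y / 8 := by
    rw [hη, div_le_div_iff₀ (by positivity) (by norm_num)]
    nlinarith
  have him : ∀ s : ℝ, ((p.re : ℂ) + s * I).im = s := by intro s; simp
  rcases le_or_gt η |s| with hs | hs
  · have h1 := norm_weight_vertical_le ha hN hp h s
    have h2 : 1 ≤ 1 / η * ‖(p.re : ℂ) + s * I - y k‖ := by
      have := abs_im_le_norm_sub_ofReal ((p.re : ℂ) + s * I) (y k)
      rw [him] at this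
      rw [one_div_mul_eq_div, one_le_div hη0]; linarith
    have h3 : Real.exp (-(Y ^ 2 / (8 * a ^ 4)) * N * (|s| - Y) ^ 2) ≤
        Real.exp (-(Y ^ 2 / (16 * a ^ 4)) * N * (|s| - Y) ^ 2) := by
      apply Real.exp_le_exp.mpr
      have h4 : 0 ≤ Y ^ 2 / (16 * a ^ 4) * N * (|s| - Y) ^ 2 := by positivity
      have h5 : Y ^ 2 / (8 * a ^ 4) = 2 * (Y ^ 2 / (16 * a ^ 4)) := by field_simp; norm_num
      rw [h5]; nlinarith
    rw [hηinv]
    calc _ ≤ Real.exp (-(Y ^ 2 / (16 * a ^ 4)) * N * (|s| - Y) ^ 2) * ‖weight a u y p‖ * 1 := by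
          rw [mul_one]; exact h1.trans (by gcongr)
      _ ≤ Real.exp (-(Y ^ 2 / (16 * a ^ 4)) * N * (|s| - Y) ^ 2) * ‖weight a u y p‖ *
          (1 / η * ‖(p.re : ℂ) + s * I - y k‖) := by gcongr
      _ = _ := by ring
  · have h1 := norm_weight_vertical_le ha hN hp h η
    rw [abs_of_pos hη0] at h1
    have hprod : ∏ j, ‖(p.re : ℂ) + s * I - y j‖ ≤
        ‖(p.re : ℂ) + s * I - y k‖ * (1 / η * ∏ j, ‖(p.re : ℂ) + η * I - y j‖) := by
      rw [← Finset.mul_prod_erase _ _ (Finset.mem_univ k)]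
      refine mul_le_mul_of_nonneg_left ?_ (norm_nonneg _)
      have h2 : ∏ j ∈ Finset.univ.erase k, ‖(p.re : ℂ) + s * I - y j‖ ≤
          ∏ j ∈ Finset.univ.erase k, ‖(p.re : ℂ) + η * I - y j‖ := by
        refine Finset.prod_le_prod (fun _ _ => norm_nonneg _) fun j _ => ?_
        refine (sq_le_sq₀ (norm_nonneg _) (norm_nonneg _)).mp ?_
        rw [norm_sq_ofReal_add, norm_sq_ofReal_add]
        have : s ^ 2 ≤ η ^ 2 := sq_le_sq' (by linarith [neg_abs_le s]) (by linarith [le_abs_self s])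
        linarith
      refine h2.trans ?_
      rw [← Finset.mul_prod_erase _ _ (Finset.mem_univ k), ← mul_assoc]
      refine le_mul_of_one_le_left (Finset.prod_nonneg fun _ _ => norm_nonneg _) ?_
      have := abs_im_le_norm_sub_ofReal ((p.re : ℂ) + η * I) (y k)
      rw [him, abs_of_pos hη0] at this
      rw [one_div_mul_eq_div, one_le_div hη0]; linarith
    have hexp : Real.exp (N * (p.re ^ 2 - s ^ 2 - 2 * u * p.re) / (2 * a ^ 2)) ≤
        Real.exp (N * η ^ 2 / (2 * a ^ 2)) *
          Real.exp (N * (p.re ^ 2 - η ^ 2 - 2 * u * p.re) / (2 * a ^ 2)) := by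
      rw [← Real.exp_add, ← add_div]
      apply Real.exp_le_exp.mpr
      gcongr
      nlinarith [mul_nonneg hN0.le (sq_nonneg s)]
    have hcomb : ‖weight a u y (p.re + s * I)‖ ≤ ‖(p.re : ℂ) + s * I - y k‖ * (1 / η) *
        Real.exp (N * η ^ 2 / (2 * a ^ 2)) * ‖weight a u y (p.re + η * I)‖ := by
      rw [norm_weight, norm_weight]
      calc _ ≤ (‖(p.re : ℂ) + s * I - y k‖ * (1 / η * ∏ j, ‖(p.re : ℂ) + η * I - y j‖)) *
            (Real.exp (N * η ^ 2 / (2 * a ^ 2)) *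
              Real.exp (N * (p.re ^ 2 - η ^ 2 - 2 * u * p.re) / (2 * a ^ 2))) := by
            gcongr
        _ = _ := by ring
    have hnum : Real.exp (N * η ^ 2 / (2 * a ^ 2)) *
        Real.exp (-(Y ^ 2 / (8 * a ^ 4)) * N * (η - Y) ^ 2) ≤
          Real.exp (-(Y ^ 2 / (16 * a ^ 4)) * N * (|s| - Y) ^ 2) := by
      rw [← Real.exp_add]
      apply Real.exp_le_exp.mpr
      have h2 : (|s| - Y) ^ 2 ≤ Y ^ 2 := by
        have := abs_nonneg s
        nlinarith
      have h3 : 49 / 64 * Y ^ 2 ≤ (η - Y) ^ 2 := by nlinarith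
      have h4 : N * η ^ 2 / (2 * a ^ 2) = N * (Y ^ 4 / (128 * a ^ 4)) := by
        rw [hη]; field_simp; norm_num
      have h5 : Y ^ 2 / (8 * a ^ 4) * N * (49 / 64 * Y ^ 2) ≤
          Y ^ 2 / (8 * a ^ 4) * N * (η - Y) ^ 2 := by gcongr
      have h6 : Y ^ 2 / (16 * a ^ 4) * N * (|s| - Y) ^ 2 ≤ Y ^ 2 / (16 * a ^ 4) * N * Y ^ 2 := by
        gcongr
      have h7 : Y ^ 2 / (8 * a ^ 4) * N * (49 / 64 * Y ^ 2) = N * (Y ^ 4 / a ^ 4) * (49 / 512) := by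
        field_simp; norm_num
      have h8 : Y ^ 2 / (16 * a ^ 4) * N * Y ^ 2 = N * (Y ^ 4 / a ^ 4) * (1 / 16) := by
        field_simp
      have h9 : N * (Y ^ 4 / (128 * a ^ 4)) = N * (Y ^ 4 / a ^ 4) * (1 / 128) := by
        field_simp
      have h10 : 0 ≤ N * (Y ^ 4 / a ^ 4) := by positivity
      rw [h4, h9]
      linarith
    refine hcomb.trans ?_
    rw [hηinv]
    calc _ ≤ ‖(p.re : ℂ) + s * I - y k‖ * (1 / η) * Real.exp (N * η ^ 2 / (2 * a ^ 2)) *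
          (Real.exp (-(Y ^ 2 / (8 * a ^ 4)) * N * (η - Y) ^ 2) * ‖weight a u y p‖) := by gcongr
      _ = ‖(p.re : ℂ) + s * I - y k‖ * (1 / η) * ‖weight a u y p‖ *
          (Real.exp (N * η ^ 2 / (2 * a ^ 2)) *
            Real.exp (-(Y ^ 2 / (8 * a ^ 4)) * N * (η - Y) ^ 2)) := by ring
      _ ≤ ‖(p.re : ℂ) + s * I - y k‖ * (1 / η) * ‖weight a u y p‖ *
          Real.exp (-(Y ^ 2 / (16 * a ^ 4)) * N * (|s| - Y) ^ 2) := by gcongr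
      _ = _ := by ring

theorem le_of_mul_deriv_nonneg {f f' : ℝ → ℝ} (hf : ∀ t, HasDerivAt f (f' t) t)
    (h : ∀ t, 0 ≤ t * f' t) (t : ℝ) : f 0 ≤ f t := by
  have hc : Continuous f := continuous_iff_continuousAt.mpr fun t => (hf t).continuousAt
  rcases le_total 0 t with ht | ht
  · refine monotoneOn_of_deriv_nonneg (convex_Ici 0) hc.continuousOn
      (fun x _ => (hf x).differentiableAt.differentiableWithinAt) (fun x hx => ?_)
      (Set.mem_Ici.mpr le_rfl) (Set.mem_Ici.mpr ht) ht
    rw [interior_Ici] at hx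
    rw [(hf x).deriv]
    exact nonneg_of_mul_nonneg_right (h x) hx
  · refine antitoneOn_of_deriv_nonpos (convex_Iic 0) hc.continuousOn
      (fun x _ => (hf x).differentiableAt.differentiableWithinAt) (fun x hx => ?_)
      (Set.mem_Iic.mpr ht) (Set.mem_Iic.mpr le_rfl) ht
    rw [interior_Iic] at hx
    rw [(hf x).deriv]
    have hx' : x < 0 := hx
    have := h x
    by_contra hcon
    push Not at hcon
    exact absurd (mul_neg_of_neg_of_pos hx' hcon) (not_lt.mpr this)

theorem phaseDeriv_re (x s : ℝ) : (phaseDeriv a u y (x + s * I)).re =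
    (x - u) / a ^ 2 + 1 / (N : ℝ) * ∑ j, (x - y j) / ((x - y j) ^ 2 + s ^ 2) := by
  have h : ((1 : ℂ) / N) = ((1 / (N : ℝ) : ℝ) : ℂ) := by push_cast; rfl
  have h2 : (((x : ℂ) + s * I - u) / (a : ℂ) ^ 2).re = (x - u) / a ^ 2 := by
    rw [← ofReal_pow, div_ofReal_re]; simp
  rw [phaseDeriv, add_re, h2, stieltjes, h, re_ofReal_mul, re_sum]
  congr 2
  refine Finset.sum_congr rfl fun j _ => ?_
  rw [one_div, inv_re, normSq_eq_norm_sq, norm_sq_ofReal_add]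
  simp

/-- If the phase increases away from the saddle point along the horizontal line through it, then
the reciprocal of the weight has a Gaussian peak there. -/
theorem norm_weight_horizontal_le (hN : 1 ≤ N) (ha : 0 < a) (hp : 0 < p.im) {c : ℝ}
    (hc : ∀ r : ℝ, c * r ^ 2 ≤ r * (phaseDeriv a u y (p + r)).re) (r : ℝ) :
    ‖weight a u y p‖ ≤ Real.exp (-(c / 2) * N * r ^ 2) * ‖weight a u y (p + r)‖ := by
  have hN0 : (0 : ℝ) < N := by exact_mod_cast hN
  have hpr : ∀ r : ℝ, p + r = ((p.re + r : ℝ) : ℂ) + p.im * I := by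
    intro r; conv_lhs => rw [← re_add_im p]
    push_cast; ring
  have hsq : ∀ (r : ℝ) (j : Fin N), 0 < (p.re + r - y j) ^ 2 + p.im ^ 2 := fun r j => by positivity
  set f : ℝ → ℝ := fun r => (∑ j, Real.log ((p.re + r - y j) ^ 2 + p.im ^ 2)) / 2 +
    N * ((p.re + r) ^ 2 - p.im ^ 2 - 2 * u * (p.re + r)) / (2 * a ^ 2) - N * c * r ^ 2 / 2 with hf
  have hderiv : ∀ r : ℝ, HasDerivAt f (N * (phaseDeriv a u y (p + r)).re - N * c * r) r := by
    intro r
    have h1 : ∀ j, HasDerivAt (fun r => Real.log ((p.re + r - y j) ^ 2 + p.im ^ 2))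
        (2 * (p.re + r - y j) / ((p.re + r - y j) ^ 2 + p.im ^ 2)) r := by
      intro j
      have : HasDerivAt (fun r => (p.re + r - y j) ^ 2 + p.im ^ 2) (2 * (p.re + r - y j)) r := by
        have := (((hasDerivAt_id r).const_add p.re).sub_const (y j)).pow 2
        simpa using this.add_const (p.im ^ 2)
      exact this.log (hsq r j).ne'
    have h2 := (HasDerivAt.fun_sum fun j (_ : j ∈ Finset.univ) => h1 j).div_const 2
    have h3 : HasDerivAt (fun r : ℝ => N * ((p.re + r) ^ 2 - p.im ^ 2 - 2 * u * (p.re + r)) /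
        (2 * a ^ 2)) (N * (2 * (p.re + r) - 2 * u) / (2 * a ^ 2)) r := by
      have h4 := ((hasDerivAt_id r).const_add p.re)
      have h5 := ((((h4.pow 2).sub_const (p.im ^ 2)).sub (h4.const_mul (2 * u))).const_mul
        (N : ℝ)).div_const (2 * a ^ 2)
      simpa using h5
    have h6 : HasDerivAt (fun r : ℝ => N * c * r ^ 2 / 2) (N * c * r) r := by
      have := (((hasDerivAt_id r).pow 2).const_mul (N * c)).div_const 2
      refine this.congr_deriv ?_
      simp; ring
    refine ((h2.add h3).sub h6).congr_deriv ?_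
    rw [hpr, phaseDeriv_re, Finset.sum_div]
    have : ∀ j, 2 * (p.re + r - y j) / ((p.re + r - y j) ^ 2 + p.im ^ 2) / 2 =
        (p.re + r - y j) / ((p.re + r - y j) ^ 2 + p.im ^ 2) := by intro j; ring
    rw [Finset.sum_congr rfl fun j _ => this j]
    generalize ∑ j, (p.re + r - y j) / ((p.re + r - y j) ^ 2 + p.im ^ 2) = S
    field_simp
    ring
  have hmin := le_of_mul_deriv_nonneg hderiv (fun t => by
    have := mul_le_mul_of_nonneg_left (hc t) hN0.le
    nlinarith) r
  have hnorm : ∀ r : ℝ, ‖weight a u y (p + r)‖ = Real.exp (f r + N * c * r ^ 2 / 2) := by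
    intro r
    rw [hpr, norm_weight, hf]
    simp only [sub_add_cancel]
    rw [Real.exp_add]
    congr 1
    rw [Finset.sum_div, Real.exp_sum]
    refine Finset.prod_congr rfl fun j _ => ?_
    have h1 : ‖((p.re + r : ℝ) : ℂ) + p.im * I - y j‖ =
        Real.sqrt ((p.re + r - y j) ^ 2 + p.im ^ 2) := by
      rw [← norm_sq_ofReal_add, Real.sqrt_sq (norm_nonneg _)]
    rw [h1, Real.sqrt_eq_rpow, Real.rpow_def_of_pos (hsq r j)]
    congr 1; ring
  have h0 := hnorm 0
  simp only [ofReal_zero, add_zero] at h0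
  rw [h0, hnorm, ← Real.exp_add]
  apply Real.exp_le_exp.mpr
  nlinarith

end

/-- `f` is within `L |r| e^{L |r|}` of the value `f₀`, which is at most `L`. The exponential is
absorbed by a Gaussian, and with a single constant `L` the property is stable under products. -/
def ExpLipschitz (L : ℝ) (f : ℝ → ℂ) (f₀ : ℂ) : Prop :=
  0 ≤ L ∧ ‖f₀‖ ≤ L ∧ ∀ r, ‖f r - f₀‖ ≤ L * |r| * Real.exp (L * |r|)

theorem ExpLipschitz.mono {L L' : ℝ} {f : ℝ → ℂ} {f₀ : ℂ} (h : ExpLipschitz L f f₀)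
    (hL : L ≤ L') : ExpLipschitz L' f f₀ :=
  ⟨h.1.trans hL, h.2.1.trans hL, fun r => (h.2.2 r).trans (by have := h.1.trans hL; gcongr)⟩

theorem ExpLipschitz.mul {L M : ℝ} {f g : ℝ → ℂ} {f₀ g₀ : ℂ} (hf : ExpLipschitz L f f₀)
    (hg : ExpLipschitz M g g₀) :
    ExpLipschitz (3 * L * M + L + M + 1) (fun r => f r * g r) (f₀ * g₀) := by
  obtain ⟨hL, hf₀, hf⟩ := hf
  obtain ⟨hM, hg₀, hg⟩ := hg
  have hLM : 0 ≤ L * M := by positivity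
  refine ⟨by positivity, ?_, fun r => ?_⟩
  · rw [norm_mul]
    calc _ ≤ L * M := by gcongr
      _ ≤ _ := by nlinarith
  · have h1 : f r * g r - f₀ * g₀ = (f r - f₀) * (g r - g₀) + (f r - f₀) * g₀ + f₀ * (g r - g₀) := by
      ring
    have hr := abs_nonneg r
    have h2 : |r| ≤ Real.exp |r| := by linarith [Real.add_one_le_exp |r|]
    set K := 3 * L * M + L + M + 1 with hK
    have e1 : |r| * (Real.exp (L * |r|) * Real.exp (M * |r|)) ≤ Real.exp (K * |r|) := by
      calc _ ≤ Real.exp |r| * (Real.exp (L * |r|) * Real.exp (M * |r|)) := by gcongr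
        _ = Real.exp ((L + M + 1) * |r|) := by
            rw [← Real.exp_add, ← Real.exp_add]; congr 1; ring
        _ ≤ _ := by
            apply Real.exp_le_exp.mpr; gcongr; linarith
    have e2 : Real.exp (L * |r|) ≤ Real.exp (K * |r|) := by
      apply Real.exp_le_exp.mpr; gcongr; linarith
    have e3 : Real.exp (M * |r|) ≤ Real.exp (K * |r|) := by
      apply Real.exp_le_exp.mpr; gcongr; linarith
    rw [h1]
    calc _ ≤ ‖f r - f₀‖ * ‖g r - g₀‖ + ‖f r - f₀‖ * ‖g₀‖ + ‖f₀‖ * ‖g r - g₀‖ := by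
          refine (norm_add₃_le).trans (le_of_eq ?_)
          simp only [norm_mul]
      _ ≤ (L * |r| * Real.exp (L * |r|)) * (M * |r| * Real.exp (M * |r|)) +
          (L * |r| * Real.exp (L * |r|)) * M + L * (M * |r| * Real.exp (M * |r|)) := by
          gcongr
          exacts [hf r, hg r, hf r, hg r]
      _ = L * M * |r| * (|r| * (Real.exp (L * |r|) * Real.exp (M * |r|))) +
          L * M * |r| * Real.exp (L * |r|) + L * M * |r| * Real.exp (M * |r|) := by ring
      _ ≤ L * M * |r| * Real.exp (K * |r|) + L * M * |r| * Real.exp (K * |r|) +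
          L * M * |r| * Real.exp (K * |r|) := by gcongr
      _ = 3 * L * M * |r| * Real.exp (K * |r|) := by ring
      _ ≤ K * |r| * Real.exp (K * |r|) := by
          gcongr; linarith

theorem ExpLipschitz.of_lipschitz {L : ℝ} {f : ℝ → ℂ} {f₀ : ℂ} (hL : 0 ≤ L) (h₀ : ‖f₀‖ ≤ L)
    (h : ∀ r, ‖f r - f₀‖ ≤ L * |r|) : ExpLipschitz L f f₀ :=
  ⟨hL, h₀, fun r => (h r).trans (le_mul_of_one_le_right (by positivity)
    (Real.one_le_exp (by positivity)))⟩

theorem expLipschitz_exp {A B : ℝ} (hA : 0 ≤ A) {α : ℂ} (hα : ‖α‖ ≤ A) {p : ℂ} (hB : ‖p‖ ≤ B)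
    {d : ℝ → ℂ} (hd : ∀ r, ‖d r‖ ≤ |r|) :
    ExpLipschitz ((A + 1) * Real.exp (A * B)) (fun r => exp (α * (p + d r))) (exp (α * p)) := by
  have hB0 : 0 ≤ B := (norm_nonneg p).trans hB
  have h1 : 1 ≤ Real.exp (A * B) := Real.one_le_exp (by positivity)
  have hαp : ‖α * p‖ ≤ A * B := by rw [norm_mul]; gcongr
  refine ⟨by positivity, ?_, fun r => ?_⟩
  · refine (norm_exp_le_exp_norm _).trans ((Real.exp_le_exp.mpr hαp).trans ?_)
    exact le_mul_of_one_le_left (by positivity) (by linarith)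
  · have h2 : α * (p + d r) - α * p = α * d r := by ring
    have h3 : ‖α * d r‖ ≤ A * |r| := by rw [norm_mul]; gcongr; exact hd r
    refine (norm_exp_sub_exp_le _ _).trans ?_
    rw [h2, Real.exp_add]
    calc _ ≤ A * |r| * (Real.exp (A * B) * Real.exp (A * |r|)) := by gcongr
      _ = A * Real.exp (A * B) * |r| * Real.exp (A * |r|) := by ring
      _ ≤ _ := by
          gcongr
          · linarith
          · nlinarith

theorem expLipschitz_expQuot {A B : ℝ} (hA : 0 ≤ A) {α : ℂ} (hα : ‖α‖ ≤ A) {p : ℂ} (hB : ‖p‖ ≤ B)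
    {d : ℝ → ℂ} (hd : ∀ r, ‖d r‖ ≤ |r|) :
    ExpLipschitz ((A + 1) * Real.exp (A * B)) (fun r => expQuot (α * (p + d r)))
      (expQuot (α * p)) := by
  have hB0 : 0 ≤ B := (norm_nonneg p).trans hB
  have h1 : 1 ≤ Real.exp (A * B) := Real.one_le_exp (by positivity)
  have hαp : ‖α * p‖ ≤ A * B := by rw [norm_mul]; gcongr
  refine ⟨by positivity, ?_, fun r => ?_⟩
  · refine (norm_expQuot_le _).trans ((Real.exp_le_exp.mpr hαp).trans ?_)
    exact le_mul_of_one_le_left (by positivity) (by linarith)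
  · have h2 : α * (p + d r) - α * p = α * d r := by ring
    have h3 : ‖α * d r‖ ≤ A * |r| := by rw [norm_mul]; gcongr; exact hd r
    refine (norm_expQuot_sub_le _ _).trans ?_
    rw [h2, Real.exp_add]
    calc _ ≤ A * |r| * (Real.exp (A * B) * Real.exp (A * |r|)) := by gcongr
      _ = A * Real.exp (A * B) * |r| * Real.exp (A * |r|) := by ring
      _ ≤ _ := by
          gcongr
          · linarith
          · nlinarith

/-! ### Laplace asymptotics of the single contour integrals -/

/-- The Gaussian integral `∫ e^{-n l r² / 2} dr = √(2π / (n l))`. -/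
def gaussConst (n : ℝ) (l : ℂ) : ℂ := ((Real.pi : ℂ) / (n * l / 2)) ^ (1 / 2 : ℂ)

theorem gaussConst_sq (n : ℝ) (l : ℂ) : gaussConst n l ^ 2 = 2 * Real.pi / (n * l) := by
  rw [gaussConst, ← cpow_nat_mul]
  norm_num
  field_simp

/-- Amplitudes that are `ExpLipschitz` meet the assumption of `norm_integral_sub_gaussian_le`. -/
theorem ExpLipschitz.mul_gaussian_le {L : ℝ} {f : ℝ → ℂ} {f₀ : ℂ} (h : ExpLipschitz L f f₀)
    {c n E r : ℝ} (hc : 0 < c) (hn : 1 ≤ n) (hE : E ≤ Real.exp (-(2 * c) * n * r ^ 2)) :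
    E * ‖f r - f₀‖ ≤ L * Real.exp (L ^ 2 / c) * |r| * Real.exp (-c * n * r ^ 2) := by
  have hL := h.1
  calc E * ‖f r - f₀‖ ≤ Real.exp (-(2 * c) * n * r ^ 2) * (L * |r| * Real.exp (L * |r|)) := by
        gcongr; exact h.2.2 r
    _ = L * |r| * (Real.exp (L * |r|) * Real.exp (-(2 * c) * n * r ^ 2)) := by ring
    _ ≤ L * |r| * (Real.exp (L ^ 2 / c) * Real.exp (-c * n * r ^ 2)) := by
        exact mul_le_mul_of_nonneg_left (exp_linear_mul_gaussian_le hL hc hn r) (by positivity)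
    _ = _ := by ring

/-- Laplace's method on the upper half of the vertical line through the saddle point. -/
theorem vertical_laplace {a Y₀ c L : ℝ} (ha : 0 < a) (hY₀ : 0 < Y₀) (hc : 0 < c)
    (hcY : c ≤ Y₀ ^ 2 / (16 * a ^ 4)) (hL : 0 ≤ L) :
    ∃ C : ℝ, 0 ≤ C ∧ ∀ (N : ℕ), 1 ≤ N → ∀ (y : Fin N → ℝ) (u : ℝ) (p : ℂ), Y₀ ≤ p.im →
      phaseDeriv a u y p = 0 → ∀ (A : ℝ → ℂ) (A₀ : ℂ), ContinuousOn A (Set.Ioi 0) →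
      (∀ s : ℝ, 0 < s → ‖weight a u y (p.re + s * I) / weight a u y p‖ * ‖A s - A₀‖ ≤
        L * |s - p.im| * Real.exp (-c * N * (s - p.im) ^ 2)) → ‖A₀‖ ≤ L →
      ‖(∫ s in Set.Ioi (0 : ℝ), weight a u y (p.re + s * I) / weight a u y p * A s) -
        A₀ * gaussConst N (curvature a y p)‖ ≤ C / N := by
  have hδ : 0 < min (Y₀ / 2) (c * Y₀ ^ 3) := by positivity
  have hTδ : 1 / Y₀ ^ 3 * min (Y₀ / 2) (c * Y₀ ^ 3) ≤ c := by
    calc _ ≤ 1 / Y₀ ^ 3 * (c * Y₀ ^ 3) := by gcongr; exact min_le_right _ _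
      _ = c := by field_simp
  obtain ⟨C, hC, H⟩ := norm_integral_sub_gaussian_le hc hδ hL
    (by positivity : 0 ≤ 1 / Y₀ ^ 3) hTδ
  refine ⟨C, hC, fun N hN y u p hp hsad A A₀ hcont hA hA₀ => ?_⟩
  have hN1 : (1 : ℝ) ≤ N := by exact_mod_cast hN
  have hp0 : 0 < p.im := hY₀.trans_le hp
  have hpr : ∀ r : ℝ, (p.re : ℂ) + ((r + p.im : ℝ) : ℂ) * I = p + r * I := by
    intro r; conv_rhs => rw [← re_add_im p]
    push_cast; ring
  set f : ℝ → ℂ := (Set.Ioi (0 : ℝ)).indicator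
    fun s => weight a u y (p.re + s * I) / weight a u y p with hf
  have hW : Continuous fun s : ℝ => weight a u y (p.re + s * I) := by
    unfold weight; fun_prop
  have hint : (∫ s in Set.Ioi (0 : ℝ), weight a u y (p.re + s * I) / weight a u y p * A s) =
      ∫ r : ℝ, f (r + p.im) * A (r + p.im) := by
    rw [integral_add_right_eq_self (fun s => f s * A s) p.im, ← integral_indicator measurableSet_Ioi]
    congr 1
    ext s
    by_cases hs : s ∈ Set.Ioi (0 : ℝ) <;> simp [hf, hs]
  have hcY2 : 2 * c ≤ p.im ^ 2 / (8 * a ^ 4) := by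
    calc 2 * c ≤ 2 * (Y₀ ^ 2 / (16 * a ^ 4)) := by gcongr
      _ = Y₀ ^ 2 / (8 * a ^ 4) := by field_simp; norm_num
      _ ≤ _ := by gcongr
  have hlam : 4 * c ≤ (curvature a y p).re := by
    refine le_trans ?_ (le_curvature_re hN hp0 hsad)
    have : p.im ^ 2 / (8 * a ^ 4) * 2 ≤ 2 * p.im ^ 2 / a ^ 4 := by
      rw [div_mul_eq_mul_div, div_le_div_iff₀ (by positivity) (by positivity)]
      nlinarith [mul_pos (pow_pos hp0 2) (pow_pos ha 4)]
    linarith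
  rw [hint]
  refine H N hN1 (curvature a y p) hlam (fun r => f (r + p.im)) (fun r => A (r + p.im)) A₀
    ?_ ?_ ?_ hA₀ ?_
  · intro r hr
    have h1 : |r| ≤ Y₀ / 2 := hr.trans (min_le_left _ _)
    have h2 : 0 < r + p.im := by linarith [neg_abs_le r]
    have h3 : ‖(r : ℂ) * I‖ = |r| := by simp
    obtain ⟨θ, hθ, hθ2⟩ := weight_div_eq_exp hN hp0 hsad (ζ := r * I) (by rw [h3]; linarith)
    refine ⟨θ, ?_, ?_⟩
    · rw [hf, Set.indicator_of_mem (Set.mem_Ioi.mpr h2), hpr, hθ, mul_pow, I_sq]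
      push_cast
      congr 1; ring
    · rw [h3] at hθ2
      refine hθ2.trans ?_
      gcongr
  · intro r
    rw [hf]
    by_cases hs : r + p.im ∈ Set.Ioi (0 : ℝ)
    · rw [Set.indicator_of_mem hs, norm_div, div_le_iff₀ (norm_pos_iff.mpr (weight_ne_zero hp0.ne'))]
      refine (norm_weight_vertical_le ha hN hp0 hsad _).trans ?_
      rw [abs_of_pos (Set.mem_Ioi.mp hs), add_sub_cancel_right]
      refine mul_le_mul_of_nonneg_right (Real.exp_le_exp.mpr ?_) (norm_nonneg _)
      have : 0 ≤ N * r ^ 2 := by positivity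
      nlinarith
    · rw [Set.indicator_of_notMem hs, norm_zero]; positivity
  · intro r
    by_cases hs : r + p.im ∈ Set.Ioi (0 : ℝ)
    · have := hA _ hs
      rw [add_sub_cancel_right] at this
      simpa only [hf, Set.indicator_of_mem hs] using this
    · simp only [hf, Set.indicator_of_notMem hs, norm_zero, zero_mul]; positivity
  · have h1 : AEStronglyMeasurable (fun s => f s * A s) := by
      have h2 : (fun s => f s * A s) = (Set.Ioi (0 : ℝ)).indicator
          fun s => weight a u y (p.re + s * I) / weight a u y p * A s := by
        ext s
        by_cases hs : s ∈ Set.Ioi (0 : ℝ) <;> simp [hf, hs]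
      rw [h2, aestronglyMeasurable_indicator_iff measurableSet_Ioi]
      exact (((hW.div_const _).continuousOn).mul hcont).aestronglyMeasurable measurableSet_Ioi
    exact h1.comp_quasiMeasurePreserving
      (measurePreserving_add_right volume p.im).quasiMeasurePreserving

/-- Laplace's method on the horizontal line through the saddle point. -/
theorem horizontal_laplace {a Y₀ c L : ℝ} (ha : 0 < a) (hY₀ : 0 < Y₀) (hc : 0 < c)
    (hcY : c ≤ Y₀ ^ 2 / (16 * a ^ 4)) (hL : 0 ≤ L) :
    ∃ C : ℝ, 0 ≤ C ∧ ∀ (N : ℕ), 1 ≤ N → ∀ (y : Fin N → ℝ) (u : ℝ) (p : ℂ), Y₀ ≤ p.im →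
      phaseDeriv a u y p = 0 →
      (∀ r : ℝ, 4 * c * r ^ 2 ≤ r * (phaseDeriv a u y (p + r)).re) →
      ∀ (B : ℝ → ℂ) (B₀ : ℂ), Continuous B → ExpLipschitz L B B₀ →
      ‖(∫ r : ℝ, weight a u y p / weight a u y (p + r) * B r) -
        B₀ * gaussConst N (curvature a y p)‖ ≤ C / N := by
  have hδ : 0 < min (Y₀ / 2) (c * Y₀ ^ 3) := by positivity
  have hTδ : 1 / Y₀ ^ 3 * min (Y₀ / 2) (c * Y₀ ^ 3) ≤ c := by
    calc _ ≤ 1 / Y₀ ^ 3 * (c * Y₀ ^ 3) := by gcongr; exact min_le_right _ _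
      _ = c := by field_simp
  have hL1 : 1 ≤ Real.exp (L ^ 2 / c) := Real.one_le_exp (by positivity)
  obtain ⟨C, hC, H⟩ := norm_integral_sub_gaussian_le hc hδ
    (by positivity : 0 ≤ L * Real.exp (L ^ 2 / c)) (by positivity : 0 ≤ 1 / Y₀ ^ 3) hTδ
  refine ⟨C, hC, fun N hN y u p hp hsad hgrow B B₀ hcont hB => ?_⟩
  have hN1 : (1 : ℝ) ≤ N := by exact_mod_cast hN
  have hp0 : 0 < p.im := hY₀.trans_le hp
  have him : ∀ r : ℝ, (p + r).im ≠ 0 := by intro r; simpa using hp0.ne'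
  have hlam : 4 * c ≤ (curvature a y p).re := by
    refine le_trans ?_ (le_curvature_re hN hp0 hsad)
    have h1 : 4 * c ≤ 4 * (Y₀ ^ 2 / (16 * a ^ 4)) := by gcongr
    have h2 : 4 * (Y₀ ^ 2 / (16 * a ^ 4)) ≤ 4 * (p.im ^ 2 / (16 * a ^ 4)) := by gcongr
    have h3 : 4 * (p.im ^ 2 / (16 * a ^ 4)) ≤ 2 * p.im ^ 2 / a ^ 4 := by
      rw [mul_div_assoc', div_le_div_iff₀ (by positivity) (by positivity)]
      nlinarith [mul_pos (pow_pos hp0 2) (pow_pos ha 4)]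
    linarith
  have hE : ∀ r : ℝ, ‖weight a u y p / weight a u y (p + r)‖ ≤
      Real.exp (-(2 * c) * N * r ^ 2) := by
    intro r
    rw [norm_div, div_le_iff₀ (norm_pos_iff.mpr (weight_ne_zero (him r)))]
    have := norm_weight_horizontal_le hN ha hp0 hgrow r
    rwa [show 4 * c / 2 = 2 * c by ring] at this
  refine H N hN1 (curvature a y p) hlam (fun r => weight a u y p / weight a u y (p + r)) B B₀
    ?_ ?_ ?_ ?_ ?_
  · intro r hr
    have h1 : |r| ≤ Y₀ / 2 := hr.trans (min_le_left _ _)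
    have h3 : ‖(r : ℂ)‖ = |r| := by simp
    obtain ⟨θ, hθ, hθ2⟩ := weight_div_eq_exp hN hp0 hsad (ζ := r) (by rw [h3]; linarith)
    refine ⟨-θ, ?_, ?_⟩
    · rw [← inv_div, hθ, ← exp_neg]
      push_cast
      congr 1; ring
    · rw [h3] at hθ2
      rw [norm_neg]
      refine hθ2.trans ?_
      gcongr
  · intro r
    refine (hE r).trans (Real.exp_le_exp.mpr ?_)
    have : 0 ≤ c * N * r ^ 2 := by positivity
    nlinarith
  · intro r
    exact hB.mul_gaussian_le hc hN1 (hE r)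
  · exact hB.2.1.trans (le_mul_of_one_le_right hL hL1)
  · refine Continuous.aestronglyMeasurable (Continuous.mul ?_ hcont)
    refine Continuous.div continuous_const ?_ fun r => weight_ne_zero (him r)
    unfold weight; fun_prop

theorem expLipschitz_point {B : ℝ} {p : ℂ} (hB : ‖p‖ ≤ B) {d : ℝ → ℂ} (hd : ∀ r, ‖d r‖ ≤ |r|) :
    ExpLipschitz (B + 1) (fun r => p + d r) p := by
  have hB0 : 0 ≤ B := (norm_nonneg p).trans hB
  refine .of_lipschitz (by positivity) (by linarith) fun r => ?_
  rw [add_sub_cancel_left]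
  refine (hd r).trans ?_
  have := abs_nonneg r
  nlinarith

theorem expLipschitz_inv {Y₀ : ℝ} (hY₀ : 0 < Y₀) {p : ℂ} (hp : Y₀ ≤ p.im) (t : ℝ) :
    ExpLipschitz (1 / Y₀ + 1 / Y₀ ^ 2) (fun r : ℝ => 1 / (p + r - t)) (1 / (p - t)) := by
  have h0 := norm_one_div_sub_ofReal_le hY₀ (hp.trans (le_abs_self _)) t
  refine .of_lipschitz (by positivity) (h0.trans (by linarith [show 0 ≤ 1 / Y₀ ^ 2 by positivity]))
    fun r => ?_
  have him : (p + r).im = p.im := by simp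
  have h1 := norm_one_div_sub_ofReal_le (z := p + r) hY₀ (by rw [him]; exact hp.trans (le_abs_self _)) t
  have hn1 := sub_ofReal_ne_zero (z := p + r) (by rw [him]; linarith) t
  have hn0 := sub_ofReal_ne_zero (z := p) (by linarith) t
  have h2 : 1 / (p + r - t) - 1 / (p - t) = -r * (1 / (p + r - t) * (1 / (p - t))) := by
    field_simp; ring
  rw [h2, norm_mul, norm_mul, norm_neg, norm_real, Real.norm_eq_abs]
  calc _ ≤ |r| * (1 / Y₀ * (1 / Y₀)) := by gcongr
    _ = 1 / Y₀ ^ 2 * |r| := by ring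
    _ ≤ _ := by
      gcongr
      linarith [show 0 ≤ 1 / Y₀ by positivity]

theorem ExpLipschitz.average {N : ℕ} {L : ℝ} {f : Fin N → ℝ → ℂ} {f₀ : Fin N → ℂ} (hL : 0 ≤ L)
    (h : ∀ j, ExpLipschitz L (f j) (f₀ j)) :
    ExpLipschitz L (fun r => 1 / (N : ℂ) * ∑ j, f j r) (1 / (N : ℂ) * ∑ j, f₀ j) := by
  refine ⟨hL, norm_average_le hL fun j => (h j).2.1, fun r => ?_⟩
  rw [← mul_sub, ← Finset.sum_sub_distrib]
  exact norm_average_le (by positivity) fun j => (h j).2.2 r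

theorem ExpLipschitz.add {L M : ℝ} {f g : ℝ → ℂ} {f₀ g₀ : ℂ} (hf : ExpLipschitz L f f₀)
    (hg : ExpLipschitz M g g₀) : ExpLipschitz (L + M) (fun r => f r + g r) (f₀ + g₀) := by
  have hL := hf.1
  have hM := hg.1
  refine ⟨add_nonneg hL hM, (norm_add_le _ _).trans (add_le_add hf.2.1 hg.2.1), fun r => ?_⟩
  have h1 := hf.2.2 r
  have h2 := hg.2.2 r
  have h3 : Real.exp (L * |r|) ≤ Real.exp ((L + M) * |r|) := by
    apply Real.exp_le_exp.mpr; gcongr; linarith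
  have h4 : Real.exp (M * |r|) ≤ Real.exp ((L + M) * |r|) := by
    apply Real.exp_le_exp.mpr; gcongr; linarith
  calc _ = ‖(f r - f₀) + (g r - g₀)‖ := by congr 1; ring
    _ ≤ L * |r| * Real.exp (L * |r|) + M * |r| * Real.exp (M * |r|) :=
        (norm_add_le _ _).trans (add_le_add h1 h2)
    _ ≤ L * |r| * Real.exp ((L + M) * |r|) + M * |r| * Real.exp ((L + M) * |r|) := by gcongr
    _ = _ := by ring

theorem expLipschitz_const (k : ℂ) : ExpLipschitz ‖k‖ (fun _ => k) k :=
  .of_lipschitz (norm_nonneg k) le_rfl fun r => by simp only [sub_self, norm_zero]; positivity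

theorem ExpLipschitz.const_mul {L M : ℝ} {f : ℝ → ℂ} {f₀ k : ℂ} (hf : ExpLipschitz L f f₀)
    (hM : 1 ≤ M) (hk : ‖k‖ ≤ M) : ExpLipschitz (M * L) (fun r => k * f r) (k * f₀) := by
  have hL := hf.1
  refine ⟨by positivity, ?_, fun r => ?_⟩
  · rw [norm_mul]; have := hf.2.1; gcongr
  · rw [← mul_sub, norm_mul]
    have h1 : Real.exp (L * |r|) ≤ Real.exp (M * L * |r|) := by
      apply Real.exp_le_exp.mpr
      gcongr
      exact le_mul_of_one_le_left hL hM
    calc _ ≤ M * (L * |r| * Real.exp (L * |r|)) := by gcongr; exact hf.2.2 r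
      _ = M * L * |r| * Real.exp (L * |r|) := by ring
      _ ≤ _ := by gcongr

set_option maxHeartbeats 1000000 in
/-- Asymptotics of the `w`-integrals with the amplitudes that occur in the kernel. -/
theorem vertical_asymptotics {a Y₀ c A B : ℝ} (ha : 0 < a) (hY₀ : 0 < Y₀) (hc : 0 < c)
    (hcY : c ≤ Y₀ ^ 2 / (16 * a ^ 4)) (hA : 0 ≤ A) (hB : 0 ≤ B) :
    ∃ C : ℝ, 0 ≤ C ∧ ∀ (N : ℕ), 1 ≤ N → ∀ (y : Fin N → ℝ) (u : ℝ) (p : ℂ), Y₀ ≤ p.im →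
      phaseDeriv a u y p = 0 → ‖p‖ ≤ B → ∀ α : ℝ, |α| ≤ A →
      ‖(∫ s in Set.Ioi (0 : ℝ), weight a u y (p.re + s * I) / weight a u y p *
          exp (-α * (p.re + s * I))) - exp (-α * p) * gaussConst N (curvature a y p)‖ ≤ C / N ∧
      ‖(∫ s in Set.Ioi (0 : ℝ), weight a u y (p.re + s * I) / weight a u y p *
          (exp (-α * (p.re + s * I)) * (p.re + s * I))) -
          exp (-α * p) * p * gaussConst N (curvature a y p)‖ ≤ C / N ∧
      ∀ k, ‖(∫ s in Set.Ioi (0 : ℝ), weight a u y (p.re + s * I) / weight a u y p *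
          (exp (-α * (p.re + s * I)) * ((p.re + s * I) / (p.re + s * I - y k)))) -
          exp (-α * p) * (p / (p - y k)) * gaussConst N (curvature a y p)‖ ≤ C / N := by
  set L₁ := (A + 1) * Real.exp (A * B) with hL₁
  have hL₁0 : 0 ≤ L₁ := by positivity
  set L₂ := 3 * L₁ * (B + 1) + L₁ + (B + 1) + 1 with hL₂
  have hL₂0 : 0 ≤ L₂ := by positivity
  set M := 1 + B / Y₀ with hM
  have hM0 : 0 ≤ M := by positivity
  set D := 8 * a / Y₀ ^ 2 with hD
  have hD0 : 0 ≤ D := by positivity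
  set L := L₁ * Real.exp (L₁ ^ 2 / c) + L₂ * Real.exp (L₂ ^ 2 / c) +
    (L₁ * Real.exp (L₁ ^ 2 / c) * M + L₁ * M * D + L₁ * M) + L₁ + L₂ with hL
  have hL0 : 0 ≤ L := by positivity
  have q1 : 0 ≤ L₁ * Real.exp (L₁ ^ 2 / c) := by positivity
  have q2 : 0 ≤ L₂ * Real.exp (L₂ ^ 2 / c) := by positivity
  have q3 : 0 ≤ L₁ * Real.exp (L₁ ^ 2 / c) * M := by positivity
  have q4 : 0 ≤ L₁ * M * D := by positivity
  have q5 : 0 ≤ L₁ * M := by positivity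
  clear_value L D M L₂ L₁
  obtain ⟨C, hC, H⟩ := vertical_laplace ha hY₀ hc hcY hL0
  refine ⟨C, hC, fun N hN y u p hp hsad hpB α hα => ?_⟩
  have hN1 : (1 : ℝ) ≤ N := by exact_mod_cast hN
  have hp0 : 0 < p.im := hY₀.trans_le hp
  have hpr : ∀ s : ℝ, (p.re : ℂ) + s * I = p + ((s - p.im : ℝ) : ℂ) * I := by
    intro s
    push_cast
    linear_combination re_add_im p
  have hd : ∀ r : ℝ, ‖(r : ℂ) * I‖ ≤ |r| := by intro r; simp
  have hα' : ‖(-α : ℂ)‖ ≤ A := by simpa using hα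
  have hE : ∀ s : ℝ, 0 < s → ‖weight a u y (p.re + s * I) / weight a u y p‖ ≤
      Real.exp (-(2 * c) * N * (s - p.im) ^ 2) := by
    intro s hs
    rw [norm_div, div_le_iff₀ (norm_pos_iff.mpr (weight_ne_zero hp0.ne'))]
    refine (norm_weight_vertical_le ha hN hp0 hsad _).trans ?_
    rw [abs_of_pos hs]
    refine mul_le_mul_of_nonneg_right (Real.exp_le_exp.mpr ?_) (norm_nonneg _)
    have h1 : 2 * c ≤ p.im ^ 2 / (8 * a ^ 4) := by
      calc 2 * c ≤ 2 * (Y₀ ^ 2 / (16 * a ^ 4)) := by gcongr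
        _ = Y₀ ^ 2 / (8 * a ^ 4) := by field_simp; norm_num
        _ ≤ _ := by gcongr
    have : 0 ≤ N * (s - p.im) ^ 2 := by positivity
    nlinarith
  have e1 := expLipschitz_exp hA hα' hpB hd
  have e2 := e1.mul (expLipschitz_point hpB hd)
  rw [← hL₁] at e1
  rw [← hL₁, ← hL₂] at e2
  have hne : ∀ s : ℝ, 0 < s → ∀ k, (p.re : ℂ) + s * I - y k ≠ 0 := fun s hs k =>
    sub_ofReal_ne_zero (by simpa using hs.ne') _
  refine ⟨H N hN y u p hp hsad (fun s => exp (-α * (p.re + s * I))) _ (by fun_prop) ?_ ?_,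
    H N hN y u p hp hsad (fun s => exp (-α * (p.re + s * I)) * (p.re + s * I)) _ (by fun_prop) ?_ ?_,
    fun k => H N hN y u p hp hsad
      (fun s => exp (-α * (p.re + s * I)) * ((p.re + s * I) / (p.re + s * I - y k))) _ ?_ ?_ ?_⟩
  · intro s hs
    have := e1.mul_gaussian_le hc hN1 (hE s hs)
    simp only [← hpr] at this
    refine this.trans ?_
    gcongr
    rw [hL]; linarith
  · refine e1.2.1.trans ?_
    rw [hL]; linarith
  · intro s hs
    have := e2.mul_gaussian_le hc hN1 (hE s hs)
    simp only [← hpr] at this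
    refine this.trans ?_
    gcongr
    rw [hL]; linarith
  · refine e2.2.1.trans ?_
    rw [hL]; linarith
  · refine ContinuousOn.mul (by fun_prop) (ContinuousOn.div (by fun_prop) (by fun_prop) ?_)
    exact fun s hs => hne s hs k
  · intro s hs
    have hk0 : p - y k ≠ 0 := sub_ofReal_ne_zero hp0.ne' _
    have hw0 := hne s hs k
    have hinv := norm_one_div_sub_ofReal_le hY₀ (hp.trans (le_abs_self _)) (y k)
    have hM1 : ‖p / (p - y k)‖ ≤ M := by
      rw [div_eq_mul_one_div, norm_mul, hM]
      calc _ ≤ B * (1 / Y₀) := by gcongr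
        _ ≤ _ := by rw [mul_one_div]; linarith
    have hM2 : ‖(y k : ℂ) / (p - y k)‖ ≤ M := by
      have : (y k : ℂ) / (p - y k) = p * (1 / (p - y k)) - 1 := by field_simp; ring
      rw [this, hM]
      refine (norm_sub_le _ _).trans ?_
      rw [norm_mul, norm_one]
      have : ‖p‖ * ‖1 / (p - y k)‖ ≤ B * (1 / Y₀) := by gcongr
      rw [mul_one_div] at this
      linarith
    have hexp : ‖exp (-α * (p.re + s * I))‖ ≤ L₁ := by
      rw [norm_exp]
      have : (-α * ((p.re : ℂ) + s * I)).re = -α * p.re := by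
        rw [← ofReal_neg, re_ofReal_mul]; simp
      rw [this]
      have h1 : -α * p.re ≤ A * B := by
        have h2 : |α * p.re| ≤ A * B := by
          rw [abs_mul]; gcongr; exact (abs_re_le_norm p).trans hpB
        linarith [neg_abs_le (α * p.re)]
      rw [hL₁]
      exact (Real.exp_le_exp.mpr h1).trans
        (le_mul_of_one_le_left (Real.exp_nonneg _) (by linarith))
    have hrem : ‖weight a u y (p.re + s * I) / weight a u y p‖ * ‖1 / ((p.re : ℂ) + s * I - y k)‖ ≤
        D * Real.exp (-c * N * (s - p.im) ^ 2) := by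
      rw [norm_div, norm_div, norm_one, mul_one_div, div_div,
        div_le_iff₀ (mul_pos (norm_pos_iff.mpr (weight_ne_zero hp0.ne')) (norm_pos_iff.mpr hw0))]
      refine (norm_weight_vertical_le_mul ha hN hp0 hsad s k).trans ?_
      rw [abs_of_pos hs, ← mul_assoc]
      refine mul_le_mul_of_nonneg_right (mul_le_mul_of_nonneg_right ?_ (norm_nonneg _))
        (norm_nonneg _)
      have h1 : c ≤ p.im ^ 2 / (16 * a ^ 4) := hcY.trans (by gcongr)
      have h2 : Real.exp (-(p.im ^ 2 / (16 * a ^ 4)) * N * (s - p.im) ^ 2) ≤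
          Real.exp (-c * N * (s - p.im) ^ 2) := by
        apply Real.exp_le_exp.mpr
        have : 0 ≤ N * (s - p.im) ^ 2 := by positivity
        nlinarith
      rw [hD]
      gcongr
    have hbase := e1.mul_gaussian_le hc hN1 (hE s hs)
    simp only [← hpr] at hbase
    -- the only singular part of the difference carries the factor `w - p`
    have hsplit : exp (-α * (p.re + s * I)) * ((p.re + s * I) / (p.re + s * I - y k)) -
        exp (-α * p) * (p / (p - y k)) =
        (exp (-α * (p.re + s * I)) - exp (-α * p)) * (p / (p - y k)) -
          exp (-α * (p.re + s * I)) * ((y k : ℂ) / (p - y k)) * (((s - p.im : ℝ) : ℂ) * I) *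
            (1 / (p.re + s * I - y k)) := by
      have : ((s - p.im : ℝ) : ℂ) * I = (p.re + s * I) - p := by rw [hpr s]; ring
      rw [this]
      field_simp
      ring
    rw [hsplit]
    set E := ‖weight a u y (p.re + s * I) / weight a u y p‖ with hEdef
    have hE0 : 0 ≤ E := norm_nonneg _
    calc _ ≤ E * (‖exp (-α * (p.re + s * I)) - exp (-α * p)‖ * M +
          L₁ * M * |s - p.im| * ‖1 / ((p.re : ℂ) + s * I - y k)‖) := by
          refine mul_le_mul_of_nonneg_left ((norm_sub_le _ _).trans ?_) hE0
          simp only [norm_mul]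
          rw [norm_real, norm_I, mul_one, Real.norm_eq_abs]
          gcongr
      _ = E * ‖exp (-α * (p.re + s * I)) - exp (-α * p)‖ * M +
          L₁ * M * |s - p.im| * (E * ‖1 / ((p.re : ℂ) + s * I - y k)‖) := by ring
      _ ≤ L₁ * Real.exp (L₁ ^ 2 / c) * |s - p.im| * Real.exp (-c * N * (s - p.im) ^ 2) * M +
          L₁ * M * |s - p.im| * (D * Real.exp (-c * N * (s - p.im) ^ 2)) :=
          add_le_add (mul_le_mul_of_nonneg_right hbase hM0)
            (mul_le_mul_of_nonneg_left hrem (by positivity))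
      _ = (L₁ * Real.exp (L₁ ^ 2 / c) * M + L₁ * M * D) * |s - p.im| *
          Real.exp (-c * N * (s - p.im) ^ 2) := by ring
      _ ≤ _ := by
          gcongr
          rw [hL]; linarith
  · rw [norm_mul]
    have hinv := norm_one_div_sub_ofReal_le hY₀ (hp.trans (le_abs_self _)) (y k)
    have hM1 : ‖p / (p - y k)‖ ≤ M := by
      rw [div_eq_mul_one_div, norm_mul, hM]
      calc _ ≤ B * (1 / Y₀) := by gcongr
        _ ≤ _ := by rw [mul_one_div]; linarith
    calc _ ≤ L₁ * M := by gcongr; exact e1.2.1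
      _ ≤ L := by rw [hL]; linarith

/-- Asymptotics of the `z`-integrals with the amplitudes that occur in the kernel. -/
theorem horizontal_asymptotics {a Y₀ c A B : ℝ} (ha : 0 < a) (hY₀ : 0 < Y₀) (hc : 0 < c)
    (hcY : c ≤ Y₀ ^ 2 / (16 * a ^ 4)) (hA : 0 ≤ A) (hB : 0 ≤ B) :
    ∃ C : ℝ, 0 ≤ C ∧ ∀ (N : ℕ), 1 ≤ N → ∀ (y : Fin N → ℝ) (u : ℝ) (p : ℂ), Y₀ ≤ p.im →
      phaseDeriv a u y p = 0 →
      (∀ r : ℝ, 4 * c * r ^ 2 ≤ r * (phaseDeriv a u y (p + r)).re) →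
      ‖p‖ ≤ B → ∀ α v : ℝ, |α| ≤ A → |v| ≤ B →
      ‖(∫ r : ℝ, weight a u y p / weight a u y (p + r) * (expQuot (α * (p + r)) *
          (p + r - v + a ^ 2 * stieltjes y (p + r)))) -
        expQuot (α * p) * (p - v + a ^ 2 * stieltjes y p) *
          gaussConst N (curvature a y p)‖ ≤ C / N ∧
      ‖(∫ r : ℝ, weight a u y p / weight a u y (p + r) * expQuot (α * (p + r))) -
        expQuot (α * p) * gaussConst N (curvature a y p)‖ ≤ C / N ∧
      ∀ k, ‖(∫ r : ℝ, weight a u y p / weight a u y (p + r) * (expQuot (α * (p + r)) *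
          (1 / (p + r - y k)))) -
        expQuot (α * p) * (1 / (p - y k)) * gaussConst N (curvature a y p)‖ ≤ C / N := by
  set L₁ := (A + 1) * Real.exp (A * B) with hL₁
  have hL₁0 : 0 ≤ L₁ := by positivity
  set L₂ := 1 / Y₀ + 1 / Y₀ ^ 2 with hL₂
  have hL₂0 : 0 ≤ L₂ := by positivity
  set L₃ := (B + 1) + B + (a ^ 2 + 1) * L₂ with hL₃
  have hL₃0 : 0 ≤ L₃ := by positivity
  set L₄ := 3 * L₁ * L₃ + L₁ + L₃ + 1 with hL₄
  have hL₄0 : 0 ≤ L₄ := by positivity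
  set L₅ := 3 * L₁ * L₂ + L₁ + L₂ + 1 with hL₅
  have hL₅0 : 0 ≤ L₅ := by positivity
  obtain ⟨C, hC, H⟩ := horizontal_laplace ha hY₀ hc hcY
    (by positivity : 0 ≤ L₁ + L₄ + L₅)
  refine ⟨C, hC, fun N hN y u p hp hsad hgrow hpB α v hα hv => ?_⟩
  have hp0 : 0 < p.im := hY₀.trans_le hp
  have hd : ∀ r : ℝ, ‖(r : ℂ)‖ ≤ |r| := by intro r; simp
  have hα' : ‖(α : ℂ)‖ ≤ A := by simpa using hα
  have e1 := expLipschitz_expQuot hA hα' hpB hd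
  rw [← hL₁] at e1
  have e2 := fun k => expLipschitz_inv hY₀ hp (y k)
  have e3 : ExpLipschitz L₃ (fun r : ℝ => p + r - v + a ^ 2 * stieltjes y (p + r))
      (p - v + a ^ 2 * stieltjes y p) := by
    have h1 := ((expLipschitz_point hpB hd).add ((expLipschitz_const (-v : ℂ)).mono
      (L' := B) (by simpa using hv))).add ((ExpLipschitz.average hL₂0 e2).const_mul
        (M := a ^ 2 + 1) (k := (a : ℂ) ^ 2) (by nlinarith) (by simp))
    simpa only [sub_eq_add_neg, stieltjes] using h1
  have e4 := e1.mul e3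
  have e5 := fun k => e1.mul (e2 k)
  have him : ∀ r : ℝ, (p + r).im ≠ 0 := by intro r; simpa using hp0.ne'
  have hcq : Continuous fun r : ℝ => expQuot (α * (p + r)) := by
    refine continuous_iff_continuousAt.mpr fun r => ?_
    have h1 : p + r ≠ 0 := by intro h; apply him r; rw [h]; simp
    exact (differentiableAt_expQuot_mul α h1).continuousAt.comp
      (f := fun r : ℝ => p + (r : ℂ)) (by fun_prop)
  have hci : ∀ k, Continuous fun r : ℝ => 1 / (p + r - y k) := fun k =>
    Continuous.div continuous_const (by fun_prop) fun r => sub_ofReal_ne_zero (him r) _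
  have hcs : Continuous fun r : ℝ => stieltjes y (p + r) := by
    unfold stieltjes
    exact continuous_const.mul (continuous_finsetSum _ fun k _ => hci k)
  refine ⟨H N hN y u p hp hsad hgrow _ _ ?_ (e4.mono ?_), H N hN y u p hp hsad hgrow _ _ hcq
    (e1.mono ?_), fun k => H N hN y u p hp hsad hgrow _ _ (hcq.mul (hci k)) ((e5 k).mono ?_)⟩
  · exact hcq.mul (by fun_prop)
  · rw [← hL₄]; linarith
  · linarith
  · rw [← hL₂, ← hL₅]; linarith

/-! ### Reduction of the kernel to products of single integrals -/

/-- An entire function, commuting with conjugation, with Gaussian decay along vertical lines,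
locally uniformly in the line. -/
structure VerticalDecay (F : ℂ → ℂ) : Prop where
  differentiable : Differentiable ℂ F
  conj : ∀ z, F ((starRingEnd ℂ) z) = (starRingEnd ℂ) (F z)
  bound : ∀ X : ℝ, ∃ C c : ℝ, 0 < c ∧ ∀ b s : ℝ, |b| ≤ X → ‖F (b + s * I)‖ ≤ C * Real.exp (-c * s ^ 2)

/-- A function holomorphic in the upper half plane, commuting with conjugation, with Gaussian
decay along horizontal lines, locally uniformly in the line. In the applications it has poles on the
real axis, so that only the upper half plane is used. -/
structure HorizontalDecay (Q : ℂ → ℂ) : Prop where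
  differentiableOn : DifferentiableOn ℂ Q {z | 0 < z.im}
  conj : ∀ z, Q ((starRingEnd ℂ) z) = (starRingEnd ℂ) (Q z)
  bound : ∀ η X : ℝ, 0 < η → ∃ C c : ℝ, 0 < c ∧ ∀ t s : ℝ, η ≤ s → s ≤ X →
    ‖Q (t + s * I)‖ ≤ C * Real.exp (-c * t ^ 2)

theorem VerticalDecay.integrable {F : ℂ → ℂ} (h : VerticalDecay F) (x : ℝ) :
    Integrable fun s : ℝ => F (x + s * I) := by
  obtain ⟨C, c, hc, hb⟩ := h.bound |x|
  exact integrable_of_norm_le_gaussian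
    (h.differentiable.continuous.comp (by fun_prop)).aestronglyMeasurable hc
    fun s => hb x s le_rfl

theorem VerticalDecay.integral_eq {F : ℂ → ℂ} (h : VerticalDecay F) (x : ℝ) :
    ∫ s : ℝ, F (((0 : ℝ) : ℂ) + s * I) = ∫ s : ℝ, F (x + s * I) := by
  -- rotate by `I` to apply the lemma on horizontal lines
  have key : ∀ a b : ℝ, a ≤ b → ∫ s : ℝ, F ((-a : ℝ) + s * I) = ∫ s : ℝ, F ((-b : ℝ) + s * I) := by
    intro a b hab
    obtain ⟨C, c, hc, hb⟩ := h.bound (max |a| |b|)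
    have hrot : ∀ t s : ℝ, I * ((t : ℂ) + s * I) = (-s : ℝ) + t * I := by
      intro t s; push_cast; ring_nf; rw [I_sq]; ring
    have := integral_horizontal_line_eq (F := fun z => F (I * z)) hab
      (h.differentiable.comp (by fun_prop)).differentiableOn hc (C := C) (fun t s h1 h2 => by
        rw [hrot]
        refine hb _ _ ?_
        rw [abs_neg]
        exact abs_le_max_abs_abs h1 h2)
    simpa only [hrot] using this
  rcases le_total 0 x with hx | hx
  · have := key (-x) 0 (by linarith)
    rw [neg_neg, neg_zero] at this
    exact this.symm
  · have := key 0 (-x) (by linarith)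
    rwa [neg_neg, neg_zero] at this

/-- The integral over a vertical line is twice the real part of that over its upper half. -/
theorem VerticalDecay.integralVertical_eq {F : ℂ → ℂ} (h : VerticalDecay F) (x : ℝ) :
    integralVertical F = I * ((∫ s in Set.Ioi (0 : ℝ), F (x + s * I)) +
      (starRingEnd ℂ) (∫ s in Set.Ioi (0 : ℝ), F (x + s * I))) := by
  have h0 : integralVertical F = I * ∫ s : ℝ, F (((0 : ℝ) : ℂ) + s * I) := by
    rw [integralVertical, integral_mul_const, mul_comm]
    congr 2
    ext t
    rw [ofReal_zero, zero_add, mul_comm]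
  rw [h0, h.integral_eq x, ← intervalIntegral.integral_Iic_add_Ioi (b := (0 : ℝ))
    (h.integrable x).integrableOn (h.integrable x).integrableOn, add_comm]
  congr 2
  have h1 := integral_comp_neg_Ioi (0 : ℝ) (fun s : ℝ => F (x + s * I))
  rw [neg_zero] at h1
  rw [← h1, ← integral_conj]
  congr 1
  ext s
  rw [← h.conj]
  congr 1
  simp

theorem HorizontalDecay.continuous_line {Q : ℂ → ℂ} (h : HorizontalDecay Q) {s : ℝ} (hs : 0 < s) :
    Continuous fun t : ℝ => Q (t + s * I) := by
  refine h.differentiableOn.continuousOn.comp_continuous (by fun_prop) fun t => ?_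
  simpa using hs

theorem HorizontalDecay.integrable {Q : ℂ → ℂ} (h : HorizontalDecay Q) {s : ℝ} (hs : 0 < s) :
    Integrable fun t : ℝ => Q (t + s * I) := by
  obtain ⟨C, c, hc, hb⟩ := h.bound s s hs
  exact integrable_of_norm_le_gaussian (h.continuous_line hs).aestronglyMeasurable hc
    fun t => hb t s le_rfl le_rfl

theorem HorizontalDecay.integral_eq {Q : ℂ → ℂ} (h : HorizontalDecay Q) {κ s : ℝ} (hκ : 0 < κ)
    (hs : 0 < s) : ∫ t : ℝ, Q (t + κ * I) = ∫ t : ℝ, Q (t + s * I) := by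
  have key : ∀ a b : ℝ, 0 < a → a ≤ b → ∫ t : ℝ, Q (t + a * I) = ∫ t : ℝ, Q (t + b * I) := by
    intro a b ha hab
    obtain ⟨C, c, hc, hb⟩ := h.bound a b ha
    exact integral_horizontal_line_eq hab
      (h.differentiableOn.mono fun z hz => ha.trans_le hz.1) hc hb
  rcases le_total κ s with h1 | h1
  · exact key κ s hκ h1
  · exact (key s κ hs h1).symm

theorem HorizontalDecay.integrable_upper {Q : ℂ → ℂ} (h : HorizontalDecay Q) {κ : ℝ}
    (hκ : 0 < κ) : Integrable fun t : ℝ => Q (-(t : ℂ) + I * κ) * (-1) := by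
  have := ((h.integrable hκ).comp_neg).mul_const (-1)
  refine this.congr (ae_of_all _ fun t => ?_)
  simp only [ofReal_neg]
  rw [mul_comm I]

theorem HorizontalDecay.integrable_lower {Q : ℂ → ℂ} (h : HorizontalDecay Q) {κ : ℝ}
    (hκ : 0 < κ) : Integrable fun t : ℝ => Q ((t : ℂ) - I * κ) := by
  have h1 := h.integrable hκ
  have h2 : Integrable fun t : ℝ => (starRingEnd ℂ) (Q (t + κ * I)) :=
    (LinearIsometryEquiv.integrable_comp_iff (μ := volume) conjLIE).mpr h1
  refine h2.congr (ae_of_all _ fun t => ?_)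
  simp only
  rw [← h.conj]
  congr 1
  simp [mul_comm I, sub_eq_add_neg]

/-- The lower line of the contour carries the conjugate of the integral over the upper one, which
is shifted to the line through `p`. -/
theorem HorizontalDecay.integralGamma_eq {Q : ℂ → ℂ} (h : HorizontalDecay Q) {κ : ℝ} (hκ : 0 < κ)
    {p : ℂ} (hp : 0 < p.im) : integralGamma κ Q =
      (starRingEnd ℂ) (∫ r : ℝ, Q (p + r)) - ∫ r : ℝ, Q (p + r) := by
  have h1 : ∫ t : ℝ, Q (-(t : ℂ) + I * κ) * (-1) = -∫ t : ℝ, Q (t + κ * I) := by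
    rw [integral_mul_const, mul_neg_one, ← integral_neg_eq_self]
    congr 2
    ext t
    push_cast
    rw [neg_neg, mul_comm I]
  have h2 : ∫ t : ℝ, Q ((t : ℂ) - I * κ) = (starRingEnd ℂ) (∫ t : ℝ, Q (t + κ * I)) := by
    rw [← integral_conj]
    congr 1
    ext t
    rw [← h.conj]
    congr 1
    simp [mul_comm I, sub_eq_add_neg]
  have h3 : ∫ r : ℝ, Q (p + r) = ∫ t : ℝ, Q (t + κ * I) := by
    rw [h.integral_eq hκ hp,
      ← integral_add_right_eq_self (fun t : ℝ => Q (t + p.im * I)) p.re]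
    congr 1
    ext r
    congr 1
    push_cast
    linear_combination -re_add_im p
  rw [integralGamma, h1, h2, h3]
  ring

/-- Double contour integrals of finite sums of products. The integrand has this form only off the
real axis; on the vertical contour the exceptional point `w = 0` is a null set. -/
theorem integralGamma_integralVertical_eq {ι : Type*} [Fintype ι] {G : ℂ → ℂ → ℂ}
    {Q V : ι → ℂ → ℂ} (k : ι → ℂ) (hQ : ∀ i, HorizontalDecay (Q i))
    (hV : ∀ i, VerticalDecay (V i)) {κ : ℝ} (hκ : 0 < κ)
    (hG : ∀ z w : ℂ, z.im ≠ 0 → w.im ≠ 0 → G z w = ∑ i, k i * (Q i z * V i w)) {p : ℂ}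
    (hp : 0 < p.im) :
    integralGamma κ (fun z => integralVertical (G z)) =
      ∑ i, k i * (((starRingEnd ℂ) (∫ r : ℝ, Q i (p + r)) - ∫ r : ℝ, Q i (p + r)) *
        (I * ((∫ s in Set.Ioi (0 : ℝ), V i (p.re + s * I)) +
          (starRingEnd ℂ) (∫ s in Set.Ioi (0 : ℝ), V i (p.re + s * I))))) := by
  have hinner : ∀ z : ℂ, z.im ≠ 0 →
      integralVertical (G z) = ∑ i, Q i z * (k i * integralVertical (V i)) := by
    intro z hz
    have hae : (fun t : ℝ => G z (I * t) * I) =ᵐ[volume]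
        fun t : ℝ => ∑ i, Q i z * k i * (V i (I * t) * I) := by
      have h0 : ∀ᵐ t : ℝ, t ≠ 0 := by simp [ae_iff, measure_singleton]
      filter_upwards [h0] with t ht
      rw [hG z (I * t) hz (by simpa using ht), Finset.sum_mul]
      exact Finset.sum_congr rfl fun i _ => by ring
    rw [integralVertical, integral_congr_ae hae, integral_finsetSum]
    · exact Finset.sum_congr rfl fun i _ => by rw [integral_const_mul, integralVertical, mul_assoc]
    · intro i _
      refine ((((hV i).integrable 0).mul_const I).congr (ae_of_all _ fun t => ?_)).const_mul _
      simp [mul_comm I]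
  have h1 : ∀ t : ℝ, (-(t : ℂ) + I * κ).im ≠ 0 := by intro t; simpa using hκ.ne'
  have h2 : ∀ t : ℝ, ((t : ℂ) - I * κ).im ≠ 0 := by intro t; simpa using hκ.ne'
  have houter : integralGamma κ (fun z => integralVertical (G z)) =
      ∑ i, integralGamma κ (Q i) * (k i * integralVertical (V i)) := by
    simp only [integralGamma]
    simp_rw [fun t : ℝ => hinner _ (h1 t), fun t : ℝ => hinner _ (h2 t), Finset.sum_mul]
    rw [integral_finsetSum, integral_finsetSum, ← Finset.sum_add_distrib]
    · refine Finset.sum_congr rfl fun i _ => ?_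
      generalize k i * integralVertical (V i) = W
      rw [integral_mul_const, add_mul, ← integral_mul_const, ← integral_mul_const]
      congr 1
      simp only [mul_right_comm _ W]
      rw [integral_mul_const]
    · exact fun i _ => ((hQ i).integrable_lower hκ).mul_const _
    · intro i _
      simp_rw [mul_right_comm _ (k i * integralVertical (V i))]
      exact ((hQ i).integrable_upper hκ).mul_const _
  rw [houter]
  exact Finset.sum_congr rfl fun i _ => by
    rw [(hQ i).integralGamma_eq hκ hp, (hV i).integralVertical_eq p.re]
    ring

theorem verticalDecay_of_polynomial {a : ℝ} (ha : 0 < a) {N : ℕ} (hN : 1 ≤ N) (y : Fin N → ℝ)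
    (u α : ℝ) (S : Finset (Fin N)) (m : ℕ) :
    VerticalDecay fun w => (∏ j ∈ S, (w - y j)) *
      exp (N * (w ^ 2 - 2 * u * w) / (2 * (a : ℂ) ^ 2)) * (exp (-α * w) * w ^ m) where
  differentiable := by fun_prop
  conj := by
    intro z
    have : (starRingEnd ℂ) (2 : ℂ) = 2 := conj_ofNat 2
    simp [← exp_conj, map_prod, this]
  bound := by
    intro X
    have hN0 : (0 : ℝ) < N := by exact_mod_cast hN
    set c := N / (4 * a ^ 2) with hc
    have hc0 : 0 < c := by positivity
    set P := ∏ j, (1 + |y j|) with hP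
    have hP0 : 0 ≤ P := Finset.prod_nonneg fun j _ => by positivity
    set D : ℝ := N + |α| + m with hD
    have hD0 : 0 ≤ D := by positivity
    refine ⟨P * Real.exp (D * X + N * (X ^ 2 + 2 * |u| * X) / (2 * a ^ 2)) * Real.exp (D ^ 2 / c),
      c, hc0, fun b s hb => ?_⟩
    set w : ℂ := b + s * I with hw
    have hX : 0 ≤ X := (abs_nonneg b).trans hb
    have hnw : ‖w‖ ≤ X + |s| := by
      refine (norm_add_le _ _).trans ?_
      simpa using hb
    have h1 : ‖∏ j ∈ S, (w - y j)‖ ≤ P * Real.exp (N * ‖w‖) := by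
      rw [norm_prod]
      calc ∏ j ∈ S, ‖w - y j‖ ≤ ∏ j ∈ S, ((1 + |y j|) * Real.exp ‖w‖) := by
            refine Finset.prod_le_prod (fun _ _ => norm_nonneg _) fun j _ => ?_
            refine (norm_sub_le _ _).trans ?_
            rw [norm_real, Real.norm_eq_abs]
            have e1 := Real.add_one_le_exp ‖w‖
            nlinarith [norm_nonneg w, abs_nonneg (y j)]
        _ ≤ ∏ j, ((1 + |y j|) * Real.exp ‖w‖) := by
            refine Finset.prod_le_prod_of_subset_of_one_le (Finset.subset_univ S)
              (fun j _ => by positivity) fun j _ _ => ?_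
            have e1 := Real.one_le_exp (norm_nonneg w)
            nlinarith [abs_nonneg (y j)]
        _ = P * Real.exp (N * ‖w‖) := by
            rw [Finset.prod_mul_distrib, Finset.prod_const, Finset.card_univ, Fintype.card_fin,
              Real.exp_nat_mul]
    have h2 : ‖exp (N * (w ^ 2 - 2 * u * w) / (2 * (a : ℂ) ^ 2))‖ ≤
        Real.exp (N * (X ^ 2 + 2 * |u| * X) / (2 * a ^ 2)) * Real.exp (-(2 * c) * 1 * s ^ 2) := by
      have e1 : (N * (w ^ 2 - 2 * u * w) / (2 * (a : ℂ) ^ 2)) =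
          ((N * (b ^ 2 - s ^ 2 - 2 * u * b) / (2 * a ^ 2) : ℝ) : ℂ) +
            ((N * (2 * b * s - 2 * u * s) / (2 * a ^ 2) : ℝ) : ℂ) * I := by
        have : w ^ 2 = b ^ 2 + 2 * b * s * I - s ^ 2 := by rw [hw]; ring_nf; rw [I_sq]; ring
        rw [this, hw]; push_cast; ring
      rw [norm_exp, e1, add_re, ofReal_re, re_ofReal_mul, I_re, mul_zero, add_zero, ← Real.exp_add]
      apply Real.exp_le_exp.mpr
      have e2 : -(2 * c) * 1 * s ^ 2 = N * (-s ^ 2) / (2 * a ^ 2) := by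
        rw [hc]; field_simp; norm_num
      rw [e2, ← add_div]
      gcongr
      rw [← mul_add]
      gcongr
      have e3 : b ^ 2 ≤ X ^ 2 := by rw [← sq_abs b]; gcongr
      have e4 : -(u * b) ≤ |u| * X := by
        calc -(u * b) ≤ |u * b| := neg_le_abs _
          _ ≤ _ := by rw [abs_mul]; gcongr
      linarith
    have h3 : ‖exp (-α * w) * w ^ m‖ ≤ Real.exp (|α| * ‖w‖) * Real.exp (m * ‖w‖) := by
      rw [norm_mul, norm_pow, Real.exp_nat_mul]
      gcongr
      · refine (norm_exp_le_exp_norm _).trans (Real.exp_le_exp.mpr ?_)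
        rw [norm_mul, norm_neg, norm_real, Real.norm_eq_abs]
      · linarith [Real.add_one_le_exp ‖w‖]
    have h4 : Real.exp (D * ‖w‖) ≤ Real.exp (D * X) * Real.exp (D * |s|) := by
      rw [← Real.exp_add, ← mul_add]; gcongr
    have h5 := exp_linear_mul_gaussian_le hD0 hc0 le_rfl s
    rw [mul_one] at h5
    calc ‖_ * _ * _‖ ≤ P * Real.exp (N * ‖w‖) *
          (Real.exp (N * (X ^ 2 + 2 * |u| * X) / (2 * a ^ 2)) * Real.exp (-(2 * c) * 1 * s ^ 2)) *
          (Real.exp (|α| * ‖w‖) * Real.exp (m * ‖w‖)) := by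
          rw [norm_mul, norm_mul]; gcongr
      _ = P * Real.exp (N * (X ^ 2 + 2 * |u| * X) / (2 * a ^ 2)) * Real.exp (D * ‖w‖) *
          Real.exp (-(2 * c) * 1 * s ^ 2) := by
          have : Real.exp (D * ‖w‖) =
              Real.exp (N * ‖w‖) * Real.exp (|α| * ‖w‖) * Real.exp (m * ‖w‖) := by
            rw [← Real.exp_add, ← Real.exp_add]; congr 1; rw [hD]; ring
          rw [this]; ring
      _ ≤ P * Real.exp (N * (X ^ 2 + 2 * |u| * X) / (2 * a ^ 2)) *
          (Real.exp (D * X) * Real.exp (D * |s|)) * Real.exp (-(2 * c) * 1 * s ^ 2) := by gcongr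
      _ = P * (Real.exp (D * X) * Real.exp (N * (X ^ 2 + 2 * |u| * X) / (2 * a ^ 2))) *
          (Real.exp (D * |s|) * Real.exp (-(2 * c) * 1 * s ^ 2)) := by ring
      _ ≤ P * (Real.exp (D * X) * Real.exp (N * (X ^ 2 + 2 * |u| * X) / (2 * a ^ 2))) *
          (Real.exp (D ^ 2 / c) * Real.exp (-c * s ^ 2)) := by
          rw [mul_one]
          exact mul_le_mul_of_nonneg_left (by simpa using h5) (by positivity)
      _ = _ := by rw [← Real.exp_add]; ring

theorem horizontalDecay_of_amplitude {a : ℝ} (ha : 0 < a) {N : ℕ} (hN : 1 ≤ N) (y : Fin N → ℝ)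
    (u α : ℝ) {B : ℂ → ℂ} (hd : DifferentiableOn ℂ B {z | 0 < z.im})
    (hconj : ∀ z, B ((starRingEnd ℂ) z) = (starRingEnd ℂ) (B z))
    (hbd : ∀ η : ℝ, 0 < η → ∃ K : ℝ, 0 ≤ K ∧ ∀ z : ℂ, η ≤ z.im → ‖B z‖ ≤ K * Real.exp (K * ‖z‖)) :
    HorizontalDecay fun z => 1 / weight a u y z * (expQuot (α * z) * B z) where
  differentiableOn := by
    have h1 : DifferentiableOn ℂ (fun z : ℂ => expQuot (α * z)) {z | 0 < z.im} := fun z hz =>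
      (differentiableAt_expQuot_mul α (by rintro rfl; simp at hz)).differentiableWithinAt
    have h2 : DifferentiableOn ℂ (weight a u y) {z | 0 < z.im} := by
      unfold weight; fun_prop
    exact ((differentiableOn_const 1).div h2 fun z hz => weight_ne_zero (ne_of_gt hz)).mul
      (h1.mul hd)
  conj := by
    intro z
    have h1 := expQuot_conj (α * z)
    rw [map_mul, conj_ofReal] at h1
    simp only [map_mul, map_div₀, map_one, weight_conj, hconj, h1]
  bound := by
    intro η X hη
    obtain ⟨K, hK0, hK⟩ := hbd η hη
    have hN0 : (0 : ℝ) < N := by exact_mod_cast hN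
    set c := N / (4 * a ^ 2) with hc
    have hc0 : 0 < c := by positivity
    set D : ℝ := |α| + K + N * |u| / a ^ 2 with hD
    have hD0 : 0 ≤ D := by positivity
    refine ⟨(1 / η) ^ N * Real.exp (N * X ^ 2 / (2 * a ^ 2)) * K * Real.exp (D * X) *
      Real.exp (D ^ 2 / c), c, hc0, fun t s h1 h2 => ?_⟩
    set z : ℂ := t + s * I with hz
    have hs0 : 0 < s := hη.trans_le h1
    have hX0 : 0 ≤ X := hs0.le.trans h2
    have him : z.im = s := by simp [hz]
    have hnz : ‖z‖ ≤ X + |t| := by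
      refine (norm_add_le _ _).trans ?_
      simp only [norm_real, norm_mul, norm_I, mul_one, Real.norm_eq_abs, abs_of_pos hs0]
      linarith
    have hw : ‖1 / weight a u y z‖ ≤ (1 / η) ^ N * (Real.exp (N * X ^ 2 / (2 * a ^ 2)) *
        Real.exp (N * |u| / a ^ 2 * |t|) * Real.exp (-(2 * c) * 1 * t ^ 2)) := by
      rw [norm_div, norm_one, hz, norm_weight, one_div, mul_inv, ← Finset.prod_inv_distrib,
        ← Real.exp_neg]
      gcongr
      · refine (Finset.prod_le_prod (s := Finset.univ) (g := fun _ => 1 / η) (fun _ _ => by positivity)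
          fun j _ => ?_).trans (by simp)
        have := norm_one_div_sub_ofReal_le (z := z) hη (by rw [him]; exact h1.trans (le_abs_self _))
          (y j)
        simpa using this
      · rw [← Real.exp_add, ← Real.exp_add]
        apply Real.exp_le_exp.mpr
        have e2 : -(2 * c) * 1 * t ^ 2 = N * (-t ^ 2) / (2 * a ^ 2) := by
          rw [hc]; field_simp; norm_num
        have e3 : N * |u| / a ^ 2 * |t| = N * (2 * (|u| * |t|)) / (2 * a ^ 2) := by
          field_simp
        rw [e2, e3, ← add_div, ← add_div, ← neg_div, ← mul_add, ← mul_add, ← mul_neg]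
        gcongr
        have e4 : s ^ 2 ≤ X ^ 2 := by gcongr
        have e5 : u * t ≤ |u| * |t| := by rw [← abs_mul]; exact le_abs_self _
        linarith
    have he : ‖expQuot (α * z)‖ ≤ Real.exp (|α| * ‖z‖) := by
      refine (norm_expQuot_le _).trans (Real.exp_le_exp.mpr ?_)
      rw [norm_mul, norm_real, Real.norm_eq_abs]
    have hB := hK z (by rw [him]; exact h1)
    have h5 := exp_linear_mul_gaussian_le hD0 hc0 le_rfl t
    have h6 : Real.exp (|α| * ‖z‖) * Real.exp (K * ‖z‖) * Real.exp (N * |u| / a ^ 2 * |t|) ≤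
        Real.exp (D * X) * Real.exp (D * |t|) := by
      rw [← Real.exp_add, ← Real.exp_add, ← Real.exp_add]
      apply Real.exp_le_exp.mpr
      have e1 : (|α| + K) * ‖z‖ ≤ (|α| + K) * (X + |t|) := by gcongr
      have e2 : 0 ≤ N * |u| / a ^ 2 * X := by positivity
      rw [hD]; nlinarith
    calc ‖_ * (_ * _)‖ ≤ ((1 / η) ^ N * (Real.exp (N * X ^ 2 / (2 * a ^ 2)) *
          Real.exp (N * |u| / a ^ 2 * |t|) * Real.exp (-(2 * c) * 1 * t ^ 2))) *
          (Real.exp (|α| * ‖z‖) * (K * Real.exp (K * ‖z‖))) := by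
          rw [norm_mul, norm_mul]; gcongr
      _ = (1 / η) ^ N * Real.exp (N * X ^ 2 / (2 * a ^ 2)) * K *
          (Real.exp (|α| * ‖z‖) * Real.exp (K * ‖z‖) * Real.exp (N * |u| / a ^ 2 * |t|)) *
          Real.exp (-(2 * c) * 1 * t ^ 2) := by ring
      _ ≤ (1 / η) ^ N * Real.exp (N * X ^ 2 / (2 * a ^ 2)) * K *
          (Real.exp (D * X) * Real.exp (D * |t|)) * Real.exp (-(2 * c) * 1 * t ^ 2) := by gcongr
      _ = (1 / η) ^ N * Real.exp (N * X ^ 2 / (2 * a ^ 2)) * K * Real.exp (D * X) *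
          (Real.exp (D * |t|) * Real.exp (-(2 * c) * 1 * t ^ 2)) := by ring
      _ ≤ (1 / η) ^ N * Real.exp (N * X ^ 2 / (2 * a ^ 2)) * K * Real.exp (D * X) *
          (Real.exp (D ^ 2 / c) * Real.exp (-c * 1 * t ^ 2)) :=
          mul_le_mul_of_nonneg_left h5 (by positivity)
      _ = _ := by rw [mul_one]; ring

/-- The `w`-dependent factors of the terms of the integrand: two terms with the full weight, and
for each `k` one with the factor `w - y k` removed from the weight. Written in this way they are
entire. -/
def verticalFactor (a u α : ℝ) {N : ℕ} (y : Fin N → ℝ) : Fin 2 ⊕ Fin N → ℂ → ℂ :=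
  Sum.elim
    (fun m w => (∏ j, (w - y j)) *
      exp (N * (w ^ 2 - 2 * u * w) / (2 * (a : ℂ) ^ 2)) * (exp (-α * w) * w ^ (m : ℕ)))
    (fun k w => (∏ j ∈ Finset.univ.erase k, (w - y j)) *
      exp (N * (w ^ 2 - 2 * u * w) / (2 * (a : ℂ) ^ 2)) * (exp (-α * w) * w ^ 1))

/-- The amplitudes of the `z`-dependent factors of the terms of the integrand, that is, what
remains besides the reciprocal weight and `expQuot (α * z)`. -/
def horizontalAmplitude (a v : ℝ) {N : ℕ} (y : Fin N → ℝ) : Fin 2 ⊕ Fin N → ℂ → ℂ :=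
  Sum.elim ![fun z => z - v + a ^ 2 * stieltjes y z, fun _ => 1] (fun k z => 1 / (z - y k))

/-- The coefficients of the terms of the integrand. The last `N` of them are of order `1 / N`, so
that `∑ |termCoeff|` stays bounded. -/
def termCoeff (a : ℝ) (N : ℕ) : Fin 2 ⊕ Fin N → ℝ :=
  Sum.elim (fun _ => 1) (fun _ => -(a ^ 2 / N))

theorem verticalFactor_inr {a u α : ℝ} {N : ℕ} {y : Fin N → ℝ} (k : Fin N) {w : ℂ}
    (hw : w - y k ≠ 0) : verticalFactor a u α y (Sum.inr k) w =
      weight a u y w * (exp (-α * w) * (w / (w - y k))) := by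
  simp only [verticalFactor, Sum.elim_inr, weight, ← Finset.mul_prod_erase _ _ (Finset.mem_univ k)]
  field_simp

theorem verticalDecay_verticalFactor {a : ℝ} (ha : 0 < a) {N : ℕ} (hN : 1 ≤ N) (y : Fin N → ℝ)
    (u α : ℝ) (i : Fin 2 ⊕ Fin N) : VerticalDecay (verticalFactor a u α y i) := by
  rcases i with m | k
  · exact verticalDecay_of_polynomial ha hN y u α _ _
  · exact verticalDecay_of_polynomial ha hN y u α _ _

theorem differentiableOn_inv_sub (t : ℝ) :
    DifferentiableOn ℂ (fun z : ℂ => 1 / (z - t)) {z | 0 < z.im} :=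
  (differentiableOn_const 1).div (by fun_prop) fun _ hz => sub_ofReal_ne_zero (ne_of_gt hz) _

theorem differentiableOn_stieltjes {N : ℕ} (y : Fin N → ℝ) :
    DifferentiableOn ℂ (stieltjes y) {z | 0 < z.im} := by
  unfold stieltjes
  exact (differentiableOn_const _).mul (DifferentiableOn.fun_sum fun k _ =>
    differentiableOn_inv_sub (y k))

theorem stieltjes_conj {N : ℕ} (y : Fin N → ℝ) (z : ℂ) :
    stieltjes y ((starRingEnd ℂ) z) = (starRingEnd ℂ) (stieltjes y z) := by
  simp [stieltjes]

theorem horizontalDecay_horizontalAmplitude {a : ℝ} (ha : 0 < a) {N : ℕ} (hN : 1 ≤ N)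
    (y : Fin N → ℝ) (u v α : ℝ) (i : Fin 2 ⊕ Fin N) :
    HorizontalDecay fun z => 1 / weight a u y z *
      (expQuot (α * z) * horizontalAmplitude a v y i z) := by
  have key : ∀ (K : ℝ) (z : ℂ), 1 ≤ K → K ≤ K * Real.exp (K * ‖z‖) := fun K z hK =>
    le_mul_of_one_le_right (by linarith) (Real.one_le_exp (by positivity))
  apply horizontalDecay_of_amplitude ha hN
  · rcases i with m | k
    · fin_cases m
      · exact DifferentiableOn.add (by fun_prop)
          ((differentiableOn_const _).mul (differentiableOn_stieltjes y))
      · exact differentiableOn_const 1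
    · exact differentiableOn_inv_sub (y k)
  · intro z
    rcases i with m | k
    · fin_cases m
      · simp [horizontalAmplitude, stieltjes_conj]
      · simp [horizontalAmplitude]
    · simp [horizontalAmplitude]
  · intro η hη
    rcases i with m | k
    · fin_cases m
      · refine ⟨1 + |v| + a ^ 2 * (1 / η), by positivity, fun z hz => ?_⟩
        have h1 := norm_stieltjes_le (y := y) hη (hz.trans (le_abs_self _))
        set K := 1 + |v| + a ^ 2 * (1 / η) with hK
        have h0 : 0 ≤ a ^ 2 * (1 / η) := by positivity
        have hK1 : 1 ≤ K := by rw [hK]; linarith [abs_nonneg v]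
        have h2 : ‖z - v + a ^ 2 * stieltjes y z‖ ≤ ‖z‖ + |v| + a ^ 2 * (1 / η) := by
          refine (norm_add_le _ _).trans (add_le_add ((norm_sub_le _ _).trans (by simp)) ?_)
          rw [norm_mul, norm_pow, norm_real, Real.norm_of_nonneg ha.le]
          gcongr
        have h3 : ‖z‖ + 1 ≤ Real.exp (K * ‖z‖) := by
          refine (Real.add_one_le_exp _).trans (Real.exp_le_exp.mpr ?_)
          exact le_mul_of_one_le_left (norm_nonneg z) hK1
        have h4 : ‖z‖ + |v| + a ^ 2 * (1 / η) ≤ K * (‖z‖ + 1) := by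
          have : 0 ≤ (|v| + a ^ 2 * (1 / η)) * ‖z‖ := by positivity
          rw [hK]; nlinarith
        exact h2.trans (h4.trans (by gcongr))
      · refine ⟨1, zero_le_one, fun z _ => ?_⟩
        simp [horizontalAmplitude]
    · refine ⟨1 + 1 / η, by positivity, fun z hz => ?_⟩
      have h1 := norm_one_div_sub_ofReal_le hη (hz.trans (le_abs_self _)) (y k)
      have h0 : 0 ≤ 1 / η := by positivity
      refine le_trans ?_ (key _ z (by linarith))
      exact h1.trans (by linarith)

theorem kernelFactor_eq {S u v α : ℝ} (hS : 0 < S) (hα : α = (v - u) / S) {z : ℂ} (hz : z ≠ 0) :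
    kernelFactor S u v z = -(1 / (S : ℂ) ^ 2) * expQuot (α * z) := by
  have hS' : (S : ℂ) ≠ 0 := by exact_mod_cast hS.ne'
  rw [kernelFactor]
  split_ifs with h
  · have : α = 0 := by rw [hα, h]; simp
    rw [this, ofReal_zero, zero_mul, expQuot_zero, mul_one, neg_div]
  · have hvu : (v : ℂ) - u ≠ 0 := by
      rw [sub_ne_zero]; exact fun h' => h (by exact_mod_cast h'.symm)
    have hα' : (α : ℂ) = (v - u) / S := by rw [hα]; push_cast; rfl
    rw [expQuot_of_ne (mul_ne_zero (by rw [hα']; exact div_ne_zero hvu hS') hz), hα']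
    have : ((v : ℂ) - u) / S * z = (v - u) * z / S := by ring
    rw [this]
    field_simp
    ring

theorem prod_mul_exp_eq {a u v α : ℝ} (ha : 0 < a) {N : ℕ} (hN : 1 ≤ N) (y : Fin N → ℝ)
    (hα : α = (v - u) / (a ^ 2 / N)) (z w : ℂ) :
    (∏ j, (w - y j) / (z - y j)) *
        exp ((w ^ 2 - 2 * v * w - z ^ 2 + 2 * u * z) / (2 * ((a ^ 2 / N : ℝ) : ℂ))) =
      1 / weight a u y z * (weight a u y w * exp (-α * w)) := by
  have hN0 : (N : ℂ) ≠ 0 := by exact_mod_cast (by omega : N ≠ 0)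
  have ha0 : (a : ℂ) ≠ 0 := by exact_mod_cast ha.ne'
  have h1 : (w ^ 2 - 2 * v * w - z ^ 2 + 2 * u * z) / (2 * ((a ^ 2 / N : ℝ) : ℂ)) =
      N * (w ^ 2 - 2 * u * w) / (2 * (a : ℂ) ^ 2) - N * (z ^ 2 - 2 * u * z) / (2 * (a : ℂ) ^ 2) +
        -α * w := by
    rw [hα]; push_cast
    field_simp
    ring
  rw [Finset.prod_div_distrib, h1, exp_add, exp_sub, weight, weight]
  simp only [div_eq_mul_inv, mul_inv]
  ring

/-- A partial fraction decomposition makes the polynomial factor of the integrand a sum of products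
and leaves in `w` the bounded amplitude `w / (w - y j)`. -/
theorem middle_factor_eq {a v : ℝ} {N : ℕ} (y : Fin N → ℝ) {z w : ℂ}
    (hz : z.im ≠ 0) (hw : w.im ≠ 0) :
    w + z - v - ((a ^ 2 / N : ℝ) : ℂ) * ∑ j, (y j : ℂ) / ((w - y j) * (z - y j)) =
      (z - v + a ^ 2 * stieltjes y z) + w +
        ∑ j, (-(a ^ 2 / N : ℝ) : ℂ) * (1 / (z - y j) * (w / (w - y j))) := by
  have h1 : ∀ j, (y j : ℂ) / ((w - y j) * (z - y j)) =
      1 / (z - y j) * (w / (w - y j)) - 1 / (z - y j) := by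
    intro j
    have := sub_ofReal_ne_zero hz (y j)
    have := sub_ofReal_ne_zero hw (y j)
    field_simp
    ring
  rw [Finset.sum_congr rfl fun j _ => h1 j, Finset.sum_sub_distrib, stieltjes, ← Finset.mul_sum]
  push_cast
  ring

/-- The integrand of the kernel as a finite sum of products. -/
theorem integrand_eq {a u v α : ℝ} (ha : 0 < a) {N : ℕ} (hN : 1 ≤ N) (y : Fin N → ℝ)
    (hα : α = (v - u) / (a ^ 2 / N)) {z w : ℂ} (hz : z.im ≠ 0) (hw : w.im ≠ 0) :
    kernelFactor (a ^ 2 / N) u v z *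
        (w + z - v - ((a ^ 2 / N : ℝ) : ℂ) * ∑ j, (y j : ℂ) / ((w - y j) * (z - y j))) *
        (∏ j, (w - y j) / (z - y j)) *
        exp ((w ^ 2 - 2 * v * w - z ^ 2 + 2 * u * z) / (2 * ((a ^ 2 / N : ℝ) : ℂ))) =
      ∑ i, (-(1 / ((a ^ 2 / N : ℝ) : ℂ) ^ 2) * termCoeff a N i) *
        ((1 / weight a u y z * (expQuot (α * z) * horizontalAmplitude a v y i z)) *
          verticalFactor a u α y i w) := by
  have hN0 : (0 : ℝ) < N := by exact_mod_cast hN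
  have hz0 : z ≠ 0 := by rintro rfl; simp at hz
  rw [mul_assoc, prod_mul_exp_eq ha hN y hα, middle_factor_eq y hz hw,
    kernelFactor_eq (by positivity) hα hz0, Fintype.sum_sum_type, Fin.sum_univ_two]
  simp only [verticalFactor_inr _ (sub_ofReal_ne_zero hw _)]
  simp only [termCoeff, horizontalAmplitude, verticalFactor, Sum.elim_inl, Sum.elim_inr,
    Matrix.cons_val_zero, Matrix.cons_val_one, Fin.val_zero, Fin.val_one, pow_zero, pow_one]
  have hw1 : (∏ j, (w - (y j : ℂ))) * exp (N * (w ^ 2 - 2 * u * w) / (2 * (a : ℂ) ^ 2)) =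
    weight a u y w := rfl
  rw [hw1, mul_add, mul_add, add_mul, add_mul, Finset.mul_sum, Finset.sum_mul]
  congr 1
  · push_cast; ring
  · refine Finset.sum_congr rfl fun j _ => ?_
    push_cast; ring

/-- The double contour integral as a combination of products of single integrals, the `z`-contour
shifted to the horizontal lines through `p` and its conjugate and the `w`-contour to the vertical
line through `p`. The lower half of each contour enters as the conjugate of the upper half. -/
def separatedIntegral (a u v α : ℝ) {N : ℕ} (y : Fin N → ℝ) (p : ℂ) : ℂ :=
  ∑ i, (termCoeff a N i : ℂ) *
    (((starRingEnd ℂ) (∫ r : ℝ, 1 / weight a u y (p + r) *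
        (expQuot (α * (p + r)) * horizontalAmplitude a v y i (p + r))) -
      ∫ r : ℝ, 1 / weight a u y (p + r) *
        (expQuot (α * (p + r)) * horizontalAmplitude a v y i (p + r))) *
      (I * ((∫ s in Set.Ioi (0 : ℝ), verticalFactor a u α y i (p.re + s * I)) +
        (starRingEnd ℂ) (∫ s in Set.Ioi (0 : ℝ), verticalFactor a u α y i (p.re + s * I)))))

theorem kernel_eq_separatedIntegral {a κ u v α : ℝ} (ha : 0 < a) (hκ : 0 < κ) {N : ℕ} (hN : 1 ≤ N)
    (y : Fin N → ℝ) (hα : α = (v - u) / (a ^ 2 / N)) {p : ℂ} (hp : 0 < p.im) :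
    kernel κ (a ^ 2 / N) y u v =
      exp (((v : ℂ) ^ 2 - (u : ℂ) ^ 2) / (2 * ((a ^ 2 / N : ℝ) : ℂ))) / (2 * Real.pi * I) ^ 2 *
        (-(1 / ((a ^ 2 / N : ℝ) : ℂ) ^ 2) * separatedIntegral a u v α y p) := by
  have h := integralGamma_integralVertical_eq
    (fun i => -(1 / ((a ^ 2 / N : ℝ) : ℂ) ^ 2) * termCoeff a N i)
    (fun i => horizontalDecay_horizontalAmplitude ha hN y u v α i)
    (fun i => verticalDecay_verticalFactor ha hN y u α i) hκ
    (fun z w hz hw => integrand_eq ha hN y hα hz hw) hp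
  rw [kernel, h]
  congr 1
  rw [separatedIntegral, Finset.mul_sum]
  exact Finset.sum_congr rfl fun i _ => by ring

/-! ### Saddle point asymptotics of the kernel -/

theorem norm_mul_sub_mul_le {X Y a b : ℂ} {C D n : ℝ} (hC : 0 ≤ C) (hD : 0 ≤ D) (hn : 1 ≤ n)
    (hX : ‖X - a‖ ≤ C / n) (hY : ‖Y - b‖ ≤ C / n) (ha : ‖a‖ ≤ D / √n) (hb : ‖b‖ ≤ D / √n) :
    ‖X * Y - a * b‖ ≤ (C * C + 2 * C * D) / (n * √n) := by
  have hs : 1 ≤ √n := Real.one_le_sqrt.mpr hn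
  have hsn : √n ≤ n := by
    have := Real.sq_sqrt (by linarith : 0 ≤ n); nlinarith
  have h1 : X * Y - a * b = (X - a) * (Y - b) + (X - a) * b + a * (Y - b) := by ring
  rw [h1]
  calc _ ≤ ‖X - a‖ * ‖Y - b‖ + ‖X - a‖ * ‖b‖ + ‖a‖ * ‖Y - b‖ := by
        refine norm_add₃_le.trans (le_of_eq ?_)
        simp only [norm_mul]
    _ ≤ C / n * (C / n) + C / n * (D / √n) + D / √n * (C / n) := by gcongr
    _ ≤ C / n * (C / √n) + C / n * (D / √n) + D / √n * (C / n) := by gcongr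
    _ = _ := by field_simp; ring

theorem norm_sum_mul_le {ι : Type*} [Fintype ι] (k : ι → ℝ) {K D : ℝ} (hK : ∑ i, |k i| ≤ K)
    (hD : 0 ≤ D) {f : ι → ℂ} (hf : ∀ i, ‖f i‖ ≤ D) : ‖∑ i, (k i : ℂ) * f i‖ ≤ K * D := by
  calc _ ≤ ∑ i, ‖(k i : ℂ) * f i‖ := norm_sum_le _ _
    _ ≤ ∑ i, |k i| * D := by
        refine Finset.sum_le_sum fun i _ => ?_
        rw [norm_mul, norm_real, Real.norm_eq_abs]
        gcongr; exact hf i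
    _ ≤ _ := by rw [← Finset.sum_mul]; gcongr

/-- The algebra of combining the four pairs of saddle points: conjugate points contribute complex
conjugate terms, and the mixed pairs are controlled by the amplitude at a mixed pair. -/
theorem norm_sum_products_sub_le {ι : Type*} [Fintype ι] (k : ι → ℝ) {K C L G n : ℝ}
    (hC : 0 ≤ C) (hL : 0 ≤ L) (hG : 0 ≤ G) (hn : 1 ≤ n) (hK : ∑ i, |k i| ≤ K) {M g : ℂ}
    (hM : M ≠ 0) (hg : ‖g‖ ≤ G / √n) {U T A B : ι → ℂ}
    (hU : ∀ i, ‖M⁻¹ * U i - A i * g‖ ≤ C / n) (hT : ∀ i, ‖M * T i - B i * g‖ ≤ C / n)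
    (hA : ∀ i, ‖A i‖ ≤ L) (hB : ∀ i, ‖B i‖ ≤ L) :
    ‖(∑ i, (k i : ℂ) * (((starRingEnd ℂ) (T i) - T i) * (I * (U i + (starRingEnd ℂ) (U i))))) -
      ((2 * (g ^ 2 * ∑ i, (k i : ℂ) * (A i * B i)).im : ℝ) : ℂ)‖ ≤
      4 * K * (C * C + 2 * C * (L * G)) / (n * √n) +
        2 * ‖g‖ ^ 2 * ‖∑ i, (k i : ℂ) * (A i * (starRingEnd ℂ) (B i))‖ := by
  set D := (C * C + 2 * C * (L * G)) / (n * √n) with hD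
  have hD0 : 0 ≤ D := by positivity
  have hprod : ∀ i, (M⁻¹ * U i) * (M * T i) = U i * T i := by
    intro i; field_simp
  have hnA : ∀ i, ‖A i * g‖ ≤ L * G / √n := by
    intro i; rw [norm_mul, mul_div_assoc]; have := hA i; gcongr
  have hnB : ∀ i, ‖B i * g‖ ≤ L * G / √n := by
    intro i; rw [norm_mul, mul_div_assoc]; have := hB i; gcongr
  have h1 : ‖(∑ i, (k i : ℂ) * (U i * T i)) - g ^ 2 * ∑ i, (k i : ℂ) * (A i * B i)‖ ≤ K * D := by
    have : (∑ i, (k i : ℂ) * (U i * T i)) - g ^ 2 * ∑ i, (k i : ℂ) * (A i * B i) =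
        ∑ i, (k i : ℂ) * ((M⁻¹ * U i) * (M * T i) - (A i * g) * (B i * g)) := by
      rw [Finset.mul_sum, ← Finset.sum_sub_distrib]
      exact Finset.sum_congr rfl fun i _ => by rw [hprod]; ring
    rw [this]
    exact norm_sum_mul_le k hK hD0 fun i =>
      norm_mul_sub_mul_le hC (by positivity) hn (hU i) (hT i) (hnA i) (hnB i)
  have h2 : ‖∑ i, (k i : ℂ) * (U i * (starRingEnd ℂ) (T i))‖ ≤ K * D +
      ‖g‖ ^ 2 * ‖∑ i, (k i : ℂ) * (A i * (starRingEnd ℂ) (B i))‖ := by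
    have hM' : (starRingEnd ℂ) M ≠ 0 := by simpa using hM
    have e1 : ∑ i, (k i : ℂ) * (U i * (starRingEnd ℂ) (T i)) = M / (starRingEnd ℂ) M *
        ((∑ i, (k i : ℂ) * ((M⁻¹ * U i) * (starRingEnd ℂ) (M * T i) -
          (A i * g) * (starRingEnd ℂ) (B i * g))) +
          g * (starRingEnd ℂ) g * ∑ i, (k i : ℂ) * (A i * (starRingEnd ℂ) (B i))) := by
      rw [Finset.mul_sum (a := g * (starRingEnd ℂ) g), ← Finset.sum_add_distrib, Finset.mul_sum]
      refine Finset.sum_congr rfl fun i _ => ?_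
      simp only [map_mul]
      field_simp
      ring
    have e2 : ‖M / (starRingEnd ℂ) M‖ = 1 := by
      rw [norm_div, RCLike.norm_conj, div_self (norm_ne_zero_iff.mpr hM)]
    rw [e1, norm_mul, e2, one_mul]
    refine (norm_add_le _ _).trans (add_le_add ?_ ?_)
    · refine norm_sum_mul_le k hK hD0 fun i =>
        norm_mul_sub_mul_le hC (by positivity) hn (hU i) ?_ (hnA i) ?_
      · rw [← map_sub, RCLike.norm_conj]; exact hT i
      · rw [RCLike.norm_conj]; exact hnB i
    · rw [norm_mul, norm_mul, RCLike.norm_conj, ← pow_two]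
  have h3 : (∑ i, (k i : ℂ) * (((starRingEnd ℂ) (T i) - T i) * (I * (U i + (starRingEnd ℂ) (U i))))) =
      ((2 * (∑ i, (k i : ℂ) * (U i * T i)).im : ℝ) : ℂ) -
        ((2 * (∑ i, (k i : ℂ) * (U i * (starRingEnd ℂ) (T i))).im : ℝ) : ℂ) := by
    have e1 : ∀ X : ℂ, ((2 * X.im : ℝ) : ℂ) = -I * (X - (starRingEnd ℂ) X) := by
      intro X
      rw [sub_conj]
      linear_combination ((2 * X.im : ℝ) : ℂ) * I_mul_I
    rw [e1, e1, map_sum, map_sum, ← Finset.sum_sub_distrib, ← Finset.sum_sub_distrib,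
      Finset.mul_sum, Finset.mul_sum, ← Finset.sum_sub_distrib]
    refine Finset.sum_congr rfl fun i _ => ?_
    simp only [map_mul, conj_ofReal, conj_conj]
    ring
  have h4 : ∀ X Y Z : ℂ, ‖((2 * X.im : ℝ) : ℂ) - ((2 * Y.im : ℝ) : ℂ) - ((2 * Z.im : ℝ) : ℂ)‖ ≤
      2 * ‖X - Z‖ + 2 * ‖Y‖ := by
    intro X Y Z
    rw [← ofReal_sub, ← ofReal_sub, norm_real, Real.norm_eq_abs]
    have e1 := abs_im_le_norm (X - Z)
    have e2 := abs_im_le_norm Y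
    rw [sub_im] at e1
    rw [abs_le] at e1 e2 ⊢
    constructor <;> linarith [e1.1, e1.2, e2.1, e2.2]
  rw [h3]
  refine (h4 _ _ _).trans ?_
  have h5 : 4 * K * (C * C + 2 * C * (L * G)) / (n * √n) = 4 * (K * D) := by rw [hD]; ring
  rw [h5]
  linarith

theorem sum_abs_termCoeff (a : ℝ) {N : ℕ} (hN : 1 ≤ N) :
    ∑ i, |termCoeff a N i| = 2 + a ^ 2 := by
  have hN0 : (N : ℝ) ≠ 0 := by exact_mod_cast (by omega : N ≠ 0)
  rw [Fintype.sum_sum_type]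
  simp only [termCoeff, Sum.elim_inl, Sum.elim_inr, abs_one, abs_neg, Finset.sum_const,
    Finset.card_univ, Fintype.card_fin, nsmul_eq_mul]
  rw [abs_of_nonneg (by positivity)]
  field_simp
  norm_num

section

variable {a u v α : ℝ} {N : ℕ} {y : Fin N → ℝ} {p : ℂ}

/-- The amplitude of `verticalFactor` relative to the weight, at `p`. -/
def verticalAmplitude (α : ℝ) {N : ℕ} (y : Fin N → ℝ) (p : ℂ) : Fin 2 ⊕ Fin N → ℂ :=
  Sum.elim ![exp (-α * p), exp (-α * p) * p] (fun k => exp (-α * p) * (p / (p - y k)))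

theorem stieltjes_of_saddle (ha : 0 < a) (h : phaseDeriv a u y p = 0) :
    p + (a : ℂ) ^ 2 * stieltjes y p = u := by
  have ha0 : (a : ℂ) ≠ 0 := by exact_mod_cast ha.ne'
  rw [phaseDeriv] at h
  field_simp at h
  linear_combination h

/-- At the pair `(p, p)` the amplitudes add up to a multiple of the curvature, up to the term
`u - v` of order `1 / N`. The curvature cancels against the Gaussian normalization. -/
theorem sum_amplitudes (ha : 0 < a) (h : phaseDeriv a u y p = 0) :
    ∑ i, (termCoeff a N i : ℂ) * (verticalAmplitude α y p i *
      (expQuot (α * p) * horizontalAmplitude a v y i p)) =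
      exp (-α * p) * expQuot (α * p) * (u - v + a ^ 2 * curvature a y p * p) := by
  have ha0 : (a : ℂ) ≠ 0 := by exact_mod_cast ha.ne'
  have hst := stieltjes_of_saddle ha h
  have hsum : ∑ k, (termCoeff a N (Sum.inr k) : ℂ) * (verticalAmplitude α y p (Sum.inr k) *
      (expQuot (α * p) * horizontalAmplitude a v y (Sum.inr k) p)) =
      -(exp (-α * p) * expQuot (α * p) * p * a ^ 2) *
        (1 / (N : ℂ) * ∑ k, 1 / (p - y k) ^ 2) := by
    rw [Finset.mul_sum, Finset.mul_sum]
    refine Finset.sum_congr rfl fun k _ => ?_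
    simp only [termCoeff, verticalAmplitude, horizontalAmplitude, Sum.elim_inr]
    have hk : 1 / (p - (y k : ℂ)) ^ 2 = (1 / (p - y k)) ^ 2 := by rw [div_pow, one_pow]
    rw [div_eq_mul_one_div p, hk]
    push_cast
    ring
  have hcurv : (a : ℂ) ^ 2 * curvature a y p =
      1 - a ^ 2 * (1 / (N : ℂ) * ∑ k, 1 / (p - y k) ^ 2) := by
    rw [curvature]; field_simp
  rw [Fintype.sum_sum_type, hsum, Fin.sum_univ_two, hcurv, ← hst]
  simp only [termCoeff, verticalAmplitude, horizontalAmplitude, Sum.elim_inl,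
    Matrix.cons_val_zero, Matrix.cons_val_one, ofReal_one]
  ring

/-- At the pair of saddle points `p` and `conj p` the amplitudes cancel up to the term `u - v` of
order `1 / N`, by `average_eq_of_phaseDeriv_eq_zero`. -/
theorem sum_mixed_amplitudes (ha : 0 < a) (hp : 0 < p.im) (h : phaseDeriv a u y p = 0) :
    ∑ i, (termCoeff a N i : ℂ) * (verticalAmplitude α y p i *
      (starRingEnd ℂ) (expQuot (α * p) * horizontalAmplitude a v y i p)) =
      exp (-α * p) * (starRingEnd ℂ) (expQuot (α * p)) * (u - v) := by
  have ha0 : (a : ℂ) ≠ 0 := by exact_mod_cast ha.ne'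
  have hst := congrArg (starRingEnd ℂ) (stieltjes_of_saddle ha h)
  simp only [map_add, map_mul, map_pow, conj_ofReal] at hst
  have hav : (1 / (N : ℂ) * ∑ k, 1 / ((p - y k) * ((starRingEnd ℂ) p - y k))) = 1 / (a : ℂ) ^ 2 := by
    have h1 := congrArg (fun t : ℝ => (t : ℂ)) (average_eq_of_phaseDeriv_eq_zero hp h)
    simp only [ofReal_mul, ofReal_div, ofReal_one, ofReal_sum, ofReal_natCast, ofReal_pow] at h1
    rw [← h1]
    congr 1
    refine Finset.sum_congr rfl fun k _ => ?_
    rw [normSq_eq_conj_mul_self, map_sub, conj_ofReal, mul_comm]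
  have hsum : ∑ k, (termCoeff a N (Sum.inr k) : ℂ) * (verticalAmplitude α y p (Sum.inr k) *
      (starRingEnd ℂ) (expQuot (α * p) * horizontalAmplitude a v y (Sum.inr k) p)) =
      -(exp (-α * p) * (starRingEnd ℂ) (expQuot (α * p)) * p * a ^ 2) *
        (1 / (N : ℂ) * ∑ k, 1 / ((p - y k) * ((starRingEnd ℂ) p - y k))) := by
    rw [Finset.mul_sum, Finset.mul_sum]
    refine Finset.sum_congr rfl fun k _ => ?_
    simp only [termCoeff, verticalAmplitude, horizontalAmplitude, Sum.elim_inr, map_mul, map_div₀,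
      map_one, map_sub, conj_ofReal]
    push_cast
    rw [div_eq_mul_inv p, one_div ((p - (y k : ℂ)) * _), mul_inv]
    ring
  rw [Fintype.sum_sum_type, hsum, Fin.sum_univ_two, hav, ← hst]
  simp only [termCoeff, verticalAmplitude, horizontalAmplitude, Sum.elim_inl,
    Matrix.cons_val_zero, Matrix.cons_val_one, ofReal_one, map_mul, map_add, map_sub, map_pow,
    conj_ofReal, map_one]
  field_simp
  ring

theorem norm_amplitude_le {Y₀ A B : ℝ} (ha : 0 < a) (hY₀ : 0 < Y₀) (hA : 0 ≤ A) (hB : 0 ≤ B)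
    (hp : Y₀ ≤ p.im) (hpB : ‖p‖ ≤ B) (hα : |α| ≤ A) (hv : |v| ≤ B) (i : Fin 2 ⊕ Fin N) :
    ‖verticalAmplitude α y p i‖ ≤
      Real.exp (A * B) * (1 + B + B / Y₀ + (2 * B + a ^ 2 / Y₀) + 1 / Y₀) ∧
    ‖expQuot (α * p) * horizontalAmplitude a v y i p‖ ≤
      Real.exp (A * B) * (1 + B + B / Y₀ + (2 * B + a ^ 2 / Y₀) + 1 / Y₀) := by
  have q1 : 0 ≤ B / Y₀ := by positivity
  have q2 : 0 ≤ a ^ 2 / Y₀ := by positivity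
  have q3 : 0 ≤ 1 / Y₀ := by positivity
  set R := 1 + B + B / Y₀ + (2 * B + a ^ 2 / Y₀) + 1 / Y₀ with hR
  have hα' : ‖(α : ℂ)‖ ≤ A := by simpa using hα
  have hαp : ‖(α : ℂ) * p‖ ≤ A * B := by rw [norm_mul]; gcongr
  have h1 : ‖exp (-α * p)‖ ≤ Real.exp (A * B) := by
    refine (norm_exp_le_exp_norm _).trans (Real.exp_le_exp.mpr ?_)
    rwa [neg_mul, norm_neg]
  have h2 : ‖expQuot (α * p)‖ ≤ Real.exp (A * B) :=
    (norm_expQuot_le _).trans (Real.exp_le_exp.mpr hαp)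
  have hinv := fun k : Fin N => norm_one_div_sub_ofReal_le hY₀ (hp.trans (le_abs_self _)) (y k)
  have hst := norm_stieltjes_le (y := y) hY₀ (hp.trans (le_abs_self _))
  have mul_bd : ∀ x z : ℂ, ‖x‖ ≤ Real.exp (A * B) → ‖z‖ ≤ R → ‖x * z‖ ≤ Real.exp (A * B) * R := by
    intro x z hx hz; rw [norm_mul]; gcongr
  rcases i with m | k
  · fin_cases m
    · constructor
      · have := mul_bd _ 1 h1 (by rw [norm_one, hR]; linarith)
        simpa [verticalAmplitude] using this
      · refine mul_bd _ _ h2 ?_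
        have h3 : ‖p - v + (a : ℂ) ^ 2 * stieltjes y p‖ ≤ B + B + a ^ 2 * (1 / Y₀) := by
          refine (norm_add_le _ _).trans (add_le_add ((norm_sub_le _ _).trans ?_) ?_)
          · rw [norm_real]; exact add_le_add hpB hv
          · rw [norm_mul, norm_pow, norm_real, Real.norm_of_nonneg ha.le]
            gcongr
        rw [mul_one_div] at h3
        refine h3.trans ?_
        rw [hR]; linarith
    · constructor
      · exact mul_bd _ _ h1 (hpB.trans (by rw [hR]; linarith))
      · exact mul_bd _ _ h2 (by
          simp only [horizontalAmplitude, Sum.elim_inl]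
          simp only [Fin.mk_one, Matrix.cons_val_one, Matrix.cons_val_fin_one, norm_one]
          rw [hR]; linarith)
  · constructor
    · refine mul_bd _ _ h1 ?_
      have h3 : ‖p / (p - y k)‖ ≤ B * (1 / Y₀) := by
        rw [div_eq_mul_one_div, norm_mul]
        have := hinv k
        gcongr
      rw [mul_one_div] at h3
      refine h3.trans ?_
      rw [hR]; linarith
    · exact mul_bd _ _ h2 ((hinv k).trans (by rw [hR]; linarith))

end

/-- The saddle point asymptotics of the double contour integral, uniformly over all
configurations with a saddle point `p` in a fixed compact set for which the phase grows along the
horizontal line through `p`. -/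
theorem separatedIntegral_asymptotics {a Y₀ c A B : ℝ} (ha : 0 < a) (hY₀ : 0 < Y₀) (hc : 0 < c)
    (hcY : c ≤ Y₀ ^ 2 / (16 * a ^ 4)) (hA : 0 ≤ A) (hB : 0 ≤ B) :
    ∃ C : ℝ, 0 ≤ C ∧ ∀ (N : ℕ), 1 ≤ N → ∀ (y : Fin N → ℝ) (u v α : ℝ) (p : ℂ), Y₀ ≤ p.im →
      phaseDeriv a u y p = 0 →
      (∀ r : ℝ, 4 * c * r ^ 2 ≤ r * (phaseDeriv a u y (p + r)).re) →
      ‖p‖ ≤ B → |α| ≤ A → |v| ≤ B → α = (v - u) / (a ^ 2 / N) →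
      ‖separatedIntegral a u v α y p -
        ((4 * Real.pi * a ^ 2 / N * (p * exp (-α * p) * expQuot (α * p)).im : ℝ) : ℂ)‖ ≤
        C / (N * √N) := by
  obtain ⟨C₁, hC₁, H₁⟩ := vertical_asymptotics ha hY₀ hc hcY hA hB
  obtain ⟨C₂, hC₂, H₂⟩ := horizontal_asymptotics ha hY₀ hc hcY hA hB
  set C := C₁ + C₂ with hC
  have hC0 : 0 ≤ C := by positivity
  set L := Real.exp (A * B) * (1 + B + B / Y₀ + (2 * B + a ^ 2 / Y₀) + 1 / Y₀) with hL
  have hL0 : 0 ≤ L := by positivity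
  set G := √(2 * Real.pi / (4 * c)) with hG
  have hG0 : 0 ≤ G := Real.sqrt_nonneg _
  set E := Real.exp (A * B) * Real.exp (A * B) with hE
  have hE0 : 0 ≤ E := by positivity
  refine ⟨4 * (2 + a ^ 2) * (C * C + 2 * C * (L * G)) + 4 * G ^ 2 * (E * (A * a ^ 2)),
    by positivity, ?_⟩
  intro N hN y u v α p hp hsad hgrow hpB hα hv hαdef
  have hN1 : (1 : ℝ) ≤ N := by exact_mod_cast hN
  have hN0 : (0 : ℝ) < N := by linarith
  have hp0 : 0 < p.im := hY₀.trans_le hp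
  have hs : 1 ≤ √(N : ℝ) := Real.one_le_sqrt.mpr hN1
  have hsN : √(N : ℝ) ≤ N := by
    have := Real.sq_sqrt hN0.le; nlinarith
  obtain ⟨V0, V1, V2⟩ := H₁ N hN y u p hp hsad hpB α hα
  obtain ⟨Z0, Z1, Z2⟩ := H₂ N hN y u p hp hsad hgrow hpB α v hα hv
  have hM : weight a u y p ≠ 0 := weight_ne_zero hp0.ne'
  set lam := curvature a y p with hlam
  have hlamre : 4 * c ≤ lam.re := by
    refine le_trans ?_ (le_curvature_re hN hp0 hsad)
    have h1 : 4 * c ≤ 4 * (Y₀ ^ 2 / (16 * a ^ 4)) := by gcongr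
    have h2 : 4 * (Y₀ ^ 2 / (16 * a ^ 4)) ≤ 4 * (p.im ^ 2 / (16 * a ^ 4)) := by gcongr
    have h3 : 4 * (p.im ^ 2 / (16 * a ^ 4)) ≤ 2 * p.im ^ 2 / a ^ 4 := by
      rw [mul_div_assoc', div_le_div_iff₀ (by positivity) (by positivity)]
      nlinarith [mul_pos (pow_pos hp0 2) (pow_pos ha 4)]
    linarith
  have hlamnorm : 4 * c ≤ ‖lam‖ := hlamre.trans (re_le_norm _)
  have hlam0 : lam ≠ 0 := by
    rw [← norm_pos_iff]; linarith
  set g := gaussConst N lam with hg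
  have hg2 : g ^ 2 = 2 * Real.pi / (N * lam) := by
    rw [hg, gaussConst_sq]; push_cast; rfl
  have hgnorm : ‖g‖ ^ 2 ≤ G ^ 2 / N := by
    rw [← norm_pow, hg2, hG, Real.sq_sqrt (by positivity), norm_div, norm_mul, norm_mul, norm_natCast,
      norm_real, Real.norm_of_nonneg Real.pi_pos.le, div_div]
    simp only [norm_ofNat]
    rw [mul_comm (4 * c)]
    gcongr
  have hgle : ‖g‖ ≤ G / √N := by
    refine (sq_le_sq₀ (norm_nonneg _) (by positivity)).mp ?_
    rwa [div_pow, Real.sq_sqrt hN0.le]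
  have hbd := fun i => norm_amplitude_le (a := a) (v := v) (y := y) ha hY₀ hA hB hp hpB hα hv i
  have hCN1 : C₁ / N ≤ C / N := by gcongr; linarith
  have hCN2 : C₂ / N ≤ C / N := by gcongr; linarith
  have hU : ∀ i, ‖(weight a u y p)⁻¹ * (∫ s in Set.Ioi (0 : ℝ),
      verticalFactor a u α y i (p.re + s * I)) - verticalAmplitude α y p i * g‖ ≤ C / N := by
    intro i
    refine le_trans ?_ hCN1
    rw [← integral_const_mul]
    rcases i with m | k
    · fin_cases m
      · have e1 : ∀ w, (weight a u y p)⁻¹ * verticalFactor a u α y (Sum.inl 0) w =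
            weight a u y w / weight a u y p * exp (-α * w) := by
          intro w
          simp only [verticalFactor, Sum.elim_inl, Fin.val_zero, pow_zero, mul_one]
          rw [← weight]; ring
        simp only [Fin.zero_eta, e1]
        exact V0
      · have e1 : ∀ w, (weight a u y p)⁻¹ * verticalFactor a u α y (Sum.inl 1) w =
            weight a u y w / weight a u y p * (exp (-α * w) * w) := by
          intro w
          simp only [verticalFactor, Sum.elim_inl, Fin.val_one, pow_one]
          rw [← weight]; ring
        simp only [Fin.mk_one, e1]
        exact V1
    · have hcongr : ∫ s in Set.Ioi (0 : ℝ), (weight a u y p)⁻¹ *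
          verticalFactor a u α y (Sum.inr k) (p.re + s * I) =
          ∫ s in Set.Ioi (0 : ℝ), weight a u y (p.re + s * I) / weight a u y p *
          (exp (-α * (p.re + s * I)) * ((p.re + s * I) / (p.re + s * I - y k))) := by
        refine setIntegral_congr_fun measurableSet_Ioi fun s hs => ?_
        rw [verticalFactor_inr k (sub_ofReal_ne_zero (by simpa using (ne_of_gt hs)) _)]
        ring
      rw [hcongr]
      exact V2 k
  have hT : ∀ i, ‖weight a u y p * (∫ r : ℝ, 1 / weight a u y (p + r) *
        (expQuot (α * (p + r)) * horizontalAmplitude a v y i (p + r))) -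
        expQuot (α * p) * horizontalAmplitude a v y i p * g‖ ≤ C / N := by
    intro i
    refine le_trans ?_ hCN2
    rw [← integral_const_mul]
    have e1 : ∀ (r : ℝ) (X : ℂ), weight a u y p * (1 / weight a u y (p + r) * X) =
        weight a u y p / weight a u y (p + r) * X := fun r X => by ring
    simp only [e1]
    rcases i with m | k
    · fin_cases m
      · exact Z0
      · have e2 : ∀ w, horizontalAmplitude a v y (Sum.inl 1) w = 1 := fun _ => rfl
        simp only [Fin.mk_one, e2, mul_one]
        exact Z1
    · exact Z2 k
  have main := norm_sum_products_sub_le (termCoeff a N) hC0 hL0 hG0 hN1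
    (sum_abs_termCoeff a hN).le hM hgle hU hT (fun i => (hbd i).1) (fun i => (hbd i).2)
  rw [sum_amplitudes ha hsad, sum_mixed_amplitudes ha hp0 hsad] at main
  have huv : (u : ℂ) - v = ((-(α * a ^ 2 / N) : ℝ) : ℂ) := by
    rw [hαdef, ← ofReal_sub]; congr 1; field_simp; ring
  have huvn : ‖(u : ℂ) - v‖ ≤ A * a ^ 2 / N := by
    rw [huv, norm_real, norm_neg, Real.norm_eq_abs, abs_div, abs_mul, abs_of_pos hN0,
      abs_of_nonneg (sq_nonneg a)]
    gcongr
  have hαp : ‖(α : ℂ) * p‖ ≤ A * B := by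
    rw [norm_mul, norm_real, Real.norm_eq_abs]; gcongr
  have hexp1 : ‖exp (-α * p)‖ ≤ Real.exp (A * B) := by
    refine (norm_exp_le_exp_norm _).trans (Real.exp_le_exp.mpr ?_)
    rwa [neg_mul, norm_neg]
  have hexp2 : ‖expQuot (α * p)‖ ≤ Real.exp (A * B) :=
    (norm_expQuot_le _).trans (Real.exp_le_exp.mpr hαp)
  have hmix : ‖exp (-α * p) * (starRingEnd ℂ) (expQuot (α * p)) * ((u : ℂ) - v)‖ ≤
      E * (A * a ^ 2 / N) := by
    rw [norm_mul, norm_mul, RCLike.norm_conj, hE]; gcongr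
  have hdir : ‖exp (-α * p) * expQuot (α * p) * ((u : ℂ) - v)‖ ≤ E * (A * a ^ 2 / N) := by
    rw [norm_mul, norm_mul, hE]; gcongr
  have hmainterm : g ^ 2 * (exp (-α * p) * expQuot (α * p) * (u - v + a ^ 2 * lam * p)) =
      ((2 * Real.pi * a ^ 2 / N : ℝ) : ℂ) * (p * exp (-α * p) * expQuot (α * p)) +
        g ^ 2 * (exp (-α * p) * expQuot (α * p) * ((u : ℂ) - v)) := by
    have hN0' : (N : ℂ) ≠ 0 := by exact_mod_cast hN0.ne'
    have : g ^ 2 * lam = 2 * Real.pi / N := by rw [hg2]; field_simp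
    push_cast
    linear_combination (exp (-α * p) * expQuot (α * p) * a ^ 2 * p) * this
  have hfinal : ‖((2 * (g ^ 2 * (exp (-α * p) * expQuot (α * p) *
      (u - v + a ^ 2 * lam * p))).im : ℝ) : ℂ) -
      ((4 * Real.pi * a ^ 2 / N * (p * exp (-α * p) * expQuot (α * p)).im : ℝ) : ℂ)‖ ≤
      2 * (G ^ 2 / N * (E * (A * a ^ 2 / N))) := by
    rw [hmainterm, add_im, im_ofReal_mul, ← ofReal_sub, norm_real, Real.norm_eq_abs]
    have e1 : ∀ X Y : ℝ, 2 * (2 * Real.pi * a ^ 2 / N * X + Y) - 4 * Real.pi * a ^ 2 / N * X =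
        2 * Y := by intro X Y; ring
    rw [e1, abs_mul, abs_two]
    gcongr
    refine (abs_im_le_norm _).trans ?_
    rw [norm_mul, norm_pow]
    gcongr
  have hNN : G ^ 2 / N * (E * (A * a ^ 2 / N)) ≤ G ^ 2 * (E * (A * a ^ 2)) / (N * √N) := by
    calc _ = G ^ 2 * (E * (A * a ^ 2)) / (N * N) := by field_simp
      _ ≤ _ := by gcongr
  have htri := norm_sub_le_norm_sub_add_norm_sub (separatedIntegral a u v α y p)
    (((2 * (g ^ 2 * (exp (-α * p) * expQuot (α * p) *
      (u - v + a ^ 2 * lam * p))).im : ℝ) : ℂ))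
    (((4 * Real.pi * a ^ 2 / N * (p * exp (-α * p) * expQuot (α * p)).im : ℝ) : ℂ))
  refine htri.trans ?_
  have hmix2 : 2 * ‖g‖ ^ 2 * ‖exp (-α * p) * (starRingEnd ℂ) (expQuot (α * p)) * ((u : ℂ) - v)‖ ≤
      2 * (G ^ 2 / N * (E * (A * a ^ 2 / N))) := by
    rw [mul_assoc]; gcongr
  calc _ ≤ (4 * (2 + a ^ 2) * (C * C + 2 * C * (L * G)) / (N * √N) +
        2 * (G ^ 2 / N * (E * (A * a ^ 2 / N)))) + 2 * (G ^ 2 / N * (E * (A * a ^ 2 / N))) := by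
        refine add_le_add (main.trans ?_) hfinal
        exact add_le_add le_rfl hmix2
    _ ≤ (4 * (2 + a ^ 2) * (C * C + 2 * C * (L * G)) / (N * √N) +
        2 * (G ^ 2 * (E * (A * a ^ 2)) / (N * √N))) +
        2 * (G ^ 2 * (E * (A * a ^ 2)) / (N * √N)) := by gcongr
    _ = _ := by ring

/-! ### The limiting phase -/

/-- The Stieltjes transform of the semicircle law. -/
def semicircleStieltjes (z : ℂ) : ℂ := ∫ t in (-1 : ℝ)..1, (semicircle t : ℂ) / (z - t)

theorem continuous_semicircle : Continuous semicircle := by unfold semicircle; fun_prop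

theorem abs_semicircle_le (t : ℝ) : |semicircle t| ≤ 1 := by
  have h1 : Real.sqrt (1 - t ^ 2) ≤ 1 := Real.sqrt_le_one.mpr (by nlinarith [sq_nonneg t])
  have h2 : 2 / Real.pi ≤ 1 := by rw [div_le_one Real.pi_pos]; exact Real.two_le_pi
  rw [semicircle, abs_of_nonneg (by positivity)]
  calc _ ≤ (1 : ℝ) * 1 := by gcongr
    _ = 1 := one_mul 1

theorem continuous_semicircle_div {z : ℂ} (hz : z.im ≠ 0) :
    Continuous fun t : ℝ => (semicircle t : ℂ) / (z - t) :=
  Continuous.div (continuous_ofReal.comp continuous_semicircle) (by fun_prop)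
    fun t => sub_ofReal_ne_zero hz t

theorem norm_semicircleStieltjes_le {z : ℂ} {η : ℝ} (hη : 0 < η) (hz : η ≤ |z.im|) :
    ‖semicircleStieltjes z‖ ≤ 2 / η := by
  have := intervalIntegral.norm_integral_le_of_norm_le_const (a := (-1 : ℝ)) (b := 1)
    (f := fun t : ℝ => (semicircle t : ℂ) / (z - t)) (C := 1 / η) (fun t _ => ?_)
  · refine this.trans (le_of_eq ?_)
    norm_num; ring
  · rw [div_eq_mul_one_div, norm_mul, norm_real, Real.norm_eq_abs]
    calc _ ≤ 1 * (1 / η) := mul_le_mul (abs_semicircle_le t) (norm_one_div_sub_ofReal_le hη hz t)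
          (norm_nonneg _) zero_le_one
      _ = _ := one_mul _

theorem norm_semicircleStieltjes_sub_le {z w : ℂ} {η : ℝ} (hη : 0 < η) (hz : η ≤ |z.im|)
    (hw : η ≤ |w.im|) :
    ‖semicircleStieltjes z - semicircleStieltjes w‖ ≤ 2 / η ^ 2 * ‖z - w‖ := by
  have hz0 : z.im ≠ 0 := fun h => by rw [h, abs_zero] at hz; linarith
  have hw0 : w.im ≠ 0 := fun h => by rw [h, abs_zero] at hw; linarith
  rw [semicircleStieltjes, semicircleStieltjes, ← intervalIntegral.integral_sub
    ((continuous_semicircle_div hz0).intervalIntegrable _ _)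
    ((continuous_semicircle_div hw0).intervalIntegrable _ _)]
  have := intervalIntegral.norm_integral_le_of_norm_le_const (a := (-1 : ℝ)) (b := 1)
    (f := fun t : ℝ => (semicircle t : ℂ) / (z - t) - (semicircle t : ℂ) / (w - t))
    (C := 1 / η * (1 / η) * ‖z - w‖) (fun t _ => ?_)
  · refine this.trans (le_of_eq ?_)
    norm_num; ring
  · have h1 := sub_ofReal_ne_zero hz0 t
    have h2 := sub_ofReal_ne_zero hw0 t
    have e1 : (semicircle t : ℂ) / (z - t) - (semicircle t : ℂ) / (w - t) =
        semicircle t * (1 / (z - t) * (1 / (w - t)) * (w - z)) := by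
      field_simp; ring
    rw [e1, norm_mul, norm_mul, norm_mul, norm_real, Real.norm_eq_abs, norm_sub_rev w z]
    have h3 := norm_one_div_sub_ofReal_le hη hz t
    have h4 := norm_one_div_sub_ofReal_le hη hw t
    calc _ ≤ 1 * (1 / η * (1 / η) * ‖z - w‖) := by
          have := abs_semicircle_le t
          gcongr
      _ = _ := one_mul _

theorem continuousOn_semicircleStieltjes : ContinuousOn semicircleStieltjes {z | 0 < z.im} := by
  intro z hz
  have hz' : 0 < z.im := hz
  refine ContinuousAt.continuousWithinAt ?_
  have hη : 0 < z.im / 2 := by linarith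
  rw [ContinuousAt, tendsto_iff_norm_sub_tendsto_zero]
  have hlim : Tendsto (fun w : ℂ => 2 / (z.im / 2) ^ 2 * ‖w - z‖) (𝓝 z) (𝓝 0) := by
    have : Continuous fun w : ℂ => 2 / (z.im / 2) ^ 2 * ‖w - z‖ := by fun_prop
    simpa using this.tendsto z
  refine squeeze_zero' (Eventually.of_forall fun _ => norm_nonneg _) ?_ hlim
  have hopen : IsOpen {w : ℂ | z.im / 2 < w.im} := isOpen_lt continuous_const continuous_im
  filter_upwards [hopen.mem_nhds (by simp only [Set.mem_ofPred_eq]; linarith)] with w hw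
  exact norm_semicircleStieltjes_sub_le hη ((le_of_lt hw).trans (le_abs_self _))
    ((by linarith : z.im / 2 ≤ z.im).trans (le_abs_self _))

theorem sub_ofReal_mem_slitPlane {z : ℂ} (hz : 0 < z.im) (t : ℝ) : z - t ∈ slitPlane := by
  right; simpa using hz.ne'

theorem hasDerivAt_semicirclePotential {z : ℂ} (hz : 0 < z.im) :
    HasDerivAt semicirclePotential (semicircleStieltjes z) z := by
  have hopen : IsOpen {w : ℂ | z.im / 2 < w.im} := isOpen_lt continuous_const continuous_im
  have hs : {w : ℂ | z.im / 2 < w.im} ∈ 𝓝 z :=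
    hopen.mem_nhds (by simp only [Set.mem_ofPred_eq]; linarith)
  have hcont : ∀ w : ℂ, 0 < w.im →
      Continuous fun t : ℝ => log (w - t) * (semicircle t : ℂ) := fun w hw =>
    (Continuous.clog (by fun_prop) fun t => sub_ofReal_mem_slitPlane hw t).mul
      (continuous_ofReal.comp continuous_semicircle)
  have h := intervalIntegral.hasDerivAt_integral_of_dominated_loc_of_deriv_le
    (μ := volume) (a := (-1 : ℝ)) (b := 1)
    (F := fun w t => log (w - (t : ℂ)) * (semicircle t : ℂ))
    (F' := fun w t => (semicircle t : ℂ) / (w - t)) (x₀ := z) (bound := fun _ => 1 / (z.im / 2))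
    hs ?_ ((hcont z hz).intervalIntegrable _ _)
    (continuous_semicircle_div hz.ne').aestronglyMeasurable ?_ (by simp) ?_
  · exact h.2
  · filter_upwards [hs] with w hw
    have hw' : z.im / 2 < w.im := hw
    exact (hcont w (by linarith)).aestronglyMeasurable
  · refine ae_of_all _ fun t _ w hw => ?_
    have hw' : z.im / 2 < w.im := hw
    rw [div_eq_mul_one_div, norm_mul, norm_real, Real.norm_eq_abs]
    calc _ ≤ 1 * (1 / (z.im / 2)) := mul_le_mul (abs_semicircle_le t)
          (norm_one_div_sub_ofReal_le (by linarith) (hw'.le.trans (le_abs_self _)) t)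
          (norm_nonneg _) zero_le_one
      _ = _ := one_mul _
  · refine ae_of_all _ fun t _ w hw => ?_
    have hw' : z.im / 2 < w.im := hw
    have h1 := ((hasDerivAt_id w).sub_const (t : ℂ)).clog
      (sub_ofReal_mem_slitPlane (by linarith : 0 < w.im) t)
    have h2 := h1.mul_const (semicircle t : ℂ)
    simpa [div_eq_mul_inv, mul_comm] using h2

theorem hasDerivAt_average_log {N : ℕ} (y : Fin N → ℝ) {z : ℂ} (hz : 0 < z.im) :
    HasDerivAt (fun z => (1 / (N : ℂ)) * ∑ j, log (z - (y j : ℂ))) (stieltjes y z) z := by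
  refine HasDerivAt.const_mul _ (HasDerivAt.fun_sum fun j _ => ?_)
  exact ((hasDerivAt_id z).sub_const (y j : ℂ)).clog (sub_ofReal_mem_slitPlane hz (y j))

/-- Cauchy's estimate on a disc of radius `η` turns closeness of the logarithmic potentials into
closeness of the Stieltjes transforms. -/
theorem norm_stieltjes_sub_le_of_mem_goodPoints {R η ξ C : ℝ} {N : ℕ} {y : Fin N → ℝ}
    (hη : 0 < η) (hy : y ∈ goodPoints R η ξ C N) {z : ℂ} (h1 : |z.re| ≤ R - η)
    (h2 : 2 * η ≤ z.im) (h3 : z.im ≤ R - η) :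
    ‖stieltjes y z - semicircleStieltjes z‖ ≤ C * (N : ℝ) ^ (-ξ) / η := by
  have hball : ∀ w ∈ Metric.closedBall z η, w ∈ Omega R η ∧ 0 < w.im := by
    intro w hw
    rw [Metric.mem_closedBall, dist_eq_norm] at hw
    have hre := (abs_re_le_norm (w - z)).trans hw
    have him := (abs_im_le_norm (w - z)).trans hw
    rw [sub_re] at hre
    rw [sub_im] at him
    rw [abs_le] at hre him h1
    have h4 : 0 < w.im := by linarith [him.1]
    refine ⟨⟨?_, ?_, ?_⟩, h4⟩
    · rw [abs_le]; constructor <;> linarith [hre.1, hre.2, h1.1, h1.2]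
    · rw [abs_of_pos h4]; linarith [him.1]
    · rw [abs_of_pos h4]; linarith [him.2]
  have hderiv : ∀ w : ℂ, 0 < w.im → HasDerivAt
      (fun z => (1 / (N : ℂ)) * ∑ j, log (z - (y j : ℂ)) - semicirclePotential z)
      (stieltjes y w - semicircleStieltjes w) w := fun w hw =>
    (hasDerivAt_average_log y hw).sub (hasDerivAt_semicirclePotential hw)
  have hz : 0 < z.im := by linarith
  rw [← (hderiv z hz).deriv]
  refine norm_deriv_le_of_forall_mem_sphere_norm_le hη ?_ fun w hw =>
    hy w (hball w (Metric.sphere_subset_closedBall hw)).1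
  apply DifferentiableOn.diffContOnCl
  intro w hw
  exact (hderiv w (hball w (Metric.closure_ball_subset_closedBall hw)).2).differentiableAt.differentiableWithinAt

/-- The generating function of the Chebyshev polynomials of the second kind, times `sin² φ`. -/
theorem hasSum_sin_series {l : ℂ} (hl : ‖l‖ < 1) (φ : ℝ) :
    HasSum (fun n : ℕ => l ^ n * (Real.sin φ * Real.sin ((n + 1) * φ) : ℝ))
      ((Real.sin φ ^ 2 : ℝ) / (1 - 2 * l * Real.cos φ + l ^ 2)) := by
  set E := exp (φ * I) with hE
  have hEn : ‖E‖ = 1 := norm_exp_ofReal_mul_I φ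
  have hE0 : E ≠ 0 := exp_ne_zero _
  have hEi : exp (-φ * I) = E⁻¹ := by rw [hE, ← exp_neg]; congr 1; ring
  have hEin : ‖E⁻¹‖ = 1 := by rw [norm_inv, hEn, inv_one]
  have g1 := (hasSum_geometric_of_norm_lt_one (ξ := l * E) (by rwa [norm_mul, hEn, mul_one])).mul_left E
  have g2 := (hasSum_geometric_of_norm_lt_one (ξ := l * E⁻¹)
    (by rwa [norm_mul, hEin, mul_one])).mul_left E⁻¹
  have g3 := (g1.sub g2).mul_left ((Real.sin φ : ℂ) / (2 * I))
  have hne : ∀ F : ℂ, ‖F‖ = 1 → 1 - l * F ≠ 0 := by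
    intro F hF h
    have : ‖l * F‖ = 1 := by rw [← sub_eq_zero.mp h, norm_one]
    rw [norm_mul, hF, mul_one] at this
    linarith
  have hd1 := hne E hEn
  have hd2 := hne E⁻¹ hEin
  have hcos : (Real.cos φ : ℂ) = (E + E⁻¹) / 2 := by
    rw [ofReal_cos, Complex.cos, hEi]
  have hsin : (Real.sin φ : ℂ) = (E - E⁻¹) / (2 * I) := by
    rw [ofReal_sin, Complex.sin, hEi]
    field_simp
    rw [I_sq]; ring
  have hden : 1 - 2 * l * Real.cos φ + l ^ 2 = (1 - l * E) * (1 - l * E⁻¹) := by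
    rw [hcos]; field_simp; ring
  convert! g3 using 1
  · ext n
    have hsn : (Real.sin ((n + 1) * φ) : ℂ) = (E ^ (n + 1) - E⁻¹ ^ (n + 1)) / (2 * I) := by
      rw [ofReal_sin, Complex.sin, hE, ← exp_nat_mul, ← exp_neg, ← exp_nat_mul]
      push_cast
      have e1 : -(((n : ℂ) + 1) * φ) * I = (n + 1) * -(φ * I) := by ring
      have e2 : ((n : ℂ) + 1) * φ * I = (n + 1) * (φ * I) := by ring
      rw [e1, e2]
      field_simp
      rw [I_sq]; ring
    rw [ofReal_mul, hsn, mul_pow, mul_pow]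
    ring
  · rw [hden]
    have e3 : E * (1 - l * E)⁻¹ - E⁻¹ * (1 - l * E⁻¹)⁻¹ =
        (E - E⁻¹) / ((1 - l * E) * (1 - l * E⁻¹)) := by
      rw [← div_eq_mul_inv, ← div_eq_mul_inv, div_sub_div _ _ hd1 hd2]
      congr 1
      linear_combination (0 : ℂ) * mul_inv_cancel₀ hE0
    have e4 : E - E⁻¹ = 2 * I * Real.sin φ := by rw [hsin]; field_simp
    rw [e3, e4]
    push_cast
    field_simp

theorem integral_cos_natCast_mul (k : ℕ) :
    ∫ φ in (0 : ℝ)..Real.pi, Real.cos (k * φ) = if k = 0 then Real.pi else 0 := by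
  split_ifs with h
  · simp [h]
  · have hk : (k : ℝ) ≠ 0 := by exact_mod_cast h
    rw [intervalIntegral.integral_comp_mul_left _ hk, integral_cos, mul_zero, Real.sin_zero,
      Real.sin_nat_mul_pi, sub_zero, smul_zero]

theorem integral_sin_mul_sin (n : ℕ) :
    ∫ φ in (0 : ℝ)..Real.pi, Real.sin φ * Real.sin ((n + 1) * φ) =
      if n = 0 then Real.pi / 2 else 0 := by
  have h : ∀ φ : ℝ, Real.sin φ * Real.sin ((n + 1) * φ) =
      (Real.cos (n * φ) - Real.cos ((n + 2 : ℕ) * φ)) / 2 := by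
    intro φ
    have e1 : (n : ℝ) * φ = (n + 1) * φ - φ := by ring
    have e2 : ((n + 2 : ℕ) : ℝ) * φ = (n + 1) * φ + φ := by push_cast; ring
    rw [e1, e2, Real.cos_sub, Real.cos_add]
    ring
  simp_rw [h]
  rw [intervalIntegral.integral_div, intervalIntegral.integral_sub
    (Continuous.intervalIntegrable (by fun_prop) _ _)
    (Continuous.intervalIntegrable (by fun_prop) _ _), integral_cos_natCast_mul,
    integral_cos_natCast_mul]
  split_ifs <;> simp_all

theorem integral_poisson {l : ℂ} (hl : ‖l‖ < 1) :
    ∫ φ in (0 : ℝ)..Real.pi, ((Real.sin φ ^ 2 : ℝ) / (1 - 2 * l * Real.cos φ + l ^ 2) : ℂ) =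
      Real.pi / 2 := by
  have h := intervalIntegral.hasSum_integral_of_dominated_convergence (μ := volume)
    (a := 0) (b := Real.pi)
    (F := fun (n : ℕ) (φ : ℝ) => l ^ n * (Real.sin φ * Real.sin ((n + 1) * φ) : ℝ))
    (f := fun φ : ℝ => ((Real.sin φ ^ 2 : ℝ) / (1 - 2 * l * Real.cos φ + l ^ 2) : ℂ))
    (fun n _ => ‖l‖ ^ n) (fun n => Continuous.aestronglyMeasurable (by fun_prop))
    (fun n => ae_of_all _ fun φ _ => ?_)
    (ae_of_all _ fun _ _ => summable_geometric_of_lt_one (norm_nonneg _) hl) (by simp)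
    (ae_of_all _ fun φ _ => hasSum_sin_series hl φ)
  · refine h.unique ?_
    have h2 : ∀ n : ℕ, ∫ φ in (0 : ℝ)..Real.pi,
        l ^ n * ((Real.sin φ * Real.sin ((n + 1) * φ) : ℝ) : ℂ) =
        if n = 0 then (Real.pi / 2 : ℂ) else 0 := by
      intro n
      rw [intervalIntegral.integral_const_mul, intervalIntegral.integral_ofReal,
        integral_sin_mul_sin]
      split_ifs with h0 <;> simp [h0]
    simp_rw [h2]
    exact hasSum_ite_eq 0 _
  · rw [norm_mul, norm_pow, norm_real, Real.norm_eq_abs, abs_mul]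
    calc _ ≤ ‖l‖ ^ n * (1 * 1) := by
          gcongr
          · exact Real.abs_sin_le_one _
          · exact Real.abs_sin_le_one _
      _ = _ := by ring

/-- The Joukowski map uniformizes the Stieltjes transform of the semicircle law. -/
theorem semicircleStieltjes_joukowski {ζ : ℂ} (hζ : 1 < ‖ζ‖) (hz : ((ζ + 1 / ζ) / 2).im ≠ 0) :
    semicircleStieltjes ((ζ + 1 / ζ) / 2) = 2 / ζ := by
  have hζ0 : ζ ≠ 0 := by rintro rfl; simp at hζ; linarith
  have hl : ‖1 / ζ‖ < 1 := by
    rw [norm_div, norm_one, div_lt_one (by linarith)]; exact hζ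
  set z := (ζ + 1 / ζ) / 2 with hzdef
  -- substitute `t = cos φ`
  have hsub := intervalIntegral.integral_deriv_smul_comp (a := Real.pi) (b := 0)
    (f := Real.cos) (f' := fun x => -Real.sin x) (g := fun t : ℝ => (semicircle t : ℂ) / (z - t))
    (fun x _ => Real.hasDerivAt_cos x) (by fun_prop) (continuous_semicircle_div hz)
  rw [Real.cos_pi, Real.cos_zero, intervalIntegral.integral_symm,
    ← intervalIntegral.integral_neg] at hsub
  rw [semicircleStieltjes, ← hsub]
  have hpi : (Real.pi : ℂ) ≠ 0 := by exact_mod_cast Real.pi_ne_zero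
  have hint : ∀ φ ∈ Set.uIcc 0 Real.pi,
      -(-Real.sin φ • ((fun t : ℝ => (semicircle t : ℂ) / (z - t)) ∘ Real.cos) φ) =
        4 * (1 / ζ) / Real.pi *
          ((Real.sin φ ^ 2 : ℝ) / (1 - 2 * (1 / ζ) * Real.cos φ + (1 / ζ) ^ 2)) := by
    intro φ hφ
    rw [Set.uIcc_of_le Real.pi_pos.le] at hφ
    have hsin := Real.sin_nonneg_of_nonneg_of_le_pi hφ.1 hφ.2
    have h1 : semicircle (Real.cos φ) = 2 / Real.pi * Real.sin φ := by
      rw [semicircle, ← Real.abs_sin_eq_sqrt_one_sub_cos_sq, abs_of_nonneg hsin]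
    have h2 : 1 - 2 * (1 / ζ) * Real.cos φ + (1 / ζ) ^ 2 = 2 * (1 / ζ) * (z - Real.cos φ) := by
      rw [hzdef]; field_simp; ring
    have h3 := sub_ofReal_ne_zero hz (Real.cos φ)
    rw [h2, Function.comp_apply, h1, real_smul]
    push_cast at h3 ⊢
    field_simp
    ring
  rw [intervalIntegral.integral_congr hint, intervalIntegral.integral_const_mul,
    integral_poisson hl]
  field_simp
  ring

theorem exists_joukowski {z : ℂ} (hz : z.im ≠ 0) :
    ∃ ζ : ℂ, 1 < ‖ζ‖ ∧ z = (ζ + 1 / ζ) / 2 := by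
  obtain ⟨w, hw⟩ := IsAlgClosed.exists_pow_nat_eq (z ^ 2 - 1) (n := 2) (by norm_num)
  have hprod : (z + w) * (z - w) = 1 := by linear_combination -hw
  have h1 : z + w ≠ 0 := fun h => by rw [h, zero_mul] at hprod; exact zero_ne_one hprod
  have h2 : z - w ≠ 0 := fun h => by rw [h, mul_zero] at hprod; exact zero_ne_one hprod
  have hn : ‖z + w‖ * ‖z - w‖ = 1 := by rw [← norm_mul, hprod, norm_one]
  rcases lt_trichotomy ‖z + w‖ 1 with h | h | h
  · refine ⟨z - w, ?_, ?_⟩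
    · by_contra! h3
      have := norm_pos_iff.mpr h2
      nlinarith [norm_nonneg (z + w)]
    · rw [one_div, ← eq_inv_of_mul_eq_one_left hprod]; ring
  · -- roots of modulus one are conjugate, and then `z` is real
    exfalso
    apply hz
    have h3 : (starRingEnd ℂ) (z + w) = z - w := by
      apply mul_left_cancel₀ h1
      rw [mul_conj, hprod, normSq_eq_norm_sq, h]; simp
    have h4 := congrArg im h3
    simp at h4
    linarith
  · refine ⟨z + w, h, ?_⟩
    rw [one_div, ← eq_inv_of_mul_eq_one_right hprod]; ring

/-! ### The limiting saddle point -/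

/-- The limit of `phaseDeriv`, in which the empirical Stieltjes transform is replaced by that of
the semicircle law. -/
def limitPhaseDeriv (a u : ℝ) (z : ℂ) : ℂ := (z - u) / (a : ℂ) ^ 2 + semicircleStieltjes z

/-- The zero of `limitPhaseDeriv a u` in the upper half plane. Its imaginary part is proportional
to the limiting density at `u`. -/
def limitSaddle (a u : ℝ) : ℂ :=
  (((1 + 2 * a ^ 2) / (1 + 4 * a ^ 2) * u : ℝ) : ℂ) + ((Real.pi * a ^ 2 * rho a u : ℝ) : ℂ) * I

theorem limitSaddle_re (a u : ℝ) :
    (limitSaddle a u).re = (1 + 2 * a ^ 2) / (1 + 4 * a ^ 2) * u := by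
  rw [limitSaddle, add_re, re_ofReal_mul, ofReal_re]; simp

theorem limitSaddle_im (a u : ℝ) : (limitSaddle a u).im = Real.pi * a ^ 2 * rho a u := by
  rw [limitSaddle, add_im, im_ofReal_mul, ofReal_im]; simp

theorem continuous_rho (a : ℝ) : Continuous (rho a) := by unfold rho; fun_prop

theorem continuous_limitSaddle (a : ℝ) : Continuous (limitSaddle a) := by
  have := continuous_rho a
  unfold limitSaddle
  fun_prop

section

variable {a u : ℝ}

theorem sq_le_of_abs_le (hu : |u| ≤ Real.sqrt (1 / 2 + 2 * a ^ 2)) :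
    u ^ 2 ≤ (1 + 4 * a ^ 2) / 2 := by
  rw [Real.le_sqrt (abs_nonneg u) (by positivity), sq_abs] at hu
  linarith

/-- The imaginary part of the limiting saddle point in terms of the square root
`√(1 + 4a² - u²)`. -/
theorem limitSaddle_im_eq (hu : |u| ≤ Real.sqrt (1 / 2 + 2 * a ^ 2)) :
    (limitSaddle a u).im = 2 * a ^ 2 / (1 + 4 * a ^ 2) * Real.sqrt (1 + 4 * a ^ 2 - u ^ 2) := by
  have h := sq_le_of_abs_le hu
  rw [limitSaddle_im, rho, max_eq_left (by nlinarith [sq_nonneg a])]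
  have := Real.pi_ne_zero
  field_simp

/-- For `u` in the bulk the limiting saddle point stays away from the real axis. -/
theorem le_limitSaddle_im (ha : 0 < a) (hu : |u| ≤ Real.sqrt (1 / 2 + 2 * a ^ 2)) :
    a ^ 2 / (1 + 4 * a ^ 2) ≤ (limitSaddle a u).im := by
  have h := sq_le_of_abs_le hu
  rw [limitSaddle_im_eq hu]
  have h1 : 1 / 2 ≤ Real.sqrt (1 + 4 * a ^ 2 - u ^ 2) := by
    apply Real.le_sqrt_of_sq_le; nlinarith [sq_nonneg a]
  calc _ = 2 * a ^ 2 / (1 + 4 * a ^ 2) * (1 / 2) := by ring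
    _ ≤ _ := by gcongr

theorem norm_limitSaddle_le (hu : |u| ≤ Real.sqrt (1 / 2 + 2 * a ^ 2)) :
    ‖limitSaddle a u‖ ≤ 1 + 4 * a ^ 2 := by
  have h := sq_le_of_abs_le hu
  have h1 : ‖limitSaddle a u‖ ^ 2 ≤ (1 + 4 * a ^ 2) ^ 2 := by
    rw [← normSq_eq_norm_sq, normSq_apply, ← pow_two, ← pow_two, limitSaddle_re,
      limitSaddle_im_eq hu, mul_pow, mul_pow, Real.sq_sqrt (by nlinarith [sq_nonneg a])]
    have h2 : ((1 + 2 * a ^ 2) / (1 + 4 * a ^ 2)) ^ 2 ≤ 1 := by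
      rw [sq_le_one_iff₀ (by positivity), div_le_one (by positivity)]; nlinarith [sq_nonneg a]
    have h3 : (2 * a ^ 2 / (1 + 4 * a ^ 2)) ^ 2 ≤ 1 := by
      rw [sq_le_one_iff₀ (by positivity), div_le_one (by positivity)]; nlinarith [sq_nonneg a]
    calc _ ≤ 1 * u ^ 2 + 1 * (1 + 4 * a ^ 2 - u ^ 2) := by
          gcongr
          nlinarith [sq_nonneg a]
      _ ≤ _ := by nlinarith [sq_nonneg a]
  exact (sq_le_sq₀ (norm_nonneg _) (by positivity)).mp h1

/-- In the Joukowski coordinate the limiting saddle point is `u + i √(1 + 4a² - u²)`. -/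
theorem limitPhaseDeriv_limitSaddle (ha : 0 < a) (hu : |u| ≤ Real.sqrt (1 / 2 + 2 * a ^ 2)) :
    limitPhaseDeriv a u (limitSaddle a u) = 0 := by
  have h := sq_le_of_abs_le hu
  set s := Real.sqrt (1 + 4 * a ^ 2 - u ^ 2) with hs
  have hs2 : s ^ 2 = 1 + 4 * a ^ 2 - u ^ 2 := Real.sq_sqrt (by nlinarith [sq_nonneg a])
  set ζ : ℂ := (u : ℂ) + (s : ℂ) * I with hζ
  have hnorm : ‖ζ‖ ^ 2 = 1 + 4 * a ^ 2 := by
    rw [hζ, ← normSq_eq_norm_sq, normSq_add_mul_I]; linarith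
  have hζ1 : 1 < ‖ζ‖ := by
    by_contra! h3
    nlinarith [norm_nonneg ζ, mul_pos ha ha]
  have hζ0 : ζ ≠ 0 := by rintro h0; rw [h0, norm_zero] at hζ1; linarith
  have hconj : ζ * ((u : ℂ) - s * I) = 1 + 4 * a ^ 2 := by
    have : (s : ℂ) ^ 2 = 1 + 4 * a ^ 2 - u ^ 2 := by exact_mod_cast hs2
    rw [hζ]
    linear_combination (1 : ℂ) * this - (s : ℂ) ^ 2 * I_sq
  have hc : (1 + 4 * (a : ℂ) ^ 2) ≠ 0 := by
    exact_mod_cast (by positivity : (1 + 4 * a ^ 2) ≠ 0)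
  have hinv : 1 / ζ = ((u : ℂ) - s * I) / (1 + 4 * a ^ 2) := by
    rw [div_eq_div_iff hζ0 hc, ← hconj]; ring
  have hz : limitSaddle a u = (ζ + 1 / ζ) / 2 := by
    rw [hinv, hζ]
    apply Complex.ext
    · rw [limitSaddle_re]
      have : ((u : ℂ) + s * I + ((u : ℂ) - s * I) / (1 + 4 * a ^ 2)) / 2 =
          (((1 + 2 * a ^ 2) / (1 + 4 * a ^ 2) * u : ℝ) : ℂ) +
            ((2 * a ^ 2 / (1 + 4 * a ^ 2) * s : ℝ) : ℂ) * I := by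
        push_cast; field_simp; ring
      rw [this, add_re, re_ofReal_mul, ofReal_re]; simp
    · rw [limitSaddle_im_eq hu]
      have : ((u : ℂ) + s * I + ((u : ℂ) - s * I) / (1 + 4 * a ^ 2)) / 2 =
          (((1 + 2 * a ^ 2) / (1 + 4 * a ^ 2) * u : ℝ) : ℂ) +
            ((2 * a ^ 2 / (1 + 4 * a ^ 2) * s : ℝ) : ℂ) * I := by
        push_cast; field_simp; ring
      rw [this, add_im, im_ofReal_mul, ofReal_im, ← hs]; simp
  have him : ((ζ + 1 / ζ) / 2).im ≠ 0 := by
    rw [← hz]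
    have := le_limitSaddle_im ha hu
    have : 0 < a ^ 2 / (1 + 4 * a ^ 2) := by positivity
    linarith
  have ha' : (a : ℂ) ≠ 0 := by exact_mod_cast ha.ne'
  rw [limitPhaseDeriv, hz, semicircleStieltjes_joukowski hζ1 him, div_eq_mul_one_div 2 ζ, hinv, hζ]
  field_simp
  ring

/-- The algebra behind the uniqueness of the limiting saddle point on its horizontal line: the
equations force `(q - b)` times a positive quantity to vanish. -/
theorem joukowski_norm_sq_eq {b q u s α β : ℝ} (hb1 : 1 < b) (hq1 : 1 < q) (hu2 : u ^ 2 ≤ b / 2)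
    (hq : q = α ^ 2 + β ^ 2) (hs2 : s ^ 2 = b - u ^ 2) (hα2 : α * (q + b) = 2 * u * q)
    (hβ2 : β * (b * (q - 1)) = s * (b - 1) * q) : q = b := by
  have hq0 : 0 < q := by linarith
  have hbu : 0 < b - u ^ 2 := by linarith
  have hfac : (q - b) * (u ^ 2 * b * (q - 1) ^ 2 * (q - b) +
      (b - u ^ 2) * (q + b) ^ 2 * (b * q - 1)) = 0 := by
    apply mul_left_cancel₀ hq0.ne'
    have e1 : α ^ 2 * (q + b) ^ 2 = 4 * u ^ 2 * q ^ 2 := by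
      linear_combination (α * (q + b) + 2 * u * q) * hα2
    have e2 : β ^ 2 * (b * (q - 1)) ^ 2 = (b - u ^ 2) * (b - 1) ^ 2 * q ^ 2 := by
      linear_combination (β * (b * (q - 1)) + s * (b - 1) * q) * hβ2 + (b - 1) ^ 2 * q ^ 2 * hs2
    linear_combination (q + b) ^ 2 * (b * (q - 1)) ^ 2 * hq + (b * (q - 1)) ^ 2 * e1 +
      (q + b) ^ 2 * e2
  have hpos : 0 < u ^ 2 * b * (q - 1) ^ 2 * (q - b) +
      (b - u ^ 2) * (q + b) ^ 2 * (b * q - 1) := by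
    have hbq : 0 < b * q - 1 := by nlinarith
    have hmain : 0 < (b - u ^ 2) * (q + b) ^ 2 * (b * q - 1) := by positivity
    rcases le_total b q with h1 | h1
    · have : 0 ≤ u ^ 2 * b * (q - 1) ^ 2 * (q - b) := by
        have : 0 ≤ q - b := by linarith
        positivity
      linarith
    · have h2 : (q - 1) ^ 2 ≤ b * q - 1 := by nlinarith
      have h3 : b * (b - q) < (q + b) ^ 2 := by nlinarith
      have h4 : u ^ 2 * ((q - 1) ^ 2 * (b * (b - q))) ≤
          (b - u ^ 2) * ((b * q - 1) * (b * (b - q))) := by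
        have : 0 ≤ b * (b - q) := mul_nonneg (by linarith) (by linarith)
        gcongr
        linarith
      have h5 : (b - u ^ 2) * ((b * q - 1) * (b * (b - q))) <
          (b - u ^ 2) * ((b * q - 1) * (q + b) ^ 2) := by gcongr
      nlinarith
  rcases mul_eq_zero.mp hfac with h1 | h1
  · linarith
  · exact absurd h1 hpos.ne'

/-- On the horizontal line through the limiting saddle point, `Re limitPhaseDeriv` has no other
zero. In the Joukowski coordinate `ζ` the equations become algebraic, and they force
`|ζ|² = 1 + 4a²`. -/
theorem eq_zero_of_limitPhaseDeriv_re_eq_zero (ha : 0 < a)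
    (hu : |u| ≤ Real.sqrt (1 / 2 + 2 * a ^ 2)) {r : ℝ}
    (h : (limitPhaseDeriv a u (limitSaddle a u + r)).re = 0) : r = 0 := by
  have hu2 := sq_le_of_abs_le hu
  have hy := le_limitSaddle_im ha hu
  have hY : 0 < a ^ 2 / (1 + 4 * a ^ 2) := by positivity
  set z := limitSaddle a u + r with hz
  have hzim : z.im = (limitSaddle a u).im := by simp [hz]
  have hzre : z.re = (limitSaddle a u).re + r := by simp [hz]
  have hzim0 : z.im ≠ 0 := by rw [hzim]; linarith
  obtain ⟨ζ, hζ1, hζz⟩ := exists_joukowski hzim0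
  set b := 1 + 4 * a ^ 2 with hb
  have ha2 : a ^ 2 = (b - 1) / 4 := by rw [hb]; ring
  have hb1 : 1 < b := by rw [hb]; nlinarith [mul_pos ha ha]
  set s := Real.sqrt (b - u ^ 2) with hs
  have hs2 : s ^ 2 = b - u ^ 2 := Real.sq_sqrt (by linarith)
  set α := ζ.re with hα
  set β := ζ.im with hβ
  set q := α ^ 2 + β ^ 2 with hq
  have hqn : normSq ζ = q := by rw [normSq_apply, hq]; ring
  have hq1 : 1 < q := by
    rw [← hqn, normSq_eq_norm_sq]; nlinarith
  have hζ0 : ζ ≠ 0 := by rintro h0; rw [h0, norm_zero] at hζ1; linarith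
  have hre : z.re = α / 2 * (1 + 1 / q) := by
    rw [hζz, div_ofNat_re, add_re, one_div, inv_re, hqn, ← hα]; ring
  have him : z.im = β / 2 * (1 - 1 / q) := by
    rw [hζz, div_ofNat_im, add_im, one_div, inv_im, hqn, ← hβ]; ring
  have hphase : (limitPhaseDeriv a u z).re = (z.re - u) / a ^ 2 + 2 * (α / q) := by
    rw [limitPhaseDeriv, add_re, ← ofReal_pow, div_ofReal_re, sub_re, ofReal_re, hζz,
      semicircleStieltjes_joukowski hζ1 (by rwa [← hζz]), div_eq_mul_inv 2 ζ,
      show (2 : ℂ) = ((2 : ℝ) : ℂ) by norm_num, re_ofReal_mul, inv_re, hqn]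
  have hq0 : 0 < q := by linarith
  have hα2 : α * (q + b) = 2 * u * q := by
    rw [hphase, hre, ha2] at h
    have hb0 : b - 1 ≠ 0 := by linarith
    field_simp at h
    linear_combination h / 4
  have hβ2 : β * (b * (q - 1)) = s * (b - 1) * q := by
    rw [limitSaddle_im_eq hu, ← hb, ← hs, him, ha2] at hzim
    field_simp at hzim
    linear_combination hzim / 4
  have hqb := joukowski_norm_sq_eq hb1 hq1 hu2 hq hs2 hα2 hβ2
  have hαu : α = u := by
    rw [hqb] at hα2
    have hb0 : b ≠ 0 := by linarith
    apply mul_right_cancel₀ (mul_ne_zero two_ne_zero hb0)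
    linear_combination hα2
  have h1 : z.re = (limitSaddle a u).re := by
    rw [hre, hqb, hαu, limitSaddle_re, ← hb, ha2]
    field_simp
    ring
  linarith

/-- The real part of the derivative of the limiting phase increases through zero along the
horizontal line through the limiting saddle point. -/
theorem limitPhaseDeriv_re_pos (ha : 0 < a) (hu : |u| ≤ Real.sqrt (1 / 2 + 2 * a ^ 2)) {r : ℝ}
    (hr : r ≠ 0) : 0 < r * (limitPhaseDeriv a u (limitSaddle a u + r)).re := by
  have hy := le_limitSaddle_im ha hu
  have hY : 0 < a ^ 2 / (1 + 4 * a ^ 2) := by positivity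
  have him : 0 < (limitSaddle a u).im := by linarith
  set f : ℝ → ℝ := fun t => (limitPhaseDeriv a u (limitSaddle a u + t)).re with hf
  have hcont : Continuous f := by
    have h1 : Continuous fun t : ℝ => semicircleStieltjes (limitSaddle a u + t) :=
      continuousOn_semicircleStieltjes.comp_continuous (by fun_prop) fun t => by
        rw [Set.mem_ofPred_eq, add_im, ofReal_im, add_zero]; exact him
    simp only [hf, limitPhaseDeriv]
    fun_prop
  obtain ⟨M, hM⟩ : ∃ M : ℝ, ∀ t : ℝ, |f t - t / a ^ 2| ≤ M := by
    refine ⟨‖(limitSaddle a u - u) / (a : ℂ) ^ 2‖ + 2 / (limitSaddle a u).im, fun t => ?_⟩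
    have h1 : f t - t / a ^ 2 = ((limitSaddle a u - u) / (a : ℂ) ^ 2 +
        semicircleStieltjes (limitSaddle a u + t)).re := by
      have h2 : limitPhaseDeriv a u (limitSaddle a u + t) = ((limitSaddle a u - u) / (a : ℂ) ^ 2 +
        semicircleStieltjes (limitSaddle a u + t)) + ((t / a ^ 2 : ℝ) : ℂ) := by
        rw [limitPhaseDeriv]; push_cast; ring
      simp only [hf]
      rw [h2, add_re _ ((t / a ^ 2 : ℝ) : ℂ), ofReal_re]; ring
    rw [h1]
    refine (abs_re_le_norm _).trans ((norm_add_le _ _).trans (add_le_add le_rfl ?_))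
    apply norm_semicircleStieltjes_le him
    rw [add_im, ofReal_im, add_zero]; exact le_abs_self _
  -- the signs at `±T` are known, so a wrong sign at `r` would give a zero other than the origin
  set T := |r| + a ^ 2 * (|M| + 1) with hT
  have hT0 : 0 < T := by positivity
  have hTM : M < T / a ^ 2 := by
    have : T / a ^ 2 = |r| / a ^ 2 + (|M| + 1) := by rw [hT]; field_simp
    rw [this]
    have : 0 ≤ |r| / a ^ 2 := by positivity
    linarith [le_abs_self M]
  have hTr : |r| < T := by rw [hT]; have : 0 < a ^ 2 * (|M| + 1) := by positivity
                           linarith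
  have hpos : 0 < f T := by linarith [(abs_le.mp (hM T)).1]
  have hneg : f (-T) < 0 := by
    have := (abs_le.mp (hM (-T))).2
    rw [neg_div] at this; linarith
  rcases lt_or_gt_of_ne hr with h | h
  · have : f r < 0 := by
      by_contra! h1
      rw [abs_of_neg h] at hTr
      obtain ⟨t, ht, h0⟩ := intermediate_value_Icc (by linarith : -T ≤ r) hcont.continuousOn
        ⟨hneg.le, h1⟩
      have := eq_zero_of_limitPhaseDeriv_re_eq_zero ha hu h0
      linarith [ht.2]
    exact mul_pos_of_neg_of_neg h this
  · have : 0 < f r := by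
      by_contra! h1
      rw [abs_of_pos h] at hTr
      obtain ⟨t, ht, h0⟩ := intermediate_value_Icc hTr.le hcont.continuousOn ⟨h1, hpos.le⟩
      have := eq_zero_of_limitPhaseDeriv_re_eq_zero ha hu h0
      linarith [ht.1]
    exact mul_pos h this

end

/-- A uniform version of `limitPhaseDeriv_re_pos` away from zero and infinity. -/
theorem exists_le_limitPhaseDeriv_re {a : ℝ} (ha : 0 < a) (δ R : ℝ) (hδ : 0 < δ) :
    ∃ m > 0, ∀ u : ℝ, |u| ≤ Real.sqrt (1 / 2 + 2 * a ^ 2) → ∀ r : ℝ, δ ≤ |r| → |r| ≤ R →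
      m ≤ r * (limitPhaseDeriv a u (limitSaddle a u + r)).re := by
  set U := Real.sqrt (1 / 2 + 2 * a ^ 2) with hU
  set S : Set (ℝ × ℝ) := {x | |x.1| ≤ U ∧ δ ≤ |x.2| ∧ |x.2| ≤ R} with hS
  have hY : 0 < a ^ 2 / (1 + 4 * a ^ 2) := by positivity
  have hcompact : IsCompact S := by
    refine (isCompact_Icc (a := ((-U, -R) : ℝ × ℝ)) (b := (U, R))).of_isClosed_subset ?_ ?_
    · have h1 : Continuous fun x : ℝ × ℝ => |x.1| := by fun_prop
      have h2 : Continuous fun x : ℝ × ℝ => |x.2| := by fun_prop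
      exact (isClosed_le h1 continuous_const).inter
        ((isClosed_le continuous_const h2).inter (isClosed_le h2 continuous_const))
    · rintro x ⟨h1, -, h2⟩
      exact ⟨⟨(abs_le.mp h1).1, (abs_le.mp h2).1⟩, ⟨(abs_le.mp h1).2, (abs_le.mp h2).2⟩⟩
  have hcont : ContinuousOn
      (fun x : ℝ × ℝ => x.2 * (limitPhaseDeriv a x.1 (limitSaddle a x.1 + x.2)).re) S := by
    have h0 := continuous_limitSaddle a
    have h1 : ContinuousOn (fun x : ℝ × ℝ => semicircleStieltjes (limitSaddle a x.1 + x.2)) S := by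
      refine continuousOn_semicircleStieltjes.comp (by fun_prop) fun x hx => ?_
      rw [Set.mem_ofPred_eq, add_im, ofReal_im, add_zero]
      exact hY.trans_le (le_limitSaddle_im ha hx.1)
    simp only [limitPhaseDeriv]
    exact continuous_snd.continuousOn.mul (continuous_re.comp_continuousOn
      (ContinuousOn.add (by fun_prop) h1))
  obtain ⟨m, hm, h⟩ := hcompact.exists_forall_le' hcont (a := 0) fun x hx => by
    refine limitPhaseDeriv_re_pos ha hx.1 ?_
    intro h0
    have := hx.2.1
    rw [h0, abs_zero] at this
    linarith
  exact ⟨m, hm, fun u hu r h1 h2 => h (u, r) ⟨hu, h1, h2⟩⟩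

/-! ### Saddle points of the empirical phase -/

section

variable {a u : ℝ} {N : ℕ} {y : Fin N → ℝ}

theorem norm_stieltjes_sub_le {z w : ℂ} {η : ℝ} (hη : 0 < η) (hz : η ≤ z.im) (hw : η ≤ w.im) :
    ‖stieltjes y z - stieltjes y w‖ ≤ 1 / η ^ 2 * ‖z - w‖ := by
  rw [stieltjes, stieltjes, ← mul_sub, ← Finset.sum_sub_distrib]
  refine norm_average_le (by positivity) fun j => ?_
  have h1 := sub_ofReal_ne_zero (z := z) (by linarith) (y j)
  have h2 := sub_ofReal_ne_zero (z := w) (by linarith) (y j)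
  have e : 1 / (z - y j) - 1 / (w - y j) = 1 / (z - y j) * (1 / (w - y j)) * (w - z) := by
    field_simp; ring
  rw [e, norm_mul, norm_mul, norm_sub_rev w z]
  have h3 := norm_one_div_sub_ofReal_le hη (hz.trans (le_abs_self _)) (y j)
  have h4 := norm_one_div_sub_ofReal_le hη (hw.trans (le_abs_self _)) (y j)
  calc _ ≤ 1 / η * (1 / η) * ‖z - w‖ := by gcongr
    _ = _ := by ring

/-- The phase derivative is close to affine, with slope the curvature, near any point. -/
theorem norm_phaseDeriv_sub_le {z₀ z w : ℂ} {η κ : ℝ} (hη : 0 < η) (hz₀ : η ≤ z₀.im)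
    (hz : η ≤ z.im) (hw : η ≤ w.im) (hzκ : ‖z - z₀‖ ≤ κ) (hwκ : ‖w - z₀‖ ≤ κ) :
    ‖phaseDeriv a u y z - phaseDeriv a u y w - curvature a y z₀ * (z - w)‖ ≤
      2 * κ / η ^ 3 * ‖z - w‖ := by
  have hne : ∀ {x : ℂ}, η ≤ x.im → ∀ j, x - (y j : ℂ) ≠ 0 := fun hx j =>
    sub_ofReal_ne_zero (by linarith) _
  have hle : ∀ {x : ℂ}, η ≤ x.im → ∀ j, ‖1 / (x - (y j : ℂ))‖ ≤ 1 / η := fun hx j =>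
    norm_one_div_sub_ofReal_le hη (hx.trans (le_abs_self _)) _
  have e : phaseDeriv a u y z - phaseDeriv a u y w - curvature a y z₀ * (z - w) =
      1 / (N : ℂ) * ∑ j, ((z - z₀) * (1 / (z₀ - y j) ^ 2 * (1 / (z - y j))) +
        (w - z₀) * (1 / (z₀ - y j) * (1 / (z - y j)) * (1 / (w - y j)))) * (z - w) := by
    have e1 : ∀ j, ((z - z₀) * (1 / (z₀ - y j) ^ 2 * (1 / (z - y j))) +
        (w - z₀) * (1 / (z₀ - y j) * (1 / (z - y j)) * (1 / (w - y j)))) * (z - w) =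
        1 / (z - y j) - 1 / (w - y j) + 1 / (z₀ - y j) ^ 2 * (z - w) := by
      intro j
      have h1 := hne hz₀ j
      have h2 := hne hz j
      have h3 := hne hw j
      field_simp
      ring
    rw [Finset.sum_congr rfl fun j _ => e1 j, Finset.sum_add_distrib, Finset.sum_sub_distrib,
      ← Finset.sum_mul, phaseDeriv, phaseDeriv, curvature, stieltjes, stieltjes]
    ring
  have hκ : 0 ≤ κ := (norm_nonneg _).trans hzκ
  rw [e]
  refine norm_average_le (by positivity) fun j => ?_
  rw [norm_mul]
  gcongr
  refine (norm_add_le _ _).trans ?_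
  have h1 := hle hz₀ j
  have h2 := hle hz j
  have h3 := hle hw j
  have h4 : ‖1 / (z₀ - (y j : ℂ)) ^ 2‖ = ‖1 / (z₀ - (y j : ℂ))‖ ^ 2 := by
    rw [← norm_pow, div_pow, one_pow]
  rw [norm_mul, norm_mul, norm_mul, norm_mul, norm_mul, h4]
  calc _ ≤ κ * ((1 / η) ^ 2 * (1 / η)) + κ * (1 / η * (1 / η) * (1 / η)) := by gcongr
    _ = _ := by field_simp; ring

/-- At an approximate saddle point the real part of the curvature is bounded below. -/
theorem le_curvature_re_of_norm_phaseDeriv_le (hN : 1 ≤ N) (ha : 0 < a) {z : ℂ} {Y e : ℝ}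
    (hY : 0 < Y) (hz : Y ≤ z.im) (he : ‖phaseDeriv a u y z‖ ≤ e) (he1 : e ≤ Y / (2 * a ^ 2))
    (he2 : e ≤ Y ^ 3 / (4 * a ^ 4)) : Y ^ 2 / (4 * a ^ 4) ≤ (curvature a y z).re := by
  set D := 1 / (N : ℝ) * ∑ j, 1 / normSq (z - y j) with hD
  have hz0 : 0 < z.im := by linarith
  have him : (phaseDeriv a u y z).im = z.im * (1 / a ^ 2 - D) := by
    rw [phaseDeriv, add_im, stieltjes_im, ← ofReal_pow, div_ofReal_im, ← hD]
    simp
    ring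
  have h1 : Y * |1 / a ^ 2 - D| ≤ e := by
    calc _ ≤ z.im * |1 / a ^ 2 - D| := by gcongr
      _ = |(phaseDeriv a u y z).im| := by rw [him, abs_mul, abs_of_pos hz0]
      _ ≤ e := (abs_im_le_norm _).trans he
  have h2 : |1 / a ^ 2 - D| ≤ 1 / (2 * a ^ 2) := by
    apply le_of_mul_le_mul_left _ hY
    refine (h1.trans he1).trans (le_of_eq (by ring))
  have h3 : |1 / a ^ 2 - D| ≤ Y ^ 2 / (4 * a ^ 4) := by
    apply le_of_mul_le_mul_left _ hY
    refine (h1.trans he2).trans (le_of_eq (by ring))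
  have h4 : 1 / (2 * a ^ 2) ≤ D := by
    have : 1 / a ^ 2 = 1 / (2 * a ^ 2) + 1 / (2 * a ^ 2) := by field_simp; ring
    linarith [(abs_le.mp h2).2]
  have h5 := average_sq_le hN fun j => 1 / normSq (z - y j)
  rw [← hD] at h5
  rw [curvature_re z hz0.ne', ← hD]
  have h6 : 2 * Y ^ 2 * (1 / (2 * a ^ 2)) ^ 2 ≤
      2 * z.im ^ 2 * (1 / (N : ℝ) * ∑ j, (1 / normSq (z - y j)) ^ 2) := by
    have : (1 / (2 * a ^ 2)) ^ 2 ≤ D ^ 2 := by gcongr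
    have := this.trans h5
    gcongr
  have h7 : 2 * Y ^ 2 * (1 / (2 * a ^ 2)) ^ 2 = Y ^ 2 / (4 * a ^ 4) + Y ^ 2 / (4 * a ^ 4) := by
    field_simp; ring
  linarith [(abs_le.mp h3).1]

/-- A quantitative inverse function theorem: near an approximate saddle point there is a saddle
point. -/
theorem exists_phaseDeriv_eq_zero (hN : 1 ≤ N) (ha : 0 < a) {z : ℂ} {Y e : ℝ}
    (hY : 0 < Y) (hz : Y ≤ z.im) (he : ‖phaseDeriv a u y z‖ ≤ e) (he1 : e ≤ Y / (2 * a ^ 2))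
    (he2 : e ≤ Y ^ 3 / (4 * a ^ 4)) (he3 : 8 * a ^ 4 / Y ^ 2 * e ≤ Y / 2)
    (he4 : 8 * a ^ 4 / Y ^ 2 * e ≤ Y ^ 5 / (128 * a ^ 4)) :
    ∃ p : ℂ, phaseDeriv a u y p = 0 ∧ ‖p - z‖ ≤ 8 * a ^ 4 / Y ^ 2 * e := by
  have hcurv := le_curvature_re_of_norm_phaseDeriv_le hN ha hY hz he he1 he2
  set c := Y ^ 2 / (4 * a ^ 4) with hc
  have hc0 : 0 < c := by positivity
  set κ := 8 * a ^ 4 / Y ^ 2 * e with hκ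
  have he0 : 0 ≤ e := (norm_nonneg _).trans he
  have hκ0 : 0 ≤ κ := by positivity
  set L := curvature a y z with hL
  have hLc : c ≤ ‖L‖ := hcurv.trans (re_le_norm L)
  have hL0 : L ≠ 0 := by rintro h; rw [h, norm_zero] at hLc; linarith
  have him : ∀ x ∈ Metric.closedBall z κ, Y / 2 ≤ x.im := by
    intro x hx
    rw [Metric.mem_closedBall, dist_eq_norm] at hx
    have := (abs_le.mp ((abs_im_le_norm (x - z)).trans hx)).1
    rw [sub_im] at this
    linarith
  have happrox : ApproximatesLinearOn (phaseDeriv a u y)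
      (ContinuousLinearMap.mul ℂ ℂ L) (Metric.closedBall z κ) ⟨c / 2, by positivity⟩ := by
    intro x hx x' hx'
    have h1 := norm_phaseDeriv_sub_le (a := a) (u := u) (y := y) (κ := κ) (by positivity : 0 < Y / 2)
      (by linarith : Y / 2 ≤ z.im)
      (him x hx) (him x' hx') (by rwa [Metric.mem_closedBall, dist_eq_norm] at hx)
      (by rwa [Metric.mem_closedBall, dist_eq_norm] at hx')
    rw [ContinuousLinearMap.mul_apply']
    refine h1.trans ?_
    gcongr
    change _ ≤ c / 2
    rw [div_le_iff₀ (by positivity), hc]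
    have : Y ^ 2 / (4 * a ^ 4) / 2 * (Y / 2) ^ 3 = 2 * (Y ^ 5 / (128 * a ^ 4)) := by
      field_simp; norm_num
    rw [this]
    linarith
  have hsurj := happrox.surjOn_closedBall_of_nonlinearRightInverse
    { toFun := fun w => w / L
      nnnorm := ‖L‖₊⁻¹
      bound' := fun w => by
        rw [norm_div, div_eq_inv_mul]; simp
      right_inv' := fun w => by
        rw [ContinuousLinearMap.mul_apply']; field_simp } hκ0 subset_rfl
  have hmem : (0 : ℂ) ∈ Metric.closedBall (phaseDeriv a u y z)
      (((‖L‖₊⁻¹ : NNReal) : ℝ)⁻¹ * κ - c / 2 * κ) := by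
    rw [Metric.mem_closedBall, dist_eq_norm, zero_sub, norm_neg]
    simp only [NNReal.coe_inv, coe_nnnorm, inv_inv]
    have : e = c / 2 * κ := by rw [hc, hκ]; field_simp; ring
    have h2 : c * κ ≤ ‖L‖ * κ := by gcongr
    linarith
  rw [← sub_mul] at hmem
  obtain ⟨p, hp, h0⟩ := hsurj hmem
  refine ⟨p, h0, ?_⟩
  rwa [Metric.mem_closedBall, dist_eq_norm] at hp

/-- Near a saddle point the real part of the phase derivative grows linearly. -/
theorem phaseDeriv_re_near (hN : 1 ≤ N) (ha : 0 < a) {p : ℂ} {Y : ℝ} (hY : 0 < Y) (hp : Y ≤ p.im)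
    (h : phaseDeriv a u y p = 0) {r : ℝ} (hr : |r| ≤ Y ^ 5 / (2 * a ^ 4)) :
    Y ^ 2 / a ^ 4 * r ^ 2 ≤ r * (phaseDeriv a u y (p + r)).re := by
  have h1 := norm_phaseDeriv_sub_le (a := a) (u := u) (y := y) hY hp
    (by simpa using hp : Y ≤ (p + (r : ℂ)).im) hp (κ := |r|) (by simp) (by simp)
  rw [h, sub_zero, add_sub_cancel_left, norm_real, Real.norm_eq_abs] at h1
  have h2 := (abs_le.mp ((abs_re_le_norm _).trans h1))
  rw [sub_re, re_mul_ofReal] at h2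
  have h3 := le_curvature_re hN (by linarith) h
  have h4 : 2 * Y ^ 2 / a ^ 4 ≤ 2 * p.im ^ 2 / a ^ 4 := by gcongr
  have h5 : 2 * |r| / Y ^ 3 * |r| ≤ Y ^ 2 / a ^ 4 * |r| := by
    refine mul_le_mul_of_nonneg_right ?_ (abs_nonneg r)
    rw [div_le_iff₀ (by positivity)]
    calc _ ≤ 2 * (Y ^ 5 / (2 * a ^ 4)) := by gcongr
      _ = _ := by field_simp
  have h6 : |r * (phaseDeriv a u y (p + r)).re - (curvature a y p).re * r ^ 2| ≤
      Y ^ 2 / a ^ 4 * r ^ 2 := by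
    have e : r * (phaseDeriv a u y (p + r)).re - (curvature a y p).re * r ^ 2 =
        r * ((phaseDeriv a u y (p + r)).re - (curvature a y p).re * r) := by ring
    rw [e, abs_mul, ← sq_abs r]
    calc _ ≤ |r| * (Y ^ 2 / a ^ 4 * |r|) := by
          gcongr
          exact (abs_le.mpr h2).trans h5
      _ = _ := by ring
  have h7 : 2 * Y ^ 2 / a ^ 4 * r ^ 2 ≤ (curvature a y p).re * r ^ 2 := by
    gcongr; linarith
  have h8 : 2 * Y ^ 2 / a ^ 4 * r ^ 2 = Y ^ 2 / a ^ 4 * r ^ 2 + Y ^ 2 / a ^ 4 * r ^ 2 := by ring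
  linarith [(abs_le.mp h6).1]

/-- Far away the linear term `r / a²` of the phase derivative dominates. -/
theorem phaseDeriv_re_far (ha : 0 < a) {p : ℂ} {Y : ℝ} (hY : 0 < Y) (hp : Y ≤ p.im)
    (h : phaseDeriv a u y p = 0) {r : ℝ} (hr : 4 * a ^ 2 / Y ≤ |r|) :
    1 / (2 * a ^ 2) * r ^ 2 ≤ r * (phaseDeriv a u y (p + r)).re := by
  have e : phaseDeriv a u y (p + r) =
      ((r / a ^ 2 : ℝ) : ℂ) + (stieltjes y (p + r) - stieltjes y p) := by
    rw [phaseDeriv] at h ⊢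
    push_cast
    linear_combination h
  have h1 : |(stieltjes y (p + r) - stieltjes y p).re| ≤ 1 / Y + 1 / Y :=
    (abs_re_le_norm _).trans ((norm_sub_le _ _).trans (add_le_add
      (norm_stieltjes_le hY (by simpa using hp.trans (le_abs_self _)))
      (norm_stieltjes_le hY (hp.trans (le_abs_self _)))))
  rw [e, add_re, ofReal_re, mul_add]
  have h2 : |r * (stieltjes y (p + r) - stieltjes y p).re| ≤ 1 / (2 * a ^ 2) * r ^ 2 := by
    rw [abs_mul, ← sq_abs r]
    calc _ ≤ |r| * (1 / Y + 1 / Y) := by gcongr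
      _ = |r| * (1 / (2 * a ^ 2) * (4 * a ^ 2 / Y)) := by field_simp; ring
      _ ≤ |r| * (1 / (2 * a ^ 2) * |r|) := by gcongr
      _ = _ := by ring
  have h3 : r * (r / a ^ 2) = 1 / (2 * a ^ 2) * r ^ 2 + 1 / (2 * a ^ 2) * r ^ 2 := by
    field_simp; ring
  linarith [(abs_le.mp h2).1]

end

/-- For empirical Stieltjes transforms close to that of the semicircle law there is a saddle point
close to the limiting one, at which the phase grows along the horizontal line. The growth is read
off from the curvature near the saddle point, from the limiting phase at intermediate distances and
from the quadratic term of the phase at large distances. -/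
theorem exists_saddle {a : ℝ} (ha : 0 < a) :
    ∃ R > 0, ∃ η > 0, ∃ e₀ > 0, ∃ Y > 0, ∃ c > 0, c ≤ Y ^ 2 / (16 * a ^ 4) ∧ ∃ k > 0,
      ∀ (N : ℕ) (y : Fin N → ℝ) (u v ε : ℝ), 1 ≤ N → |u| ≤ Real.sqrt (1 / 2 + 2 * a ^ 2) →
        (∀ z : ℂ, |z.re| ≤ R - η → 2 * η ≤ z.im → z.im ≤ R - η →
          ‖stieltjes y z - semicircleStieltjes z‖ ≤ ε) →
        |u - v| / a ^ 2 + ε ≤ e₀ →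
        ∃ p : ℂ, Y ≤ p.im ∧ phaseDeriv a v y p = 0 ∧
          ‖p - limitSaddle a u‖ ≤ k * (|u - v| / a ^ 2 + ε) ∧
          ∀ r : ℝ, 4 * c * r ^ 2 ≤ r * (phaseDeriv a v y (p + r)).re := by
  set b := 1 + 4 * a ^ 2 with hb
  set Y₁ := a ^ 2 / b with hY₁
  have hb0 : 0 < b := by positivity
  have hY₁0 : 0 < Y₁ := by positivity
  set Y := Y₁ / 2 with hYdef
  have hY0 : 0 < Y := by positivity
  set δ := Y ^ 5 / (2 * a ^ 4) with hδ
  set R₁ := 4 * a ^ 2 / Y with hR₁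
  have hR₁0 : 0 < R₁ := by positivity
  obtain ⟨m, hm, hmid⟩ := exists_le_limitPhaseDeriv_re ha δ R₁ (by positivity)
  set k := 8 * a ^ 4 / Y₁ ^ 2 with hk
  have hk0 : 0 < k := by positivity
  set M := k * (1 / a ^ 2 + 1 / Y ^ 2) + 1 with hM
  have hM0 : 0 < M := by positivity
  -- the first four bounds give the saddle point, the last one the growth at middle distances
  set e₀ := min (min (Y₁ / (2 * a ^ 2)) (Y₁ ^ 3 / (4 * a ^ 4)))
    (min (min (Y / k) (Y₁ ^ 5 / (128 * a ^ 4) / k)) (m / (2 * R₁ * M))) with he₀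
  set c := min (min (Y ^ 2 / a ^ 4) (1 / (2 * a ^ 2)))
    (min (m / (2 * R₁ ^ 2)) (Y ^ 2 / (4 * a ^ 4))) / 4 with hc
  have hc1 : 4 * c ≤ Y ^ 2 / a ^ 4 := by
    rw [hc, mul_div_cancel₀ _ (by norm_num)]; exact (min_le_left _ _).trans (min_le_left _ _)
  have hc2 : 4 * c ≤ 1 / (2 * a ^ 2) := by
    rw [hc, mul_div_cancel₀ _ (by norm_num)]; exact (min_le_left _ _).trans (min_le_right _ _)
  have hc3 : 4 * c ≤ m / (2 * R₁ ^ 2) := by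
    rw [hc, mul_div_cancel₀ _ (by norm_num)]; exact (min_le_right _ _).trans (min_le_left _ _)
  have hc4 : 4 * c ≤ Y ^ 2 / (4 * a ^ 4) := by
    rw [hc, mul_div_cancel₀ _ (by norm_num)]; exact (min_le_right _ _).trans (min_le_right _ _)
  -- the domain has to contain the horizontal segments of length `2 R₁` around limiting saddle points
  refine ⟨b + R₁ + Y₁ / 4, by positivity, Y₁ / 4, by positivity, e₀, by positivity, Y, hY0, c,
    by positivity, ?_, k, hk0, ?_⟩
  · have : Y ^ 2 / (4 * a ^ 4) = 4 * (Y ^ 2 / (16 * a ^ 4)) := by field_simp; norm_num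
    linarith
  intro N y u v ε hN hu hS he
  rw [add_sub_cancel_right] at hS
  set e := |u - v| / a ^ 2 + ε with hedef
  set z₀ := limitSaddle a u with hz₀
  have hz₀im : Y₁ ≤ z₀.im := le_limitSaddle_im ha hu
  have hz₀norm : ‖z₀‖ ≤ b := norm_limitSaddle_le hu
  have hSr : ∀ r : ℝ, |r| ≤ R₁ →
      ‖stieltjes y (z₀ + r) - semicircleStieltjes (z₀ + r)‖ ≤ ε := by
    intro r hr
    have h1 := (abs_re_le_norm z₀).trans hz₀norm
    have h2 := (im_le_norm z₀).trans hz₀norm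
    apply hS
    · rw [add_re, ofReal_re]; exact (abs_add_le _ _).trans (add_le_add h1 hr)
    · rw [add_im, ofReal_im]; linarith
    · rw [add_im, ofReal_im]; linarith
  have hε0 : 0 ≤ ε := (norm_nonneg _).trans (hSr 0 (by simpa using hR₁0.le))
  have he0 : 0 ≤ e := by positivity
  have hεe : |u - v| / a ^ 2 + ε ≤ e := le_rfl
  have hphase : ‖phaseDeriv a v y z₀‖ ≤ e := by
    have h0 := limitPhaseDeriv_limitSaddle ha hu
    have h1 := hSr 0 (by simpa using hR₁0.le)
    rw [ofReal_zero, add_zero] at h1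
    have e1 : phaseDeriv a v y z₀ = ((u - v : ℝ) : ℂ) / (a : ℂ) ^ 2 +
        (stieltjes y z₀ - semicircleStieltjes z₀) := by
      rw [limitPhaseDeriv] at h0
      rw [phaseDeriv]
      push_cast
      linear_combination h0
    rw [e1]
    refine (norm_add_le _ _).trans (add_le_add (le_of_eq ?_) h1)
    rw [norm_div, norm_real, Real.norm_eq_abs, norm_pow, norm_real, Real.norm_of_nonneg ha.le]
  have he1 : e ≤ Y₁ / (2 * a ^ 2) := he.trans ((min_le_left _ _).trans (min_le_left _ _))
  have he2 : e ≤ Y₁ ^ 3 / (4 * a ^ 4) := he.trans ((min_le_left _ _).trans (min_le_right _ _))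
  have he3 : k * e ≤ Y := by
    rw [← le_div_iff₀' hk0]
    exact he.trans ((min_le_right _ _).trans ((min_le_left _ _).trans (min_le_left _ _)))
  have he4 : k * e ≤ Y₁ ^ 5 / (128 * a ^ 4) := by
    rw [← le_div_iff₀' hk0]
    exact he.trans ((min_le_right _ _).trans ((min_le_left _ _).trans (min_le_right _ _)))
  have he5 : M * e ≤ m / (2 * R₁) := by
    have : e ≤ m / (2 * R₁ * M) := he.trans ((min_le_right _ _).trans (min_le_right _ _))
    calc _ ≤ M * (m / (2 * R₁ * M)) := by gcongr
      _ = _ := by field_simp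
  obtain ⟨p, hp0, hpz⟩ := exists_phaseDeriv_eq_zero hN ha hY₁0 hz₀im hphase he1 he2 he3 he4
  have hpim : Y ≤ p.im := by
    have := (abs_le.mp ((abs_im_le_norm (p - z₀)).trans (hpz.trans he3))).1
    rw [sub_im] at this
    linarith
  refine ⟨p, hpim, hp0, hpz, fun r => ?_⟩
  rcases le_total |r| δ with h1 | h1
  · refine le_trans ?_ (phaseDeriv_re_near hN ha hY0 hpim hp0 h1)
    gcongr
  rcases le_total R₁ |r| with h2 | h2
  · refine le_trans ?_ (phaseDeriv_re_far ha hY0 hpim hp0 h2)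
    gcongr
  have h3 := hmid u hu r h1 h2
  have h4 : ‖phaseDeriv a v y (p + r) - limitPhaseDeriv a u (z₀ + r)‖ ≤ m / (2 * R₁) := by
    have e1 : phaseDeriv a v y (p + r) - limitPhaseDeriv a u (z₀ + r) =
        (p - z₀) / (a : ℂ) ^ 2 + (stieltjes y (p + r) - stieltjes y (z₀ + r)) +
        (((u - v : ℝ) : ℂ) / (a : ℂ) ^ 2 +
          (stieltjes y (z₀ + r) - semicircleStieltjes (z₀ + r))) := by
      rw [phaseDeriv, limitPhaseDeriv]
      push_cast
      ring
    have h5 : ‖stieltjes y (p + r) - stieltjes y (z₀ + r)‖ ≤ 1 / Y ^ 2 * ‖p - z₀‖ := by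
      have := norm_stieltjes_sub_le (y := y) hY0 (by simpa using hpim : Y ≤ (p + (r : ℂ)).im)
        (by simp; linarith : Y ≤ (z₀ + (r : ℂ)).im)
      rwa [add_sub_add_right_eq_sub] at this
    have h6 : ‖((u - v : ℝ) : ℂ) / (a : ℂ) ^ 2‖ = |u - v| / a ^ 2 := by
      rw [norm_div, norm_real, Real.norm_eq_abs, norm_pow, norm_real, Real.norm_of_nonneg ha.le]
    have h7 : ‖(p - z₀) / (a : ℂ) ^ 2‖ = 1 / a ^ 2 * ‖p - z₀‖ := by
      rw [norm_div, norm_pow, norm_real, Real.norm_of_nonneg ha.le]; ring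
    rw [e1]
    calc _ ≤ (1 / a ^ 2 * ‖p - z₀‖ + 1 / Y ^ 2 * ‖p - z₀‖) + (|u - v| / a ^ 2 + ε) := by
          refine (norm_add_le _ _).trans (add_le_add ((norm_add_le _ _).trans
            (add_le_add h7.le h5)) ((norm_add_le _ _).trans (add_le_add h6.le (hSr r h2))))
      _ ≤ (1 / a ^ 2 * (k * e) + 1 / Y ^ 2 * (k * e)) + e := by gcongr
      _ = M * e := by rw [hM]; ring
      _ ≤ _ := he5
  have h5 := (abs_re_le_norm _).trans h4
  rw [sub_re] at h5
  have h6 : |r * ((phaseDeriv a v y (p + r)).re - (limitPhaseDeriv a u (z₀ + r)).re)| ≤ m / 2 := by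
    rw [abs_mul]
    calc _ ≤ R₁ * (m / (2 * R₁)) := by gcongr
      _ = _ := by field_simp
  have h7 : 4 * c * r ^ 2 ≤ m / 2 := by
    calc _ ≤ m / (2 * R₁ ^ 2) * R₁ ^ 2 := by
          rw [← sq_abs r]; gcongr
      _ = _ := by field_simp
  rw [mul_sub] at h6
  linarith [(abs_le.mp h6).1]

/-! ### A crude bound for a fixed number of particles -/

section

variable {κ S B u v : ℝ} {N : ℕ}

/-- A bound of the integrand that does not depend on the starting points. -/
theorem norm_kernel_integrand_le (hκ : 0 < κ) (hS : 0 < S) (hu : |u| ≤ B) (hv : |v| ≤ B)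
    (y : Fin N → ℝ) (s : ℝ) {z : ℂ} (hz : |z.im| = κ) :
    ‖kernelFactor S u v z * (I * s + z - v - S * ∑ j, (y j : ℂ) / ((I * s - y j) * (z - y j))) *
        (∏ j, (I * s - y j) / (z - y j)) *
        exp (((I * s) ^ 2 - 2 * v * (I * s) - z ^ 2 + 2 * u * z) / (2 * S))‖ ≤
      1 / S ^ 2 * Real.exp (2 * B / S * κ + κ + B + S * N / κ + N + κ ^ 2 / (2 * S)) *
        (Real.exp ((3 * B / S + 1 + N / κ) * |z.re|) * Real.exp (-(1 / (2 * S)) * z.re ^ 2)) *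
        (Real.exp ((3 * B / S + 1 + N / κ) * |s|) * Real.exp (-(1 / (2 * S)) * s ^ 2)) := by
  have hB : 0 ≤ B := (abs_nonneg u).trans hu
  have hzim : z.im ≠ 0 := by intro h; rw [h, abs_zero] at hz; linarith
  have hz0 : z ≠ 0 := by rintro rfl; exact hzim rfl
  have hzn : ‖z‖ ≤ |z.re| + κ := hz ▸ norm_le_abs_re_add_abs_im z
  have hws : ‖I * (s : ℂ)‖ = |s| := by rw [norm_mul, norm_I, one_mul, norm_real, Real.norm_eq_abs]
  have h1 : ‖kernelFactor S u v z‖ ≤ 1 / S ^ 2 * Real.exp (2 * B / S * (|z.re| + κ)) := by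
    rw [kernelFactor_eq hS rfl hz0, norm_mul, norm_neg, norm_div, norm_one, norm_pow, norm_real,
      Real.norm_of_nonneg hS.le]
    gcongr
    refine (norm_expQuot_le _).trans (Real.exp_le_exp.mpr ?_)
    rw [norm_mul, norm_real, Real.norm_eq_abs, abs_div, abs_of_pos hS]
    have : |v - u| ≤ 2 * B := (abs_sub _ _).trans (by linarith)
    gcongr
  have h2 : ‖I * (s : ℂ) + z - v - S * ∑ j, (y j : ℂ) / ((I * s - y j) * (z - y j))‖ ≤
      Real.exp (|s| + |z.re| + κ + B + S * N / κ) := by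
    have hsum : ‖∑ j, (y j : ℂ) / ((I * s - y j) * (z - y j))‖ ≤ N * (1 / κ) := by
      have : ∀ j ∈ Finset.univ, ‖(y j : ℂ) / ((I * s - y j) * (z - y j))‖ ≤ 1 / κ := by
        intro j _
        -- the distance from the imaginary axis to `y j` is `|y j|`
        have e1 : ‖(y j : ℂ) / (I * s - y j)‖ ≤ 1 := by
          rw [norm_div, norm_real, Real.norm_eq_abs]
          apply div_le_one_of_le₀ _ (norm_nonneg _)
          simpa using abs_re_le_norm (I * (s : ℂ) - y j)
        have e2 : (y j : ℂ) / ((I * s - y j) * (z - y j)) =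
            (y j : ℂ) / (I * s - y j) * (1 / (z - y j)) := by
          rw [div_mul_div_comm, mul_one]
        rw [e2, norm_mul]
        calc _ ≤ 1 * (1 / κ) := by
              gcongr
              exact norm_one_div_sub_ofReal_le hκ hz.ge _
          _ = _ := one_mul _
      simpa using norm_sum_le_of_le _ this
    refine le_trans ?_ ((le_add_of_nonneg_right zero_le_one).trans (Real.add_one_le_exp _))
    refine (norm_sub_le _ _).trans (add_le_add ((norm_sub_le _ _).trans (add_le_add
      ((norm_add_le _ _).trans ?_) ?_)) ?_)
    · rw [hws]; linarith
    · rwa [norm_real, Real.norm_eq_abs]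
    · rw [norm_mul, norm_real, Real.norm_of_nonneg hS.le]
      calc _ ≤ S * (N * (1 / κ)) := by gcongr
        _ = _ := by ring
  have h3 : ‖∏ j, (I * s - (y j : ℂ)) / (z - y j)‖ ≤
      Real.exp (N * ((|s| + |z.re| + κ) / κ)) := by
    rw [norm_prod, Real.exp_nat_mul]
    refine (Finset.prod_le_prod (g := fun _ => Real.exp ((|s| + |z.re| + κ) / κ))
      (fun j _ => norm_nonneg _) fun j _ => ?_).trans (by simp)
    have e1 : (I * s - (y j : ℂ)) / (z - y j) = 1 + (I * s - z) * (1 / (z - y j)) := by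
      have := sub_ofReal_ne_zero hzim (y j)
      field_simp
      ring
    rw [e1]
    refine le_trans ?_ (Real.add_one_le_exp _)
    rw [add_comm]
    refine (norm_add_le _ _).trans (add_le_add ?_ (by simp))
    rw [norm_mul, div_eq_mul_one_div _ κ]
    have e2 := norm_one_div_sub_ofReal_le hκ hz.ge (y j)
    have e3 : ‖I * s - z‖ ≤ |s| + |z.re| + κ := (norm_sub_le _ _).trans (by rw [hws]; linarith)
    gcongr
  have h4 : ‖exp (((I * s) ^ 2 - 2 * v * (I * s) - z ^ 2 + 2 * u * z) / (2 * S))‖ ≤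
      Real.exp (-(1 / (2 * S)) * s ^ 2 + -(1 / (2 * S)) * z.re ^ 2 + κ ^ 2 / (2 * S) +
        B / S * |z.re|) := by
    rw [norm_exp]
    apply Real.exp_le_exp.mpr
    have e1 : (((I * (s : ℂ)) ^ 2 - 2 * v * (I * s) - z ^ 2 + 2 * u * z) / (2 * S)).re =
        (-s ^ 2 - z.re ^ 2 + z.im ^ 2 + 2 * (u * z.re)) / (2 * S) := by
      rw [show (2 * S : ℂ) = ((2 * S : ℝ) : ℂ) by push_cast; rfl, div_ofReal_re]
      congr 1
      simp [pow_two]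
      ring
    rw [e1, ← sq_abs z.im, hz]
    have e2 : u * z.re ≤ B * |z.re| := (le_abs_self _).trans (by rw [abs_mul]; gcongr)
    calc _ ≤ (-s ^ 2 - z.re ^ 2 + κ ^ 2 + 2 * (B * |z.re|)) / (2 * S) := by gcongr
      _ = _ := by field_simp; ring
  rw [norm_mul, norm_mul, norm_mul]
  calc _ ≤ 1 / S ^ 2 * Real.exp (2 * B / S * (|z.re| + κ)) *
        Real.exp (|s| + |z.re| + κ + B + S * N / κ) *
        Real.exp (N * ((|s| + |z.re| + κ) / κ)) *
        Real.exp (-(1 / (2 * S)) * s ^ 2 + -(1 / (2 * S)) * z.re ^ 2 + κ ^ 2 / (2 * S) +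
        B / S * |z.re|) := by gcongr
    _ = 1 / S ^ 2 * Real.exp (2 * B / S * (|z.re| + κ) +
        (|s| + |z.re| + κ + B + S * N / κ) + (N * ((|s| + |z.re| + κ) / κ)) +
        (-(1 / (2 * S)) * s ^ 2 + -(1 / (2 * S)) * z.re ^ 2 + κ ^ 2 / (2 * S) +
        B / S * |z.re|)) := by
      simp only [mul_assoc, ← Real.exp_add]
    _ ≤ 1 / S ^ 2 * Real.exp ((2 * B / S * κ + κ + B + S * N / κ + N + κ ^ 2 / (2 * S)) +
        (((3 * B / S + 1 + N / κ) * |z.re|) + (-(1 / (2 * S)) * z.re ^ 2)) +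
        (((3 * B / S + 1 + N / κ) * |s|) + (-(1 / (2 * S)) * s ^ 2))) := by
      refine mul_le_mul_of_nonneg_left (Real.exp_le_exp.mpr ?_) (by positivity)
      have e1 : 0 ≤ 3 * B / S * |s| := by positivity
      have e2 : N * ((|s| + |z.re| + κ) / κ) = N / κ * |s| + N / κ * |z.re| + N := by
        field_simp
      have e3 : 3 * B / S = 2 * B / S + B / S := by ring
      rw [e2]
      rw [e3] at e1 ⊢
      linarith
    _ = _ := by
      simp only [mul_assoc, ← Real.exp_add]

theorem integrable_exp_linear_mul_gaussian {c : ℝ} (hc : 0 < c) {A : ℝ} (hA : 0 ≤ A) :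
    Integrable fun t : ℝ => Real.exp (A * |t|) * Real.exp (-c * t ^ 2) := by
  refine (Integrable.const_mul (integrable_exp_neg_mul_sq (half_pos hc))
    (Real.exp (A ^ 2 / (c / 2)))).mono' (Continuous.aestronglyMeasurable (by fun_prop))
    (ae_of_all _ fun t => ?_)
  have h := exp_linear_mul_gaussian_le hA (half_pos hc) (le_refl (1 : ℝ)) t
  rw [Real.norm_of_nonneg (by positivity)]
  simpa [mul_div_cancel₀] using h

/-- For fixed `N` the kernel is bounded uniformly in the starting points. -/
theorem exists_norm_kernel_le (hκ : 0 < κ) (hS : 0 < S) (B : ℝ) (N : ℕ) :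
    ∃ C : ℝ, ∀ (y : Fin N → ℝ) (u v : ℝ), |u| ≤ B → |v| ≤ B → ‖kernel κ S y u v‖ ≤ C := by
  rcases lt_or_ge B 0 with hB | hB
  · exact ⟨0, fun y u v hu => absurd ((abs_nonneg u).trans hu) (not_le.mpr hB)⟩
  set Q := 3 * B / S + 1 + N / κ with hQ
  set E := 1 / S ^ 2 * Real.exp (2 * B / S * κ + κ + B + S * N / κ + N + κ ^ 2 / (2 * S)) with hE
  set g : ℝ → ℝ := fun t => Real.exp (Q * |t|) * Real.exp (-(1 / (2 * S)) * t ^ 2) with hg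
  have hgi : Integrable g := integrable_exp_linear_mul_gaussian (by positivity) (by positivity)
  set J := ∫ t, g t with hJ
  refine ⟨Real.exp (B ^ 2 / (2 * S)) / ‖(2 * Real.pi * I : ℂ) ^ 2‖ * (E * J * J + E * J * J),
    fun y u v hu hv => ?_⟩
  have hexp : ‖exp (((v : ℂ) ^ 2 - (u : ℂ) ^ 2) / (2 * S))‖ ≤ Real.exp (B ^ 2 / (2 * S)) := by
    rw [norm_exp]
    apply Real.exp_le_exp.mpr
    have : ((v : ℂ) ^ 2 - (u : ℂ) ^ 2) / (2 * S) = (((v ^ 2 - u ^ 2) / (2 * S) : ℝ) : ℂ) := by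
      push_cast; rfl
    rw [this, ofReal_re]
    have : v ^ 2 ≤ B ^ 2 := by rw [← sq_abs v]; gcongr
    gcongr
    nlinarith [sq_nonneg u]
  have hinner : ∀ z : ℂ, |z.im| = κ → ‖integralVertical fun w =>
      kernelFactor S u v z *
        (w + z - v - S * ∑ j, (y j : ℂ) / ((w - y j) * (z - y j))) *
        (∏ j, (w - y j) / (z - y j)) *
        exp ((w ^ 2 - 2 * v * w - z ^ 2 + 2 * u * z) / (2 * S))‖ ≤ E * J * g z.re := by
    intro z hz
    refine (norm_integral_le_of_norm_le (hgi.const_mul (E * g z.re)) (ae_of_all _ fun s => ?_)).trans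
      (le_of_eq ?_)
    · rw [norm_mul, norm_I, mul_one]
      exact norm_kernel_integrand_le hκ hS hu hv y s hz
    · rw [integral_const_mul]; ring
  rw [kernel, norm_mul, norm_div]
  have hJ0 : 0 ≤ J := integral_nonneg fun t => by positivity
  have hE0 : 0 ≤ E := by positivity
  have hgc : Integrable fun t => E * J * g t := hgi.const_mul _
  gcongr
  rw [integralGamma]
  refine (norm_add_le _ _).trans (add_le_add ?_ ?_)
  · refine (norm_integral_le_of_norm_le hgc (ae_of_all _ fun t => ?_)).trans
      (le_of_eq (integral_const_mul _ _))
    rw [norm_mul, norm_neg, norm_one, mul_one]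
    refine (hinner _ (by simp [abs_of_pos hκ])).trans (le_of_eq ?_)
    simp [hg]
  · refine (norm_integral_le_of_norm_le hgc (ae_of_all _ fun t => ?_)).trans
      (le_of_eq (integral_const_mul _ _))
    refine (hinner _ (by simp [abs_of_pos hκ])).trans (le_of_eq ?_)
    simp [hg]

end

/-! ### The rescaled kernel and its sine kernel limit -/

/-- The conjugated kernel at the local scale `1 / (N ρ(u))` around the point `u_N`. -/
def rescaledKernel (κ a u τ uN : ℝ) {N : ℕ} (y : Fin N → ℝ) : ℂ :=
  1 / ((N : ℂ) * (rho a u : ℂ)) *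
    conjKernel κ a (omegaZero a u * (N * rho a u)) y uN (uN + τ / (N * rho a u))

section

variable {a u : ℝ}

theorem rho_ge (ha : 0 < a) (hu : |u| ≤ Real.sqrt (1 / 2 + 2 * a ^ 2)) :
    1 / (Real.pi * (1 + 4 * a ^ 2)) ≤ rho a u := by
  have h := le_limitSaddle_im ha hu
  rw [limitSaddle_im] at h
  have := Real.pi_pos
  rw [div_le_iff₀ (by positivity)] at h ⊢
  nlinarith [mul_pos ha ha]

/-- The conjugation constant in terms of the limiting saddle point. -/
theorem omegaZero_eq (ha : 0 < a) (hu : |u| ≤ Real.sqrt (1 / 2 + 2 * a ^ 2)) :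
    omegaZero a u = Real.pi * (limitSaddle a u).re / (limitSaddle a u).im := by
  have hu2 := sq_le_of_abs_le hu
  rw [limitSaddle_im_eq hu, limitSaddle_re, omegaZero]
  set b := 1 + 4 * a ^ 2 with hb
  have hb0 : 0 < b := by positivity
  have hs : 0 < √b := Real.sqrt_pos.mpr hb0
  have habs : |u / √b| ≤ 1 := by
    rw [abs_div, abs_of_pos hs, div_le_one hs]
    apply Real.abs_le_sqrt; linarith
  have h2 : √(1 - (u / √b) ^ 2) = √(b - u ^ 2) / √b := by
    rw [← Real.sqrt_div' _ hb0.le, div_pow, Real.sq_sqrt hb0.le, sub_div, div_self hb0.ne']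
  have h3 : 0 < √(b - u ^ 2) := Real.sqrt_pos.mpr (by linarith)
  rw [Real.cot_eq_cos_div_sin, Real.sin_arccos, Real.cos_arccos (abs_le.mp habs).1
    (abs_le.mp habs).2, h2]
  field_simp

/-- The conjugation cancels the exponential prefactor of the kernel. -/
theorem rescaledKernel_eq_kernel (ha : 0 < a) (hu : |u| ≤ Real.sqrt (1 / 2 + 2 * a ^ 2))
    {N : ℕ} (hN : 1 ≤ N) (κ τ uN : ℝ) (y : Fin N → ℝ) :
    rescaledKernel κ a u τ uN y =
      ((Real.exp (omegaZero a u * τ) / (N * rho a u) : ℝ) : ℂ) *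
        (((Real.exp (N * (uN ^ 2 - (uN + τ / (N * rho a u)) ^ 2) / (2 * a ^ 2)) : ℝ) : ℂ) *
          kernel κ (a ^ 2 / N) y uN (uN + τ / (N * rho a u))) := by
  have hN0 : (N : ℂ) ≠ 0 := by exact_mod_cast (by omega : N ≠ 0)
  have hρ : (rho a u : ℂ) ≠ 0 := by
    have : 0 < rho a u := lt_of_lt_of_le (by have := Real.pi_pos; positivity) (rho_ge ha hu)
    exact_mod_cast this.ne'
  rw [rescaledKernel, conjKernel, exp_add]
  have e : ((omegaZero a u * (N * rho a u) : ℝ) : ℂ) *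
      (((uN + τ / (N * rho a u) : ℝ) : ℂ) - uN) = omegaZero a u * τ := by
    push_cast; field_simp; ring
  rw [e]
  push_cast
  ring

/-- The rescaled kernel through the separated integral at a point of the upper half plane. -/
theorem rescaledKernel_eq_separatedIntegral (ha : 0 < a)
    (hu : |u| ≤ Real.sqrt (1 / 2 + 2 * a ^ 2)) {κ : ℝ} (hκ : 0 < κ) {N : ℕ} (hN : 1 ≤ N)
    (τ uN : ℝ) (y : Fin N → ℝ) {p : ℂ} (hp : 0 < p.im) :
    rescaledKernel κ a u τ uN y =
      ((N * Real.exp (omegaZero a u * τ) / (4 * Real.pi ^ 2 * a ^ 4 * rho a u) : ℝ) : ℂ) *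
        separatedIntegral a uN (uN + τ / (N * rho a u)) (τ / (a ^ 2 * rho a u)) y p := by
  have hN0 : (N : ℝ) ≠ 0 := by exact_mod_cast (by omega : N ≠ 0)
  have hρ : rho a u ≠ 0 := by
    have : 0 < rho a u := lt_of_lt_of_le (by have := Real.pi_pos; positivity) (rho_ge ha hu)
    exact this.ne'
  set v := uN + τ / (N * rho a u) with hv
  have hα : τ / (a ^ 2 * rho a u) = (v - uN) / (a ^ 2 / N) := by
    rw [hv]; field_simp; ring
  rw [rescaledKernel_eq_kernel ha hu hN, ← hv, kernel_eq_separatedIntegral ha hκ hN y hα hp]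
  have e1 : ((v : ℂ) ^ 2 - (uN : ℂ) ^ 2) / (2 * ((a ^ 2 / N : ℝ) : ℂ)) =
      ((N * (v ^ 2 - uN ^ 2) / (2 * a ^ 2) : ℝ) : ℂ) := by
    push_cast
    have hN1 : (N : ℂ) ≠ 0 := by exact_mod_cast hN0
    have ha1 : (a : ℂ) ≠ 0 := by exact_mod_cast ha.ne'
    field_simp
  have e2 : N * (uN ^ 2 - v ^ 2) / (2 * a ^ 2) = -(N * (v ^ 2 - uN ^ 2) / (2 * a ^ 2)) := by ring
  have e3 : (2 * (Real.pi : ℂ) * I) ^ 2 = -(4 * Real.pi ^ 2) := by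
    rw [mul_pow, I_sq]; ring
  rw [e1, e2, e3, ← ofReal_exp, Real.exp_neg]
  have hN1 : (N : ℂ) ≠ 0 := by exact_mod_cast hN0
  have ha1 : (a : ℂ) ≠ 0 := by exact_mod_cast ha.ne'
  have hρ1 : (rho a u : ℂ) ≠ 0 := by exact_mod_cast hρ
  have hexp : ((Real.exp (N * (v ^ 2 - uN ^ 2) / (2 * a ^ 2)) : ℝ) : ℂ) ≠ 0 := by
    exact_mod_cast (Real.exp_pos _).ne'
  have hpi : (Real.pi : ℂ) ≠ 0 := by exact_mod_cast Real.pi_ne_zero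
  push_cast at hexp ⊢
  field_simp

theorem exp_neg_mul_expQuot (w : ℂ) : exp (-w) * expQuot w = expQuot (-w) := by
  by_cases hw : w = 0
  · simp [hw]
  · apply mul_left_cancel₀ hw
    have h1 := mul_expQuot w
    have h2 := mul_expQuot (-w)
    have h3 : exp (-w) * exp w = 1 := by rw [← exp_add]; simp
    linear_combination exp (-w) * h1 + h2 + h3

theorem norm_mul_expQuot_sub_le {A B α : ℝ} {p z : ℂ} (hA : |α| ≤ A) (hp : ‖p‖ ≤ B)
    (hz : ‖z‖ ≤ B) : ‖p * expQuot (-(α * p)) - z * expQuot (-(α * z))‖ ≤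
      (Real.exp (A * B) + B * A * Real.exp (3 * (A * B))) * ‖p - z‖ := by
  have hA0 : 0 ≤ A := (abs_nonneg _).trans hA
  have hB0 : 0 ≤ B := (norm_nonneg _).trans hp
  have e : p * expQuot (-(α * p)) - z * expQuot (-(α * z)) =
      (p - z) * expQuot (-(α * p)) + z * (expQuot (-(α * p)) - expQuot (-(α * z))) := by ring
  have hn : ∀ {x : ℂ}, ‖x‖ ≤ B → ‖-(α * x)‖ ≤ A * B := by
    intro x hx
    rw [norm_neg, norm_mul, norm_real, Real.norm_eq_abs]; gcongr
  have h1 : ‖expQuot (-(α * p))‖ ≤ Real.exp (A * B) :=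
    (norm_expQuot_le _).trans (Real.exp_le_exp.mpr (hn hp))
  have h2 : ‖-(α * p) - -(α * z)‖ ≤ A * ‖p - z‖ := by
    rw [← neg_sub', ← mul_sub, norm_neg, norm_mul, norm_real, Real.norm_eq_abs]; gcongr
  have h3 : ‖-(α * p) - -(α * z)‖ ≤ A * B + A * B :=
    (norm_sub_le _ _).trans (add_le_add (hn hp) (hn hz))
  rw [e]
  calc _ ≤ ‖p - z‖ * Real.exp (A * B) +
        B * (A * ‖p - z‖ * Real.exp (A * B + (A * B + A * B))) := by
        refine (norm_add_le _ _).trans (add_le_add ?_ ?_)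
        · rw [norm_mul]; gcongr
        · rw [norm_mul]
          refine mul_le_mul hz ((norm_expQuot_sub_le _ _).trans ?_) (norm_nonneg _) hB0
          have h4 := hn hz
          gcongr
    _ = _ := by
      rw [show A * B + (A * B + A * B) = 3 * (A * B) by ring]; ring

/-- At the limiting saddle point the leading term of the kernel is exactly the sine kernel. -/
theorem limitSaddle_leading_term (ha : 0 < a) (hu : |u| ≤ Real.sqrt (1 / 2 + 2 * a ^ 2)) (τ : ℝ) :
    Real.exp (omegaZero a u * τ) / (limitSaddle a u).im * (limitSaddle a u *
      expQuot (-(((τ / (a ^ 2 * rho a u) : ℝ) : ℂ) * limitSaddle a u))).im =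
      Real.sinc (Real.pi * τ) := by
  have him : 0 < (limitSaddle a u).im :=
    lt_of_lt_of_le (by positivity) (le_limitSaddle_im ha hu)
  rw [omegaZero_eq ha hu]
  have hα : τ / (a ^ 2 * rho a u) = Real.pi * τ / (limitSaddle a u).im := by
    rw [limitSaddle_im]
    have := Real.pi_ne_zero
    have : rho a u ≠ 0 := by
      rintro h; rw [limitSaddle_im, h, mul_zero] at him; exact lt_irrefl _ him
    field_simp
  rw [hα]
  set z := limitSaddle a u
  by_cases hτ : τ = 0
  · simp [hτ, expQuot_zero, him.ne']
  set α := Real.pi * τ / z.im with hαdef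
  have hα0 : α ≠ 0 := div_ne_zero (mul_ne_zero Real.pi_ne_zero hτ) him.ne'
  have h1 : α * (z * expQuot (-((α : ℂ) * z))).im = Real.exp (-(α * z.re)) * Real.sin (α * z.im) := by
    have h2 : (α : ℂ) * (z * expQuot (-(α * z))) = 1 - exp (-(α * z)) := by
      linear_combination -mul_expQuot (-(α * z))
    rw [← im_ofReal_mul, h2, sub_im, one_im, exp_im]
    simp
  have h3 : α * z.im = Real.pi * τ := by rw [hαdef]; field_simp
  have h4 : Real.pi * z.re / z.im * τ = α * z.re := by rw [hαdef]; ring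
  rw [Real.sinc_of_ne_zero (mul_ne_zero Real.pi_ne_zero hτ), h4, ← h3]
  apply mul_left_cancel₀ hα0
  have h5 : α * (Real.exp (α * z.re) / z.im * (z * expQuot (-((α : ℂ) * z))).im) =
      Real.exp (α * z.re) / z.im * (Real.exp (-(α * z.re)) * Real.sin (α * z.im)) := by
    rw [← h1]; ring
  rw [h5, Real.exp_neg]
  have := (Real.exp_pos (α * z.re)).ne'
  field_simp

end

section

variable {a u : ℝ}

theorem abs_omegaZero_mul_le (ha : 0 < a) (hu : |u| ≤ Real.sqrt (1 / 2 + 2 * a ^ 2)) {τ T : ℝ}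
    (hτ : |τ| ≤ T) :
    |omegaZero a u * τ| ≤ Real.pi * (1 + 4 * a ^ 2) / (a ^ 2 / (1 + 4 * a ^ 2)) * T := by
  have h1 := le_limitSaddle_im ha hu
  have h0 : 0 < a ^ 2 / (1 + 4 * a ^ 2) := by positivity
  have h2 := (abs_re_le_norm _).trans (norm_limitSaddle_le hu)
  have h3 := Real.pi_pos
  rw [omegaZero_eq ha hu, abs_mul, abs_div, abs_mul, abs_of_pos h3,
    abs_of_pos (h0.trans_le h1)]
  gcongr

theorem abs_div_rho_le (ha : 0 < a) (hu : |u| ≤ Real.sqrt (1 / 2 + 2 * a ^ 2)) {τ T : ℝ}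
    (hτ : |τ| ≤ T) : |τ / rho a u| ≤ T * (Real.pi * (1 + 4 * a ^ 2)) := by
  have h1 := rho_ge ha hu
  have h3 := Real.pi_pos
  have h0 : 0 < 1 / (Real.pi * (1 + 4 * a ^ 2)) := by positivity
  rw [abs_div, abs_of_pos (h0.trans_le h1)]
  calc _ ≤ T / (1 / (Real.pi * (1 + 4 * a ^ 2))) := by gcongr; exact (abs_nonneg _).trans hτ
    _ = _ := by field_simp

theorem abs_add_div_rho_le (ha : 0 < a) (hu : |u| ≤ Real.sqrt (1 / 2 + 2 * a ^ 2)) {τ T uN E : ℝ}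
    (hτ : |τ| ≤ T) (huN : |uN - u| ≤ E) {N : ℕ} (hN : 1 ≤ N) :
    |uN| ≤ Real.sqrt (1 / 2 + 2 * a ^ 2) + E + T * (Real.pi * (1 + 4 * a ^ 2)) ∧
      |uN + τ / (N * rho a u)| ≤
        Real.sqrt (1 / 2 + 2 * a ^ 2) + E + T * (Real.pi * (1 + 4 * a ^ 2)) := by
  have h1 : |uN| ≤ Real.sqrt (1 / 2 + 2 * a ^ 2) + E := by
    calc |uN| = |u + (uN - u)| := by rw [add_sub_cancel]
      _ ≤ _ := (abs_add_le _ _).trans (add_le_add hu huN)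
  have h2 := abs_div_rho_le ha hu hτ
  have h3 : |τ / (N * rho a u)| ≤ |τ / rho a u| := by
    rw [mul_comm, ← div_div, abs_div]
    apply div_le_self (abs_nonneg _)
    rw [Nat.abs_cast]; exact_mod_cast hN
  exact ⟨h1.trans (le_add_of_nonneg_right ((abs_nonneg _).trans h2)),
    (abs_add_le _ _).trans (add_le_add h1 (h3.trans h2))⟩

/-- For each fixed `N` the rescaled kernel is bounded. -/
theorem exists_norm_rescaledKernel_le (ha : 0 < a) {κ : ℝ} (hκ : 0 < κ) (T E : ℝ) {N : ℕ}
    (hN : 1 ≤ N) : ∃ D : ℝ, ∀ (y : Fin N → ℝ) (τ u uN : ℝ), |τ| ≤ T →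
      |u| ≤ Real.sqrt (1 / 2 + 2 * a ^ 2) → |uN - u| ≤ E →
      ‖rescaledKernel κ a u τ uN y‖ ≤ D := by
  have hN0 : (0 : ℝ) < N := by exact_mod_cast hN
  set B := Real.sqrt (1 / 2 + 2 * a ^ 2) + E + T * (Real.pi * (1 + 4 * a ^ 2)) with hB
  obtain ⟨C, hC⟩ := exists_norm_kernel_le hκ (by positivity : 0 < a ^ 2 / N) B N
  set W := Real.pi * (1 + 4 * a ^ 2) / (a ^ 2 / (1 + 4 * a ^ 2)) * T with hW
  refine ⟨Real.exp W / (N * (1 / (Real.pi * (1 + 4 * a ^ 2)))) *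
    (Real.exp (N * B ^ 2 / (2 * a ^ 2)) * C), fun y τ u uN hτ hu huN => ?_⟩
  obtain ⟨h1, h2⟩ := abs_add_div_rho_le ha hu hτ huN hN
  have hρ := rho_ge ha hu
  have hpi := Real.pi_pos
  have hρ0 : 0 < rho a u := lt_of_lt_of_le (by positivity) hρ
  rw [rescaledKernel_eq_kernel ha hu hN, norm_mul, norm_mul, norm_real, norm_real,
    Real.norm_of_nonneg (by positivity), Real.norm_of_nonneg (by positivity)]
  have h3 := (le_abs_self _).trans (abs_omegaZero_mul_le ha hu hτ)
  have h4 := hC y _ _ h1 h2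
  have h5 : uN ^ 2 - (uN + τ / (N * rho a u)) ^ 2 ≤ B ^ 2 := by
    have : uN ^ 2 ≤ B ^ 2 := by rw [← sq_abs uN]; gcongr
    nlinarith [sq_nonneg (uN + τ / (N * rho a u))]
  gcongr

/-- Convergence of the rescaled kernel to the sine kernel for large `N`: the saddle point is
close to its limit, and the integral is close to its leading term there. -/
theorem exists_norm_rescaledKernel_sub_le (ha : 0 < a) :
    ∃ R > 0, ∃ η > 0, ∃ e₀ > 0, ∀ (T E : ℝ), 0 ≤ T → 0 ≤ E → ∃ C : ℝ, 0 ≤ C ∧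
      ∀ (κ : ℝ), 0 < κ → ∀ (N : ℕ) (y : Fin N → ℝ) (τ u uN ε : ℝ), 1 ≤ N → |τ| ≤ T →
      |u| ≤ Real.sqrt (1 / 2 + 2 * a ^ 2) → |uN - u| ≤ E →
      (∀ z : ℂ, |z.re| ≤ R - η → 2 * η ≤ z.im → z.im ≤ R - η →
          ‖stieltjes y z - semicircleStieltjes z‖ ≤ ε) →
      |u - uN| / a ^ 2 + ε ≤ e₀ →
      ‖rescaledKernel κ a u τ uN y - (Real.sinc (Real.pi * τ) : ℂ)‖ ≤
        C * (|u - uN| / a ^ 2 + ε + 1 / √N) := by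
  obtain ⟨R, hR, η, hη, e₀, he₀, Y, hY, c, hc, hcY, k, hk, hsaddle⟩ := exists_saddle ha
  refine ⟨R, hR, η, hη, e₀, he₀, fun T E hT hE => ?_⟩
  set b := 1 + 4 * a ^ 2 with hb
  have hb0 : 0 < b := by positivity
  have hpi := Real.pi_pos
  set A := T * (Real.pi * b) / a ^ 2 with hA
  have hA0 : 0 ≤ A := by positivity
  set B := Real.sqrt (1 / 2 + 2 * a ^ 2) + E + T * (Real.pi * b) + (b + k * e₀) with hB
  have hB0 : 0 ≤ B := by positivity
  obtain ⟨C₁, hC₁, hJ⟩ := separatedIntegral_asymptotics ha hY hc hcY hA0 hB0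
  set W := Real.exp (Real.pi * b / (a ^ 2 / b) * T) with hW
  set L := Real.exp (A * B) + B * A * Real.exp (3 * (A * B)) with hL
  set D₁ := W / (4 * Real.pi ^ 2 * a ^ 4 * (1 / (Real.pi * b))) * C₁ with hD₁
  set D₂ := W / (a ^ 2 / b) * (L * k) with hD₂
  have hD₁0 : 0 ≤ D₁ := by positivity
  have hD₂0 : 0 ≤ D₂ := by positivity
  refine ⟨D₁ + D₂, by positivity, fun κ hκ N y τ u uN ε hN hτ hu huN hS he => ?_⟩
  have hN0 : (0 : ℝ) < N := by exact_mod_cast hN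
  obtain ⟨p, hpY, hp0, hpz, hgrow⟩ := hsaddle N y u uN ε hN hu hS he
  set e := |u - uN| / a ^ 2 + ε with hedef
  set z := limitSaddle a u with hz
  have hzim := le_limitSaddle_im ha hu
  have hzb : ‖z‖ ≤ b := norm_limitSaddle_le hu
  have he0 : 0 ≤ e := by
    have := (norm_nonneg _).trans hpz
    exact nonneg_of_mul_nonneg_right this hk
  obtain ⟨-, hv⟩ := abs_add_div_rho_le ha hu hτ huN hN
  have hpB : ‖p‖ ≤ B := by
    calc ‖p‖ = ‖z + (p - z)‖ := by rw [add_sub_cancel]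
      _ ≤ b + k * e₀ := (norm_add_le _ _).trans (add_le_add hzb (hpz.trans (by gcongr)))
      _ ≤ B := by rw [hB]; exact le_add_of_nonneg_left (by positivity)
  have hzB : ‖z‖ ≤ B := hzb.trans (by
    rw [hB]
    have : 0 ≤ Real.sqrt (1 / 2 + 2 * a ^ 2) + E + T * (Real.pi * b) + k * e₀ := by positivity
    linarith)
  have hvB : |uN + τ / (N * rho a u)| ≤ B := hv.trans (le_add_of_nonneg_right (by positivity))
  have hρ := rho_ge ha hu
  have hρ0 : 0 < rho a u := lt_of_lt_of_le (by positivity) hρ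
  set α := τ / (a ^ 2 * rho a u) with hα
  have hαA : |α| ≤ A := by
    have h1 := abs_div_rho_le ha hu hτ
    have h2 : α = τ / rho a u / a ^ 2 := by rw [hα]; field_simp
    rw [h2, abs_div, abs_of_pos (by positivity : 0 < a ^ 2), hA]
    gcongr
  have hαeq : α = (uN + τ / (N * rho a u) - uN) / (a ^ 2 / N) := by
    rw [hα]; field_simp; ring
  have hasymp := hJ N hN y uN _ α p hpY hp0 hgrow hpB hαA hvB hαeq
  have hω : Real.exp (omegaZero a u * τ) ≤ W :=
    Real.exp_le_exp.mpr ((le_abs_self _).trans (abs_omegaZero_mul_le ha hu hτ))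
  have hG : p * exp (-α * p) * expQuot (α * p) = p * expQuot (-(α * p)) := by
    rw [← exp_neg_mul_expQuot, neg_mul]; ring
  have hzim0 : 0 < z.im := lt_of_lt_of_le (by positivity) hzim
  set q := N * Real.exp (omegaZero a u * τ) / (4 * Real.pi ^ 2 * a ^ 4 * rho a u) with hq
  have hq0 : 0 ≤ q := by positivity
  have hlead : q * (4 * Real.pi * a ^ 2 / N * (p * exp (-α * p) * expQuot (α * p)).im) =
      Real.exp (omegaZero a u * τ) / z.im * (p * expQuot (-(α * p))).im := by
    rw [hG, hq, hz, limitSaddle_im]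
    field_simp
  have hsplit : rescaledKernel κ a u τ uN y - (Real.sinc (Real.pi * τ) : ℂ) =
      (q : ℂ) * (separatedIntegral a uN (uN + τ / (N * rho a u)) α y p -
        ((4 * Real.pi * a ^ 2 / N * (p * exp (-α * p) * expQuot (α * p)).im : ℝ) : ℂ)) +
      ((Real.exp (omegaZero a u * τ) / z.im *
        (p * expQuot (-(α * p)) - z * expQuot (-(α * z))).im : ℝ) : ℂ) := by
    rw [rescaledKernel_eq_separatedIntegral ha hu hκ hN τ uN y (hY.trans_le hpY),
      ← limitSaddle_leading_term ha hu τ, mul_sub, ← ofReal_mul, hlead, sub_im, mul_sub,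
      ofReal_sub]
    ring
  have herr₁ : ‖(q : ℂ) * (separatedIntegral a uN (uN + τ / (N * rho a u)) α y p -
      ((4 * Real.pi * a ^ 2 / N * (p * exp (-α * p) * expQuot (α * p)).im : ℝ) : ℂ))‖ ≤
      D₁ * (1 / √N) := by
    rw [norm_mul, norm_real, Real.norm_of_nonneg hq0]
    have h1 : q ≤ N * (W / (4 * Real.pi ^ 2 * a ^ 4 * (1 / (Real.pi * b)))) := by
      rw [hq, mul_div_assoc]
      gcongr
    calc _ ≤ N * (W / (4 * Real.pi ^ 2 * a ^ 4 * (1 / (Real.pi * b)))) * (C₁ / (N * √N)) := by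
          gcongr
      _ = D₁ * (1 / √N) := by
          rw [hD₁, mul_comm (N : ℝ) √N, ← div_div]
          field_simp
  have herr₂ : ‖((Real.exp (omegaZero a u * τ) / z.im *
        (p * expQuot (-(α * p)) - z * expQuot (-(α * z))).im : ℝ) : ℂ)‖ ≤ D₂ * e := by
    rw [norm_real, Real.norm_eq_abs, abs_mul, abs_of_nonneg (by positivity)]
    have h1 := (abs_im_le_norm _).trans (norm_mul_expQuot_sub_le hαA hpB hzB)
    rw [← hL] at h1
    calc _ ≤ W / (a ^ 2 / b) * (L * (k * e)) := by
          gcongr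
          exact h1.trans (by gcongr)
      _ = _ := by rw [hD₂]; ring
  rw [hsplit]
  have hs : 0 ≤ 1 / √(N : ℝ) := by positivity
  have hx1 := mul_nonneg hD₁0 he0
  have hx2 := mul_nonneg hD₂0 hs
  calc _ ≤ D₁ * (1 / √N) + D₂ * e := (norm_add_le _ _).trans (add_le_add herr₁ herr₂)
    _ ≤ _ := by linarith

end

end WignerKernel

end

theorem lemma3p2 (a : ℝ) (ha : 0 < a) (κ : ℝ) (hκ : 0 < κ)
    (ξ : ℝ) (hξ0 : 0 < ξ) (hξ : ξ ≤ 1 / 2) (K : Set ℝ) (hK : IsCompact K) :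
    ∃ R₀ > (0 : ℝ), ∃ η₀ > (0 : ℝ), ∀ (C₀ : ℝ) (ε : ℕ → ℝ), Tendsto ε atTop (𝓝 0) →
      ∃ C : ℝ, ∀ N : ℕ, 1 ≤ N → ∀ y ∈ WignerKernel.goodPoints R₀ η₀ ξ C₀ N,
        ∀ τ ∈ K, ∀ u : ℝ, |u| ≤ Real.sqrt (1 / 2 + 2 * a ^ 2) →
          ∀ uN : ℝ, |uN - u| ≤ ε N →
            ‖1 / ((N : ℂ) * (WignerKernel.rho a u : ℂ)) *
                WignerKernel.conjKernel κ a
                  (WignerKernel.omegaZero a u * (N * WignerKernel.rho a u)) y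
                  uN (uN + τ / (N * WignerKernel.rho a u)) -
              (Real.sinc (Real.pi * τ) : ℂ)‖
              ≤ C * (|u - uN| + (N : ℝ) ^ (-ξ)) := by
  obtain ⟨R, hR, η, hη, e₀, he₀, hlarge⟩ := WignerKernel.exists_norm_rescaledKernel_sub_le ha
  refine ⟨R, hR, η, hη, fun C₀ ε hε => ?_⟩
  obtain ⟨T, hT⟩ : ∃ T : ℝ, ∀ τ ∈ K, |τ| ≤ T := by
    obtain ⟨T, hT⟩ := hK.isBounded.exists_norm_le
    exact ⟨T, hT⟩
  obtain ⟨E, hE⟩ : ∃ E : ℝ, ∀ N, |ε N| ≤ E := by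
    obtain ⟨E, hE⟩ := (Metric.isBounded_range_of_tendsto ε hε).exists_norm_le
    exact ⟨E, fun N => hE _ ⟨N, rfl⟩⟩
  have hE0 : 0 ≤ E := (abs_nonneg _).trans (hE 0)
  have hτT : ∀ τ ∈ K, |τ| ≤ max T 0 := fun τ hτ => (hT τ hτ).trans (le_max_left _ _)
  obtain ⟨C₁, hC₁, hlarge⟩ := hlarge (max T 0) E (le_max_right _ _) hE0
  have hsmall : ∀ N : ℕ, ∃ D : ℝ, 0 ≤ D ∧ (1 ≤ N → ∀ (y : Fin N → ℝ) (τ u uN : ℝ),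
      |τ| ≤ max T 0 → |u| ≤ Real.sqrt (1 / 2 + 2 * a ^ 2) → |uN - u| ≤ E →
      ‖WignerKernel.rescaledKernel κ a u τ uN y - (Real.sinc (Real.pi * τ) : ℂ)‖ ≤ D) := by
    intro N
    rcases Nat.eq_zero_or_pos N with h0 | h0
    · exact ⟨0, le_rfl, fun h => by omega⟩
    · obtain ⟨D, hD⟩ := WignerKernel.exists_norm_rescaledKernel_le ha hκ (max T 0) E h0
      refine ⟨|D| + 1, by positivity, fun _ y τ u uN h1 h2 h3 => ?_⟩
      refine (norm_sub_le _ _).trans (add_le_add ((hD y τ u uN h1 h2 h3).trans (le_abs_self D)) ?_)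
      rw [Complex.norm_real, Real.norm_eq_abs]
      exact Real.abs_sinc_le_one _
  choose D hD0 hD using hsmall
  have hpow : Tendsto (fun N : ℕ => (N : ℝ) ^ (-ξ)) atTop (𝓝 0) :=
    (tendsto_rpow_neg_atTop hξ0).comp tendsto_natCast_atTop_atTop
  have hlim : Tendsto (fun N : ℕ => ε N / a ^ 2 + C₀ * (N : ℝ) ^ (-ξ) / η) atTop (𝓝 0) := by
    have := (hε.div_const (a ^ 2)).add ((hpow.const_mul C₀).div_const η)
    simpa using this
  obtain ⟨N₀, hN₀⟩ := eventually_atTop.mp (hlim.eventually (eventually_le_nhds he₀))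
  -- `C₂` serves the finitely many `N < N₀`, for which `N^{-ξ}` is bounded below
  set C₂ := ∑ N ∈ Finset.range N₀, D N * (N : ℝ) ^ ξ with hC₂
  have hC₂0 : 0 ≤ C₂ := Finset.sum_nonneg fun N _ => mul_nonneg (hD0 N) (by positivity)
  set C₃ := C₁ * (1 / a ^ 2 + |C₀| / η + 1) with hC₃
  have hC₃0 : 0 ≤ C₃ := by positivity
  refine ⟨C₂ + C₃, fun N hN y hy τ hτ u hu uN huN => ?_⟩
  change ‖WignerKernel.rescaledKernel κ a u τ uN y - (Real.sinc (Real.pi * τ) : ℂ)‖ ≤ _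
  have hN0 : (0 : ℝ) < N := by exact_mod_cast hN
  have huE : |uN - u| ≤ E := huN.trans ((le_abs_self _).trans (hE N))
  have hX0 : 0 ≤ |u - uN| + (N : ℝ) ^ (-ξ) := by positivity
  rcases lt_or_ge N N₀ with h | h
  · calc _ ≤ D N := hD N hN y τ u uN (hτT τ hτ) hu huE
      _ = D N * (N : ℝ) ^ ξ * (N : ℝ) ^ (-ξ) := by
          rw [mul_assoc, ← Real.rpow_add hN0, add_neg_cancel, Real.rpow_zero, mul_one]
      _ ≤ C₂ * (N : ℝ) ^ (-ξ) := by
          gcongr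
          exact Finset.single_le_sum (f := fun N : ℕ => D N * (N : ℝ) ^ ξ)
            (fun N _ => mul_nonneg (hD0 N) (by positivity)) (Finset.mem_range.mpr h)
      _ ≤ (C₂ + C₃) * (|u - uN| + (N : ℝ) ^ (-ξ)) := by
          gcongr
          · linarith
          · linarith [abs_nonneg (u - uN)]
  · have hN₁ : |u - uN| / a ^ 2 + C₀ * (N : ℝ) ^ (-ξ) / η ≤ e₀ := by
      refine le_trans ?_ (hN₀ N h)
      rw [abs_sub_comm]
      gcongr
    have h1 := hlarge κ hκ N y τ u uN (C₀ * (N : ℝ) ^ (-ξ) / η) hN (hτT τ hτ) hu huE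
      (fun z h1 h2 h3 => WignerKernel.norm_stieltjes_sub_le_of_mem_goodPoints hη hy h1 h2 h3) hN₁
    -- the relative error `N^{-1/2}` of Laplace's method is absorbed because `ξ ≤ 1/2`
    have hroot : 1 / √(N : ℝ) ≤ (N : ℝ) ^ (-ξ) := by
      rw [Real.sqrt_eq_rpow, one_div, ← Real.rpow_neg hN0.le]
      exact Real.rpow_le_rpow_of_exponent_le (by exact_mod_cast hN) (by linarith)
    refine h1.trans ?_
    have hb1 : |u - uN| / a ^ 2 + C₀ * (N : ℝ) ^ (-ξ) / η + 1 / √(N : ℝ) ≤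
        (1 / a ^ 2 + |C₀| / η + 1) * (|u - uN| + (N : ℝ) ^ (-ξ)) := by
      have hx : 0 ≤ (N : ℝ) ^ (-ξ) := by positivity
      have e1 : C₀ * (N : ℝ) ^ (-ξ) / η ≤ |C₀| / η * (N : ℝ) ^ (-ξ) := by
        rw [mul_div_right_comm]
        gcongr
        exact le_abs_self _
      have e2 : 0 ≤ (|C₀| / η + 1) * |u - uN| := by positivity
      have e3 : 0 ≤ 1 / a ^ 2 * (N : ℝ) ^ (-ξ) := by positivity
      have e4 : |u - uN| / a ^ 2 = 1 / a ^ 2 * |u - uN| := by ring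
      rw [e4]
      linarith
    calc _ ≤ C₁ * ((1 / a ^ 2 + |C₀| / η + 1) * (|u - uN| + (N : ℝ) ^ (-ξ))) := by gcongr
      _ = C₃ * (|u - uN| + (N : ℝ) ^ (-ξ)) := by rw [hC₃]; ring
      _ ≤ _ := by gcongr; linarith
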